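/- Let $1\to\mathbb{T}\to\widehat\Gamma\xrightarrow{q}\Gamma\to1$ be a central extension of Lie groups by the unit circle $\mathbb T$ (so $q$ is in particular a principal $\mathbb T$-bundle), with induced extension $0\to i\mathbb R\to\mathrm{Lie}\,\widehat\Gamma\xrightarrow{q_*}\mathrm{Lie}\,\Gamma\to0$; Lie groups and manifolds are smooth and modelled on Banach spaces (for instance finite-dimensional). $\Gamma$ acts on $\mathrm{Lie}\,\widehat\Gamma$ by $\mathrm{Ad}_\gamma=\mathrm{Ad}_{\hat\gamma}$ for any $\hat\gamma$ with $q(\hat\gamma)=\gamma$. Let $\pi:B\to X$ be a principal $\Gamma$-bundle, $\theta$ a connection on $B$ with curvature $F_\theta=d\theta+\frac12[\theta,\theta]$, and $L$ a splitting, i.e. a vector bundle map $L:B\times_{\mathrm{Ad}}\mathrm{Lie}\,\widehat\Gamma\to B\times_{\mathrm{Ad}}i\mathbb R\cong X\times i\mathbb R$ which is the identity on $B\times_{\mathrm{Ad}}i\mathbb R$; write $L([b,\hat Y])=[b,\bar L(b,\hat Y)]$. A lifting of $B$ is a principal $\widehat\Gamma$-bundle $\hat\pi:\widehat B\to X$ with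 a smooth map $\hat q:\widehat B\to B$ over $X$ such that $\hat q(\hat b\hat\gamma)=\hat q(\hat b)q(\hat\gamma)$. A connection $\hat\theta$ on $\widehat B$ is compatible with $\theta$ if $q_*(\hat\theta)=\hat q^*\theta$, and its scalar curvature is the $i\mathbb R$-valued 2-form $K_{\hat\theta}=L\circ F_{\hat\theta}$ on $X$, where $F_{\hat\theta}$ is regarded as a 2-form on $X$ with values in $\widehat B\times_{\mathrm{Ad}}\mathrm{Lie}\,\widehat\Gamma\cong B\times_{\mathrm{Ad}}\mathrm{Lie}\,\widehat\Gamma$. Fix a (continuous) linear split $\sigma:\mathrm{Lie}\,\Gamma\to\mathrm{Lie}\,\widehat\Gamma$ of $q_*$, and put $Z_\sigma(\gamma,Y)=\mathrm{Ad}_\gamma\sigma(Y)-\sigma(\mathrm{Ad}_\gamma Y)$, $\omega_\sigma(Y,Z)=[\sigma(Y),\sigma(Z)]-\sigma([Y,Z])$ and $\nu_\sigma=\hat\mu-\sigma(q^*\mu)$, where $\hat\mu,\mu$ are the left-invariant Maurer–Cartan forms of $\widehat\Gamma,\Gamma$. Let $B^{[2]}=B\times_XB$ with projections $\pi_1,\pi_2$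 to $B$, let $\zeta:B^{[2]}\to\Gamma$ be defined by $b_1\zeta(b_1,b_2)=b_2$, and let $\rho:J_B=\zeta^*\widehat\Gamma\to B^{[2]}$ be the pulled-back $\mathbb T$-bundle, with the product induced by that of $\widehat\Gamma$. The lifting bundle gerbe of $(B,\theta,L)$ is $(J_B,B)$ with the connection $\nabla_{\theta,\sigma}=\zeta^*\nu_\sigma+\rho^*Z_\sigma(\zeta^{-1},\pi_1^*\theta)$ and the curving $f_{\theta,\sigma}=-\frac12\omega_\sigma(\theta,\theta)-\kappa_{\theta,\sigma}$ on $B$, where $\kappa_{\theta,\sigma}(b;V,W)=\bar L(b,\sigma(F_\theta(b;V,W)))$. A bundle gerbe with connection and curving $(P,Y,\nabla,f)$ over $X$ is trivial if it is isomorphic to $(\delta(Q),Y',\delta(\alpha),F_\alpha)$ for some manifold $Y'$ over $X$, some principal $\mathbb T$-bundle $Q\to Y'$ and some connection $\alpha$ on $Q$, where $\delta(Q)=\pi_1^*Q^*\otimes\pi_2^*Q$ over $Y'^{[2]}=Y'\times_XY'$ has the contraction product and $\delta(\alpha)=-\pi_1^*\alpha+\pi_2^*\alpha$; an isomorphism consists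 of a diffeomorphism $F:Y\to Y'$ over $X$ and an isomorphism $P\to\delta(Q)$ of $\mathbb T$-bundles covering $F^{[2]}$ which respects the products and the connections, with $F^*F_\alpha=f$. Then $B$ admits a lifting with a connection compatible with $\theta$ whose scalar curvature vanishes if and only if the lifting bundle gerbe $(J_B,\nabla_{\theta,\sigma},f_{\theta,\sigma})$ is trivial as a bundle gerbe with connection and curving. -/

import Mathlib

open scoped Manifold ContDiff

noncomputable section

namespace LiftGerbe

/-! Manifolds are smooth (`C^∞`), without boundary, and modelled on a real Banach space `E`
(finite-dimensional manifolds being the case of a finite-dimensional `E`).  Tangent spaces are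
those of Mathlib; the Lie algebra `GroupLieAlgebra 𝓘(ℝ, E) G = T_1 G` of a Lie group modelled on
`E` has `E` as its underlying Banach space. -/

section Forms

variable {E : Type*} [NormedAddCommGroup E] [NormedSpace ℝ E]
  {H : Type*} [TopologicalSpace H] (I : ModelWithCorners ℝ E H)
  (M : Type*) [TopologicalSpace M] [ChartedSpace H M]
  (V : Type*) [NormedAddCommGroup V] [NormedSpace ℝ V]

/-- (Not necessarily smooth) 1-forms on `M` with values in `V`. -/
abbrev OneForm := ∀ p : M, TangentSpace I p →L[ℝ] V

/-- `V`-valued functions of a point of `M` and two tangent vectors at it. -/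
abbrev TwoForm := ∀ p : M, TangentSpace I p → TangentSpace I p → V

end Forms

section ExteriorDerivative

variable {E : Type*} [NormedAddCommGroup E] [NormedSpace ℝ E]
  {M : Type*} [TopologicalSpace M] [ChartedSpace E M]
  {V : Type*} [NormedAddCommGroup V] [NormedSpace ℝ V]

/-- Smoothness of a 1-form, as a function on the total space of the tangent bundle. -/
def IsSmoothForm [IsManifold 𝓘(ℝ, E) ∞ M] (η : OneForm 𝓘(ℝ, E) M V) : Prop :=
  ContMDiff 𝓘(ℝ, E).tangent 𝓘(ℝ, V) ∞
    (fun v : TangentBundle 𝓘(ℝ, E) M => η v.proj v.snd)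

/-- The local expression of a 1-form in the preferred chart at `p`: its pull-back under the
inverse of the chart. -/
def formInChart (η : OneForm 𝓘(ℝ, E) M V) (p : M) (y : E) : E →L[ℝ] V :=
  (η ((extChartAt 𝓘(ℝ, E) p).symm y)).comp
    (mfderiv 𝓘(ℝ, E) 𝓘(ℝ, E) (extChartAt 𝓘(ℝ, E) p).symm y)

/-- The exterior derivative of a 1-form, computed at `p` in the preferred chart at `p`, with the
convention `dη(v, w) = v(η(w)) - w(η(v)) - η([v, w])`. -/
def extDer (η : OneForm 𝓘(ℝ, E) M V) : TwoForm 𝓘(ℝ, E) M V := fun p v w =>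
  let φ := extChartAt 𝓘(ℝ, E) p
  let v' : E := mfderiv 𝓘(ℝ, E) 𝓘(ℝ, E) φ p v
  let w' : E := mfderiv 𝓘(ℝ, E) 𝓘(ℝ, E) φ p w
  fderiv ℝ (formInChart η p) (φ p) v' w' - fderiv ℝ (formInChart η p) (φ p) w' v'

end ExteriorDerivative

section LieGroups

variable {E : Type*} [NormedAddCommGroup E] [NormedSpace ℝ E]
  {G : Type*} [TopologicalSpace G] [ChartedSpace E G] [Group G]

variable (G) in
/-- The Lie bracket of `Lie G`. -/
def lieBr (X Y : E) : E :=
  @Bracket.bracket (GroupLieAlgebra 𝓘(ℝ, E) G) (GroupLieAlgebra 𝓘(ℝ, E) G) _ X Y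

/-- The adjoint action `Ad_g` of `G` on `Lie G`. -/
def Ad (g : G) : E →L[ℝ] E :=
  mfderiv 𝓘(ℝ, E) 𝓘(ℝ, E) (fun x : G => g * x * g⁻¹) 1

/-- The (left-invariant) Maurer-Cartan form of `G`. -/
def maurerCartan : OneForm 𝓘(ℝ, E) G E := fun g =>
  mfderiv 𝓘(ℝ, E) 𝓘(ℝ, E) (fun x : G => g⁻¹ * x) g

end LieGroups

/-- The Lie algebra `iℝ` of the circle group `𝕋`. -/
abbrev LieT := EuclideanSpace ℝ (Fin 1)

/-- A smooth principal `G`-bundle `proj : P → X`, with `G` acting on the right. -/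
structure PrincipalBundle
    (EG : Type*) [NormedAddCommGroup EG] [NormedSpace ℝ EG]
    (G : Type*) [TopologicalSpace G] [ChartedSpace EG G] [Group G]
    (EP : Type*) [NormedAddCommGroup EP] [NormedSpace ℝ EP]
    (P : Type*) [TopologicalSpace P] [ChartedSpace EP P]
    (EX : Type*) [NormedAddCommGroup EX] [NormedSpace ℝ EX]
    (X : Type*) [TopologicalSpace X] [ChartedSpace EX X] where
  proj : P → X
  act : P → G → P
  act_one : ∀ p, act p 1 = p
  act_mul : ∀ p g h, act p (g * h) = act (act p g) h
  proj_act : ∀ p g, proj (act p g) = proj p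
  contMDiff_proj : ContMDiff 𝓘(ℝ, EP) 𝓘(ℝ, EX) ∞ proj
  contMDiff_act : ContMDiff (𝓘(ℝ, EP).prod 𝓘(ℝ, EG)) 𝓘(ℝ, EP) ∞
    (fun x : P × G => act x.1 x.2)
  /-- Around every point of the base there is a smooth equivariant trivialization. -/
  locally_trivial : ∀ x : X, ∃ e : Bundle.Trivialization G proj, x ∈ e.baseSet ∧
    ContMDiffOn 𝓘(ℝ, EP) (𝓘(ℝ, EX).prod 𝓘(ℝ, EG)) ∞ e e.source ∧
    ContMDiffOn (𝓘(ℝ, EX).prod 𝓘(ℝ, EG)) 𝓘(ℝ, EP) ∞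
      e.toOpenPartialHomeomorph.symm e.target ∧
    ∀ p ∈ e.source, ∀ g : G, (e (act p g)).2 = (e p).2 * g

section Connections

variable {EG : Type*} [NormedAddCommGroup EG] [NormedSpace ℝ EG]
  {G : Type*} [TopologicalSpace G] [ChartedSpace EG G] [Group G]
  {EP : Type*} [NormedAddCommGroup EP] [NormedSpace ℝ EP]
  {P : Type*} [TopologicalSpace P] [ChartedSpace EP P]
  {EX : Type*} [NormedAddCommGroup EX] [NormedSpace ℝ EX]
  {X : Type*} [TopologicalSpace X] [ChartedSpace EX X]

theorem PrincipalBundle.act_injective {B : PrincipalBundle EG G EP P EX X} (p : P) {g h : G}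
    (e : B.act p g = B.act p h) : g = h := by
  obtain ⟨t, ht, -, -, hact⟩ := B.locally_trivial (B.proj p)
  have hp : p ∈ t.source := t.mem_source.2 ht
  have h2 := (hact p hp g).symm.trans ((congrArg (fun x => (t x).2) e).trans (hact p hp h))
  exact mul_left_cancel h2

theorem PrincipalBundle.exists_act {B : PrincipalBundle EG G EP P EX X} {p p' : P}
    (e : B.proj p = B.proj p') : ∃ g, B.act p g = p' := by
  obtain ⟨t, ht, -, -, hact⟩ := B.locally_trivial (B.proj p)
  have hp : p ∈ t.source := t.mem_source.2 ht
  have hp' : p' ∈ t.source := t.mem_source.2 (e ▸ ht)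
  refine ⟨(t p).2⁻¹ * (t p').2, ?_⟩
  have hg : B.act p ((t p).2⁻¹ * (t p').2) ∈ t.source :=
    t.mem_source.2 ((B.proj_act p _).symm ▸ ht)
  refine t.injOn hg hp' (Prod.ext ?_ ?_)
  · exact (t.coe_fst hg).trans ((B.proj_act p _).trans (e.trans (t.coe_fst hp').symm))
  · exact (hact p hp _).trans (mul_inv_cancel_left _ _)

/-- The value at `p` of the fundamental vector field generated by an element of `Lie G`. -/
def PrincipalBundle.fundamental (B : PrincipalBundle EG G EP P EX X) (p : P) :
    EG →L[ℝ] TangentSpace 𝓘(ℝ, EP) p :=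
  (mfderiv 𝓘(ℝ, EG) 𝓘(ℝ, EP) (fun g : G => B.act p g) 1 : EG →L[ℝ] EP)

/-- A connection on a principal bundle, as a `Lie G`-valued 1-form on the total space. -/
structure Connection [IsManifold 𝓘(ℝ, EP) ∞ P] (B : PrincipalBundle EG G EP P EX X) where
  form : OneForm 𝓘(ℝ, EP) P EG
  smooth : IsSmoothForm form
  form_fundamental : ∀ p (Z : EG), form p (B.fundamental p Z) = Z
  form_act : ∀ p (g : G) (v : TangentSpace 𝓘(ℝ, EP) p),
    form (B.act p g) (mfderiv 𝓘(ℝ, EP) 𝓘(ℝ, EP) (fun x : P => B.act x g) p v)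
      = Ad g⁻¹ (form p v)

variable [IsManifold 𝓘(ℝ, EP) ∞ P] {B : PrincipalBundle EG G EP P EX X}

/-- The curvature `F_θ = dθ + (1/2)[θ, θ]` on the total space, where
`(1/2)[θ, θ](v, w) = [θ(v), θ(w)]`. -/
def Connection.curvature (θ : Connection B) : TwoForm 𝓘(ℝ, EP) P EG := fun p v w =>
  extDer θ.form p v w + lieBr G (θ.form p v) (θ.form p w)

/-- The 2-form `F` on the base `X` pulls back to the 2-form `K` on the total space. -/
def PrincipalBundle.PullsBackTo (B : PrincipalBundle EG G EP P EX X) {V : Type*}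
    [NormedAddCommGroup V] [NormedSpace ℝ V]
    (F : TwoForm 𝓘(ℝ, EX) X V) (K : TwoForm 𝓘(ℝ, EP) P V) : Prop :=
  ∀ p v w, F (B.proj p) (mfderiv 𝓘(ℝ, EP) 𝓘(ℝ, EX) B.proj p v)
    (mfderiv 𝓘(ℝ, EP) 𝓘(ℝ, EX) B.proj p w) = K p v w

end Connections

/-! ### Central extensions by the circle group -/

section CentralExtensions

/-- A central extension `1 → 𝕋 → Ĝ → G → 1` of Lie groups: an exact sequence of smooth
homomorphisms with central image of `𝕋`, for which `q : Ĝ → G` is a principal `𝕋`-bundle. -/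
structure CentralExtension
    (EH : Type*) [NormedAddCommGroup EH] [NormedSpace ℝ EH]
    (Ghat : Type*) [TopologicalSpace Ghat] [ChartedSpace EH Ghat] [Group Ghat]
    (EG : Type*) [NormedAddCommGroup EG] [NormedSpace ℝ EG]
    (G : Type*) [TopologicalSpace G] [ChartedSpace EG G] [Group G] where
  incl : Circle →* Ghat
  q : Ghat →* G
  contMDiff_incl : ContMDiff 𝓘(ℝ, LieT) 𝓘(ℝ, EH) ∞ incl
  contMDiff_q : ContMDiff 𝓘(ℝ, EH) 𝓘(ℝ, EG) ∞ q
  incl_injective : Function.Injective incl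
  ker_q : ∀ g, q g = 1 ↔ g ∈ Set.range incl
  q_surjective : Function.Surjective q
  central : ∀ z g, incl z * g = g * incl z
  bundle : PrincipalBundle LieT Circle EH Ghat EG G
  bundle_proj : bundle.proj = q
  bundle_act : ∀ g z, bundle.act g z = g * incl z

variable {EH : Type*} [NormedAddCommGroup EH] [NormedSpace ℝ EH]
  {Ghat : Type*} [TopologicalSpace Ghat] [ChartedSpace EH Ghat] [Group Ghat]
  {EG : Type*} [NormedAddCommGroup EG] [NormedSpace ℝ EG]
  {G : Type*} [TopologicalSpace G] [ChartedSpace EG G] [Group G]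

namespace CentralExtension

variable (C : CentralExtension EH Ghat EG G)

/-- The inclusion `Lie 𝕋 = iℝ → Lie Ĝ`. -/
def dincl : LieT →L[ℝ] EH := mfderiv 𝓘(ℝ, LieT) 𝓘(ℝ, EH) C.incl 1

/-- The projection `q_* : Lie Ĝ → Lie G`. -/
def dq : EH →L[ℝ] EG := mfderiv 𝓘(ℝ, EH) 𝓘(ℝ, EG) C.q 1

theorem exists_retraction : ∃ r : EH →L[ℝ] LieT, ∀ z, r (C.dincl z) = z := by
  obtain ⟨e, he, hs, -, hact⟩ := C.bundle.locally_trivial (C.bundle.proj (C.incl 1))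
  have hmem : (C.incl 1 : Ghat) ∈ e.source := e.mem_source.2 he
  let ρ : Ghat → Circle := fun g => (e (C.incl 1)).2⁻¹ * (e g).2
  have hρ : ρ ∘ C.incl = id := by
    funext z
    have h := hact _ hmem z
    rw [C.bundle_act, ← map_mul, one_mul] at h
    simp [ρ, h]
  have hsm : ContMDiffAt 𝓘(ℝ, EH) 𝓘(ℝ, LieT) ∞ ρ (C.incl 1) := by
    have h1 : ContMDiffAt 𝓘(ℝ, EH) (𝓘(ℝ, EG).prod 𝓘(ℝ, LieT)) ∞ e (C.incl 1) :=
      hs.contMDiffAt (e.open_source.mem_nhds hmem)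
    have : LieGroup 𝓘(ℝ, LieT) ∞ Circle := LieGroup.of_le (m := ∞) (n := ω) le_top
    have h2 : ContMDiff 𝓘(ℝ, LieT) 𝓘(ℝ, LieT) ∞
        (fun z : Circle => (e (C.incl 1)).2⁻¹ * z) := contMDiff_mul_left
    exact h2.contMDiffAt.comp _ (contMDiffAt_snd.comp _ h1)
  refine ⟨mfderiv 𝓘(ℝ, EH) 𝓘(ℝ, LieT) ρ (C.incl 1), fun z => ?_⟩
  have hc := mfderiv_comp (1 : Circle) (hsm.mdifferentiableAt (by simp))
    (C.contMDiff_incl.contMDiffAt.mdifferentiableAt (by simp))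
  rw [hρ, mfderiv_id] at hc
  exact (DFunLike.congr_fun hc z).symm

/-- The inverse of the inclusion `iℝ → Lie Ĝ`, extended to a continuous linear map on `Lie Ĝ`.
It is only used on elements of the image `ker q_*` of `iℝ`, where it does not depend on the
extension chosen. -/
def scalar : EH →L[ℝ] LieT := C.exists_retraction.choose

/-- The action of `G` on `Lie Ĝ` by `Ad_γ = Ad_γ̂` for any `γ̂` with `q(γ̂) = γ`. -/
def AdHat (g : G) : EH →L[ℝ] EH := Ad (Function.surjInv C.q_surjective g)

/-- A (continuous) split of `0 → iℝ → Lie Ĝ → Lie G → 0` as vector spaces. -/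
def IsSplit (σ : EG →L[ℝ] EH) : Prop := ∀ Y, C.dq (σ Y) = Y

/-- The group cocycle `Z_σ(γ, Y) = Ad_γ σ(Y) - σ(Ad_γ Y)`, with values in `iℝ`. -/
def groupCocycle (σ : EG →L[ℝ] EH) (g : G) : EG →L[ℝ] LieT :=
  C.scalar.comp ((C.AdHat g).comp σ - σ.comp (Ad g))

/-- The Lie algebra cocycle `ω_σ(Y, Z) = [σ(Y), σ(Z)] - σ([Y, Z])`, with values in `iℝ`. -/
def lieCocycle (σ : EG →L[ℝ] EH) (Y Z : EG) : LieT :=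
  C.scalar (lieBr Ghat (σ Y) (σ Z) - σ (lieBr G Y Z))

/-- The `iℝ`-valued 1-form `ν_σ = μ̂ - σ(q^*μ)` on `Ĝ`, where `μ̂` and `μ` are the Maurer-Cartan
forms of `Ĝ` and `G`. -/
def nu (σ : EG →L[ℝ] EH) : OneForm 𝓘(ℝ, EH) Ghat LieT := fun g =>
  C.scalar.comp (maurerCartan g -
    σ.comp ((maurerCartan (C.q g)).comp (mfderiv 𝓘(ℝ, EH) 𝓘(ℝ, EG) C.q g)))

end CentralExtension

end CentralExtensions

/-! ### Associated bundles and splittings, liftings, scalar curvature -/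

section Lifting

variable {EH : Type*} [NormedAddCommGroup EH] [NormedSpace ℝ EH]
  {Ghat : Type*} [TopologicalSpace Ghat] [ChartedSpace EH Ghat] [Group Ghat]
  {EG : Type*} [NormedAddCommGroup EG] [NormedSpace ℝ EG]
  {G : Type*} [TopologicalSpace G] [ChartedSpace EG G] [Group G]
  {EX : Type*} [NormedAddCommGroup EX] [NormedSpace ℝ EX]
  {X : Type*} [TopologicalSpace X] [ChartedSpace EX X]
  {EB : Type*} [NormedAddCommGroup EB] [NormedSpace ℝ EB]
  {B : Type*} [TopologicalSpace B] [ChartedSpace EB B]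

/-- The associated bundle `B ×_ρ V`: the quotient of `B × V` by `(b, v) ∼ (bγ, ρ(γ⁻¹)v)`. -/
def AssocBundle (β : PrincipalBundle EG G EB B EX X) {V : Type*} (ρ : G → V → V) : Type _ :=
  Quot (fun x y : B × V => ∃ g : G, y = (β.act x.1 g, ρ g⁻¹ x.2))

/-- The class `[b, v]` in the associated bundle. -/
def AssocBundle.mk (β : PrincipalBundle EG G EB B EX X) {V : Type*} (ρ : G → V → V)
    (b : B) (v : V) : AssocBundle β ρ :=
  Quot.mk _ (b, v)

/-- A splitting of `B`: a smooth vector bundle map `L : B ×_Ad Lie Ĝ → B ×_Ad iℝ` over `X` which is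
the identity on the subbundle `B ×_Ad iℝ` (on `iℝ` the adjoint action is trivial).  That `L` is
a smooth vector bundle map over `X` is expressed by the map `bar`, with
`L([b, Y]) = [b, bar(b, Y)]`, which is linear in `Y` and smooth. -/
structure Splitting (C : CentralExtension EH Ghat EG G)
    (β : PrincipalBundle EG G EB B EX X) where
  L : AssocBundle β (fun g (Y : EH) => C.AdHat g Y) → AssocBundle β (fun (_ : G) (z : LieT) => z)
  bar : B → EH →L[ℝ] LieT
  L_mk : ∀ b Y, L (AssocBundle.mk β _ b Y) = AssocBundle.mk β _ b (bar b Y)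
  smooth_bar : ContMDiff (𝓘(ℝ, EB).prod 𝓘(ℝ, EH)) 𝓘(ℝ, LieT) ∞
    (fun x : B × EH => bar x.1 x.2)
  L_incl : ∀ b z, L (AssocBundle.mk β _ b (C.dincl z)) = AssocBundle.mk β _ b z

/-- A lifting of the `G`-bundle `B` to a `Ĝ`-bundle. -/
structure Lifting (C : CentralExtension EH Ghat EG G) (β : PrincipalBundle EG G EB B EX X)
    (EL : Type*) [NormedAddCommGroup EL] [NormedSpace ℝ EL]
    (Bhat : Type*) [TopologicalSpace Bhat] [ChartedSpace EL Bhat] where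
  bundle : PrincipalBundle EH Ghat EL Bhat EX X
  qhat : Bhat → B
  contMDiff_qhat : ContMDiff 𝓘(ℝ, EL) 𝓘(ℝ, EB) ∞ qhat
  proj_qhat : ∀ b, β.proj (qhat b) = bundle.proj b
  qhat_act : ∀ b g, qhat (bundle.act b g) = β.act (qhat b) (C.q g)

variable {EL : Type*} [NormedAddCommGroup EL] [NormedSpace ℝ EL]
  {Bhat : Type*} [TopologicalSpace Bhat] [ChartedSpace EL Bhat] [IsManifold 𝓘(ℝ, EL) ∞ Bhat]
  [IsManifold 𝓘(ℝ, EB) ∞ B]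
  {C : CentralExtension EH Ghat EG G} {β : PrincipalBundle EG G EB B EX X}

/-- The connection `θ̂` on the lifting is compatible with `θ`: `q_*(θ̂) = q̂^*θ`. -/
def Lifting.IsCompatible (Λ : Lifting C β EL Bhat) (θ : Connection β)
    (θhat : Connection Λ.bundle) : Prop :=
  ∀ b v, C.dq (θhat.form b v) =
    θ.form (Λ.qhat b) (mfderiv 𝓘(ℝ, EL) 𝓘(ℝ, EB) Λ.qhat b v)

/-- The 2-form `K` on `X` is the scalar curvature `L ∘ F_θ̂`: under the identification of 2-forms on
`X` with values in `B ×_Ad Lie Ĝ` with horizontal equivariant `Lie Ĝ`-valued 2-forms on `B̂`, its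
pull-back to `B̂` is `bar(q̂(b̂), F_θ̂)`. -/
def Lifting.IsScalarCurvature (Λ : Lifting C β EL Bhat) (L : Splitting C β)
    (θhat : Connection Λ.bundle) (K : TwoForm 𝓘(ℝ, EX) X LieT) : Prop :=
  Λ.bundle.PullsBackTo K (fun b v w => L.bar (Λ.qhat b) (θhat.curvature b v w))

end Lifting

/-! ### Bundle gerbes with connection and curving -/

section BundleGerbes

/-- A bundle gerbe `(P, Y)` over `X` together with a 1-form `conn` on `P` and a 2-form `curving` on
`Y`.  The map `(fst, snd) : P → Y^[2]` is the projection of the `𝕋`-bundle `P`.  Whatever further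
conditions (smoothness, compatibility of the two forms) make this a bundle gerbe with connection
and curving are conditions on the object and not additional data; they play no role in the notion
of isomorphism, and so are not recorded here. -/
structure BundleGerbe (X : Type*)
    (EY : Type*) [NormedAddCommGroup EY] [NormedSpace ℝ EY]
    (Y : Type*) [TopologicalSpace Y] [ChartedSpace EY Y]
    {EP : Type*} [NormedAddCommGroup EP] [NormedSpace ℝ EP]
    {HP : Type*} [TopologicalSpace HP] (IP : ModelWithCorners ℝ EP HP)
    (P : Type*) [TopologicalSpace P] [ChartedSpace HP P] where
  proj : Y → X
  fst : P → Y
  snd : P → Y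
  proj_fst : ∀ p, proj (fst p) = proj (snd p)
  exists_of_proj_eq : ∀ y₁ y₂, proj y₁ = proj y₂ → ∃ p, fst p = y₁ ∧ snd p = y₂
  act : P → Circle → P
  act_one : ∀ p, act p 1 = p
  act_mul : ∀ p u v, act p (u * v) = act (act p u) v
  fst_act : ∀ p u, fst (act p u) = fst p
  snd_act : ∀ p u, snd (act p u) = snd p
  /-- `𝕋` acts simply transitively on the fibres of `P → Y^[2]`. -/
  existsUnique_act : ∀ p p', fst p = fst p' → snd p = snd p' → ∃! u, act p u = p'
  /-- The product `P_(y₁, y₂) ⊗ P_(y₂, y₃) → P_(y₁, y₃)`. -/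
  mul : ∀ p p' : P, snd p = fst p' → P
  fst_mul : ∀ p p' h, fst (mul p p' h) = fst p
  snd_mul : ∀ p p' h, snd (mul p p' h) = snd p'
  mul_act : ∀ p p' h u v,
    mul (act p u) (act p' v) ((snd_act p u).trans (h.trans (fst_act p' v).symm)) =
      act (mul p p' h) (u * v)
  mul_assoc : ∀ p p' p'' h h',
    mul (mul p p' h) p'' ((snd_mul p p' h).trans h') =
      mul p (mul p' p'' h') (h.trans (fst_mul p' p'' h').symm)
  conn : OneForm IP P LieT
  curving : TwoForm 𝓘(ℝ, EY) Y LieT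

variable {X : Type*}
  {EY : Type*} [NormedAddCommGroup EY] [NormedSpace ℝ EY]
  {Y : Type*} [TopologicalSpace Y] [ChartedSpace EY Y]
  {EQ : Type*} [NormedAddCommGroup EQ] [NormedSpace ℝ EQ]
  {Q : Type*} [TopologicalSpace Q] [ChartedSpace EQ Q]

/-- The total space of the `𝕋`-bundle `δ(Q) = π₁^*Q^* ⊗ π₂^*Q` over `Y^[2]`: the quotient of
`Q ×_X Q` by the diagonal action of `𝕋`; the class of `(q₁, q₂)` is `q₁^* ⊗ q₂`. -/
def Delta (π : Y → X) (κ : PrincipalBundle LieT Circle EQ Q EY Y) : Type _ :=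
  Quot (fun x y : {x : Q × Q // π (κ.proj x.1) = π (κ.proj x.2)} =>
    ∃ z : Circle, y.1 = (κ.act x.1.1 z, κ.act x.1.2 z))

namespace Delta

variable (π : Y → X) (κ : PrincipalBundle LieT Circle EQ Q EY Y)

/-- The class `q₁^* ⊗ q₂`. -/
def mk (q₁ q₂ : Q) (h : π (κ.proj q₁) = π (κ.proj q₂)) : Delta π κ := Quot.mk _ ⟨(q₁, q₂), h⟩

/-- The first component of the projection `δ(Q) → Y^[2]`. -/
def fst : Delta π κ → Y := Quot.lift (fun x => κ.proj x.1.1) (by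
  rintro x y ⟨z, hz⟩
  simp [hz, κ.proj_act])

/-- The second component of the projection `δ(Q) → Y^[2]`. -/
def snd : Delta π κ → Y := Quot.lift (fun x => κ.proj x.1.2) (by
  rintro x y ⟨z, hz⟩
  simp [hz, κ.proj_act])

/-- The action of `𝕋` on `δ(Q)`: `(q₁^* ⊗ q₂)u = q₁^* ⊗ (q₂u)`. -/
def act (d : Delta π κ) (u : Circle) : Delta π κ :=
  Quot.map (fun x => ⟨(x.1.1, κ.act x.1.2 u), by rw [κ.proj_act]; exact x.2⟩) (by
    rintro x y ⟨z, hz⟩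
    refine ⟨z, ?_⟩
    simp [hz, ← κ.act_mul, mul_comm]) d

end Delta

variable {EP : Type*} [NormedAddCommGroup EP] [NormedSpace ℝ EP]
  {HP : Type*} [TopologicalSpace HP] {IP : ModelWithCorners ℝ EP HP}
  {P : Type*} [TopologicalSpace P] [ChartedSpace HP P]

/-- On the open set `U`, the map `Φ : P → δ(Q)` is the class of the pair `(a, b)` of smooth maps. -/
def IsLocalLift (IP : ModelWithCorners ℝ EP HP) {π : Y → X}
    {κ : PrincipalBundle LieT Circle EQ Q EY Y}
    (Φ : P → Delta π κ) (U : Set P) (a b : P → Q) : Prop :=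
  IsOpen U ∧ ContMDiffOn IP 𝓘(ℝ, EQ) ∞ a U ∧ ContMDiffOn IP 𝓘(ℝ, EQ) ∞ b U ∧
    ∀ p ∈ U, ∃ h, Φ p = Delta.mk π κ (a p) (b p) h

end BundleGerbes

section Trivial

variable {X : Type*}
  {EY : Type*} [NormedAddCommGroup EY] [NormedSpace ℝ EY]
  {Y : Type*} [TopologicalSpace Y] [ChartedSpace EY Y]
  {EP : Type*} [NormedAddCommGroup EP] [NormedSpace ℝ EP]
  {HP : Type*} [TopologicalSpace HP] {IP : ModelWithCorners ℝ EP HP}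
  {P : Type*} [TopologicalSpace P] [ChartedSpace HP P]
  {Y' : Type*} [TopologicalSpace Y'] [ChartedSpace EY Y']
  {EQ : Type*} [NormedAddCommGroup EQ] [NormedSpace ℝ EQ]
  {Q : Type*} [TopologicalSpace Q] [ChartedSpace EQ Q] [IsManifold 𝓘(ℝ, EQ) ∞ Q]

/-- An isomorphism `(Φ, F)` from a bundle gerbe with connection and curving `(P, Y, ∇, f)` to
`(δ(Q), Y', δ(α), F_α)`, where `α` is a connection on the `𝕋`-bundle `Q → Y'` and `Y'` is a
manifold over `X` by `π'`.  Here `δ(Q)` carries the quotient structure of `Q ×_X Q`: a map to `δ(Q)`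
is smooth if it lifts locally to a pair of smooth maps to `Q`, and `δ(α) = -π₁^*α + π₂^*α` is
computed from such lifts.  (A morphism of `𝕋`-bundles covering a diffeomorphism is an
isomorphism.) -/
structure IsoToDelta (𝒢 : BundleGerbe X EY Y IP P) (π' : Y' → X)
    (κ : PrincipalBundle LieT Circle EQ Q EY Y') (α : Connection κ) where
  F : Y ≃ₘ^∞⟮𝓘(ℝ, EY), 𝓘(ℝ, EY)⟯ Y'
  Φ : P → Delta π' κ
  proj_F : ∀ y, π' (F y) = 𝒢.proj y
  fst_Φ : ∀ p, Delta.fst π' κ (Φ p) = F (𝒢.fst p)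
  snd_Φ : ∀ p, Delta.snd π' κ (Φ p) = F (𝒢.snd p)
  Φ_act : ∀ p u, Φ (𝒢.act p u) = Delta.act π' κ (Φ p) u
  /-- `Φ` commutes with the products, that of `δ(Q)` being
  `(q₁^* ⊗ q₂) ⊗ (q₂^* ⊗ q₃) ↦ q₁^* ⊗ q₃`. -/
  Φ_mul : ∀ (p p' : P) (h : 𝒢.snd p = 𝒢.fst p') (q₁ q₂ q₃ : Q)
    (h₁₂ : π' (κ.proj q₁) = π' (κ.proj q₂)) (h₂₃ : π' (κ.proj q₂) = π' (κ.proj q₃)),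
    Φ p = Delta.mk π' κ q₁ q₂ h₁₂ → Φ p' = Delta.mk π' κ q₂ q₃ h₂₃ →
    Φ (𝒢.mul p p' h) = Delta.mk π' κ q₁ q₃ (h₁₂.trans h₂₃)
  smooth_Φ : ∀ p, ∃ U a b, p ∈ U ∧ IsLocalLift IP Φ U a b
  conn_eq : ∀ U a b, IsLocalLift IP Φ U a b → ∀ p ∈ U, ∀ v : TangentSpace IP p,
    𝒢.conn p v = -α.form (a p) (mfderiv IP 𝓘(ℝ, EQ) a p v) +
      α.form (b p) (mfderiv IP 𝓘(ℝ, EQ) b p v)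
  /-- The curvature `F_α` as a 2-form on `Y'`. -/
  curv : TwoForm 𝓘(ℝ, EY) Y' LieT
  curv_eq : κ.PullsBackTo curv α.curvature
  curving_eq : ∀ y v w, 𝒢.curving y v w =
    curv (F y) (mfderiv 𝓘(ℝ, EY) 𝓘(ℝ, EY) F y v) (mfderiv 𝓘(ℝ, EY) 𝓘(ℝ, EY) F y w)

end Trivial

section TrivialDef

universe uX uEY uY uEP uHP uP

/-- A bundle gerbe with connection and curving is trivial if it is isomorphic to
`(δ(Q), Y', δ(α), F_α)` for some `Y'`, some `𝕋`-bundle `Q → Y'` and some connection `α` on `Q`. -/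
def BundleGerbe.IsTrivial {X : Type uX}
    {EY : Type uEY} [NormedAddCommGroup EY] [NormedSpace ℝ EY]
    {Y : Type uY} [TopologicalSpace Y] [ChartedSpace EY Y]
    {EP : Type uEP} [NormedAddCommGroup EP] [NormedSpace ℝ EP]
    {HP : Type uHP} [TopologicalSpace HP] {IP : ModelWithCorners ℝ EP HP}
    {P : Type uP} [TopologicalSpace P] [ChartedSpace HP P]
    (𝒢 : BundleGerbe X EY Y IP P) : Prop :=
  ∃ (Y' : Type uY) (_ : TopologicalSpace Y') (_ : ChartedSpace EY Y')
    (_ : IsManifold 𝓘(ℝ, EY) ∞ Y') (π' : Y' → X)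
    (EQ : Type uEY) (_ : NormedAddCommGroup EQ) (_ : NormedSpace ℝ EQ) (_ : CompleteSpace EQ)
    (Q : Type uY) (_ : TopologicalSpace Q) (_ : ChartedSpace EQ Q)
    (_ : IsManifold 𝓘(ℝ, EQ) ∞ Q)
    (κ : PrincipalBundle LieT Circle EQ Q EY Y') (α : Connection κ),
    Nonempty (IsoToDelta 𝒢 π' κ α)

end TrivialDef

/-! ### The lifting bundle gerbe -/

section LiftingBundleGerbe

variable {EH : Type*} [NormedAddCommGroup EH] [NormedSpace ℝ EH]
  {Ghat : Type*} [TopologicalSpace Ghat] [ChartedSpace EH Ghat] [Group Ghat]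
  {EG : Type*} [NormedAddCommGroup EG] [NormedSpace ℝ EG]
  {G : Type*} [TopologicalSpace G] [ChartedSpace EG G] [Group G]
  {EX : Type*} [NormedAddCommGroup EX] [NormedSpace ℝ EX]
  {X : Type*} [TopologicalSpace X] [ChartedSpace EX X]
  {EB : Type*} [NormedAddCommGroup EB] [NormedSpace ℝ EB]
  {B : Type*} [TopologicalSpace B] [ChartedSpace EB B]

/-- The pull-back `J_B = ζ^*Ĝ` of `q : Ĝ → G` under `ζ : B^[2] → G`, `b₁ζ(b₁, b₂) = b₂`: the triples
`(b₁, b₂, γ̂)` with `q(γ̂) = ζ(b₁, b₂)`, that is, `b₁q(γ̂) = b₂`. -/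
def LiftJ (C : CentralExtension EH Ghat EG G) (β : PrincipalBundle EG G EB B EX X) : Type _ :=
  {x : B × B × Ghat // β.act x.1 (C.q x.2.2) = x.2.1}

variable (C : CentralExtension EH Ghat EG G) (β : PrincipalBundle EG G EB B EX X)

namespace LiftJ

instance : TopologicalSpace (LiftJ C β) :=
  inferInstanceAs (TopologicalSpace {x : B × B × Ghat // β.act x.1 (C.q x.2.2) = x.2.1})

/-- The global parametrization `(b, γ̂) ↦ (b, bq(γ̂), γ̂)` of `J_B ⊆ B × B × Ĝ` as a graph. -/
def homeo : LiftJ C β ≃ₜ B × Ghat where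
  toFun x := (x.1.1, x.1.2.2)
  invFun y := ⟨(y.1, β.act y.1 (C.q y.2), y.2), rfl⟩
  left_inv := by
    rintro ⟨⟨b₁, b₂, g⟩, h⟩
    exact Subtype.ext (Prod.ext rfl (Prod.ext h rfl))
  right_inv y := rfl
  continuous_toFun := by
    have h : Continuous (fun x : LiftJ C β => x.1) := continuous_subtype_val
    exact h.fst.prodMk h.snd.snd
  continuous_invFun := by
    refine Continuous.subtype_mk ?_ _
    refine continuous_fst.prodMk (Continuous.prodMk ?_ continuous_snd)
    exact β.contMDiff_act.continuous.comp
      (continuous_fst.prodMk (C.contMDiff_q.continuous.comp continuous_snd))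

/-- The manifold structure of `J_B` as a graph in `B × B × Ĝ`. -/
instance : ChartedSpace (ModelProd EB EH) (LiftJ C β) where
  atlas := {e | ∃ c ∈ atlas (ModelProd EB EH) (B × Ghat),
    e = (homeo C β).toOpenPartialHomeomorph.trans c}
  chartAt x := (homeo C β).toOpenPartialHomeomorph.trans (chartAt _ (homeo C β x))
  mem_chart_source x := by simp
  chart_mem_atlas x := ⟨_, chart_mem_atlas _ _, rfl⟩

instance [IsManifold 𝓘(ℝ, EB) ∞ B] [IsManifold 𝓘(ℝ, EH) ∞ Ghat] :
    IsManifold (𝓘(ℝ, EB).prod 𝓘(ℝ, EH)) ∞ (LiftJ C β) where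
  compatible := by
    rintro _ _ ⟨c, hc, rfl⟩ ⟨c', hc', rfl⟩
    have h := (contDiffGroupoid ∞ (𝓘(ℝ, EB).prod 𝓘(ℝ, EH))).compatible hc hc'
    refine (contDiffGroupoid ∞ (𝓘(ℝ, EB).prod 𝓘(ℝ, EH))).mem_of_eqOnSource h ?_
    rw [OpenPartialHomeomorph.trans_symm_eq_symm_trans_symm, OpenPartialHomeomorph.trans_assoc]
    refine OpenPartialHomeomorph.EqOnSource.trans' (Setoid.refl _) ?_
    rw [← OpenPartialHomeomorph.trans_assoc, ← Homeomorph.symm_toOpenPartialHomeomorph,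
      ← Homeomorph.trans_toOpenPartialHomeomorph]
    simp

end LiftJ

variable {β} [IsManifold 𝓘(ℝ, EB) ∞ B]

/-- The connection `∇_{θ,σ} = ζ^*ν_σ + ρ^*Z_σ(ζ⁻¹, π₁^*θ)` on the lifting bundle gerbe. -/
def liftConn (θ : Connection β) (σ : EG →L[ℝ] EH) :
    OneForm (𝓘(ℝ, EB).prod 𝓘(ℝ, EH)) (LiftJ C β) LieT := fun x =>
  (C.nu σ x.1.2.2).comp (mfderiv (𝓘(ℝ, EB).prod 𝓘(ℝ, EH)) 𝓘(ℝ, EH)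
      (fun y : LiftJ C β => y.1.2.2) x) +
  (C.groupCocycle σ (C.q x.1.2.2)⁻¹).comp ((θ.form x.1.1).comp
    (mfderiv (𝓘(ℝ, EB).prod 𝓘(ℝ, EH)) 𝓘(ℝ, EB) (fun y : LiftJ C β => y.1.1) x))

variable {C}

/-- The reduced splitting `l_σ(b, Y) = bar(b, σ(Y))` induced by a splitting. -/
def Splitting.reduced (L : Splitting C β) (σ : EG →L[ℝ] EH) (b : B) (Y : EG) : LieT :=
  L.bar b (σ Y)

/-- The curving `f_{θ,σ} = -(1/2)ω_σ(θ, θ) - l_σ(b, F_θ)`, where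
`(1/2)ω_σ(θ, θ)(v, w) = ω_σ(θ(v), θ(w))`. -/
def liftCurving (θ : Connection β) (L : Splitting C β) (σ : EG →L[ℝ] EH) :
    TwoForm 𝓘(ℝ, EB) B LieT := fun b v w =>
  -C.lieCocycle σ (θ.form b v) (θ.form b w) - L.reduced σ b (θ.curvature b v w)

/-- The lifting bundle gerbe `(J_B, ∇_{θ,σ}, f_{θ,σ})` over `X`, with the product induced by the
product of `Ĝ`. -/
def liftingBundleGerbe (θ : Connection β) (L : Splitting C β) (σ : EG →L[ℝ] EH) :
    BundleGerbe X EB B (𝓘(ℝ, EB).prod 𝓘(ℝ, EH)) (LiftJ C β) where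
  proj := β.proj
  fst x := x.1.1
  snd x := x.1.2.1
  proj_fst x := by rw [← x.2, β.proj_act]
  exists_of_proj_eq b₁ b₂ h := by
    obtain ⟨g, hg⟩ := PrincipalBundle.exists_act h
    obtain ⟨g', rfl⟩ := C.q_surjective g
    exact ⟨⟨(b₁, b₂, g'), hg⟩, rfl, rfl⟩
  act x u := ⟨(x.1.1, x.1.2.1, x.1.2.2 * C.incl u), by
    have h : C.q (C.incl u) = 1 := (C.ker_q _).2 ⟨u, rfl⟩
    simp only [map_mul, h, mul_one]
    exact x.2⟩
  act_one x := Subtype.ext (by simp)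
  act_mul x u v := Subtype.ext (by simp [mul_assoc])
  fst_act x u := rfl
  snd_act x u := rfl
  existsUnique_act := by
    rintro ⟨⟨b₁, b₂, g⟩, hx⟩ ⟨⟨c₁, c₂, g'⟩, hy⟩ (rfl : b₁ = c₁) (rfl : b₂ = c₂)
    have h : C.q g = C.q g' := PrincipalBundle.act_injective b₁ (hx.trans hy.symm)
    obtain ⟨u, hu⟩ := (C.ker_q (g⁻¹ * g')).1 (by simp [h])
    refine ⟨u, Subtype.ext (by simp [hu]), fun v hv => C.incl_injective ?_⟩
    have hv' : g * C.incl v = g' := congrArg (fun x => x.1.2.2) hv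
    rw [hu, ← hv', inv_mul_cancel_left]
  mul x y h := ⟨(x.1.1, y.1.2.1, x.1.2.2 * y.1.2.2), by
    simp only [map_mul, β.act_mul]
    rw [x.2, h, y.2]⟩
  fst_mul _ _ _ := rfl
  snd_mul _ _ _ := rfl
  mul_act x y h u v := Subtype.ext (by
    refine Prod.ext rfl (Prod.ext rfl ?_)
    change x.1.2.2 * C.incl u * (y.1.2.2 * C.incl v) = x.1.2.2 * y.1.2.2 * C.incl (u * v)
    rw [map_mul, mul_assoc, ← mul_assoc (C.incl u), C.central u]
    simp only [mul_assoc])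
  mul_assoc x y z h h' := Subtype.ext (Prod.ext rfl (Prod.ext rfl (mul_assoc _ _ _)))
  conn := liftConn C θ σ
  curving := liftCurving θ L σ

end LiftingBundleGerbe

end LiftGerbe

end

universe uEB uB

/-!
The circle acts on `J_B = ζ^*Ĝ` and on a lifting `B̂` of `B`, and the two structures determine
each other.  Since `q` is a circle bundle, the action of `T ⊆ Ĝ` makes a lifting `q̂ : B̂ → B` a
circle bundle over `B`, and `b̂₂ = b̂₁ ĝ` determines `ĝ` over `ζ(q̂ b̂₁, q̂ b̂₂)`; this is an
isomorphism of `J_B` with `δ(B̂)` that respects the products.  Conversely, an isomorphism of `J_B`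
with `δ(Q)`, for a circle bundle `Q → B`, turns an element `ĝ` over `ζ(b, b q(ĝ))` into an
isomorphism of the fibres of `Q` over `b` and `b q(ĝ)`; by the compatibility with the products,
this is an action of `Ĝ` on `Q`, and `Q` is a lifting of `B`.

A connection `θ̂` on the lifting is compatible with `θ` if and only if `θ̂ - σ(q̂^*θ)` has values in
the kernel of `q_*`, which is the Lie algebra of the circle (`CentralExtension.exists_dincl_eq`):
`θ̂ = σ(q̂^*θ) + α` with a scalar form `α`.  By the Leibniz rule `Connection.val_act` for the
derivative of `m ↦ a(m) g(m)`, the equivariance of `θ̂` under `Ĝ` says that `α` is a connection of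
the circle bundle and that `δ(α)` is the connection `ν_σ + Z_σ(ζ⁻¹, θ)` of the gerbe
(`IsoToDelta.val_action`).

As `q_*` is a homomorphism of Lie algebras (`mfderiv_hom_bracket`), `σ` fails to be one by
`ω_σ`, and the brackets with the central `α` vanish.  Hence the curvature of `θ̂` is
`σ(F_θ) + ½ ω_σ(θ, θ) + dα`, pulled back to the lifting, and its image under `L` is
`dα - q̂^*f` (`bar_curvature`).  The scalar curvature vanishes if and only if `dα` is the pull-back
of the curving `f`, that is, `F_α = f`.

All computations with forms rest on the naturality of the exterior derivative
(`extDer_pullForm`), and principal bundles are recognized from a free, fibrewise transitive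
action, local sections and a smooth division (`PrincipalBundle.ofSections`).
-/

open scoped Topology

set_option linter.unusedSectionVars false

noncomputable section

namespace LiftGerbe

/-! ### Pull-back and the exterior derivative of 1-forms -/

section ExteriorDerivative

variable {E : Type*} [NormedAddCommGroup E] [NormedSpace ℝ E]
  {M : Type*} [TopologicalSpace M] [ChartedSpace E M]
  {E' : Type*} [NormedAddCommGroup E'] [NormedSpace ℝ E']
  {M' : Type*} [TopologicalSpace M'] [ChartedSpace E' M']
  {V : Type*} [NormedAddCommGroup V] [NormedSpace ℝ V]
  {W : Type*} [NormedAddCommGroup W] [NormedSpace ℝ W]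

/-- A map `A` into continuous linear maps is smooth if `A x w` is jointly smooth in `x` and `w`:
`A x` is the partial derivative in the second variable at `w = 0`. -/
theorem contDiffAt_clm_of_uncurry {A : E → E' →L[ℝ] V} {x : E}
    (h : ContDiffAt ℝ ∞ (fun z : E × E' => A z.1 z.2) (x, 0)) :
    ContDiffAt ℝ ∞ A x := by
  have h1 : ContDiffAt ℝ ∞ (fun y : E => (fderiv ℝ (fun z : E × E' => A z.1 z.2) (y, 0)).comp
      (ContinuousLinearMap.inr ℝ E E')) x := by
    have h2 : ContDiffAt ℝ ∞ (fderiv ℝ (fun z : E × E' => A z.1 z.2)) (x, 0) :=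
      h.fderiv_right (by simp)
    have h3 : ContDiffAt ℝ ∞ (fun y : E => (y, (0 : E'))) x := by fun_prop
    exact (h2.comp x h3).clm_comp contDiffAt_const
  refine h1.congr_of_eventuallyEq ?_
  have h4 : ∀ᶠ z in 𝓝 (x, (0 : E')), DifferentiableAt ℝ (fun z : E × E' => A z.1 z.2) z := by
    have := (h.of_le (m := 1) (by simp)).eventually (by simp)
    exact this.mono fun z hz => hz.differentiableAt (by simp)
  have h5 : Filter.Tendsto (fun y : E => (y, (0 : E'))) (𝓝 x) (𝓝 (x, 0)) :=
    (Continuous.prodMk continuous_id continuous_const).tendsto x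
  filter_upwards [h5.eventually h4] with y hy
  have h6 := hy.hasFDerivAt.comp (0 : E') (hasFDerivAt_prodMk_right y (0 : E'))
  exact ((A y).hasFDerivAt (x := 0)).unique h6

/-- The pull-back `f^*η` of a 1-form. -/
def pullForm (f : M → M')
    (η : OneForm 𝓘(ℝ, E') M' V) : OneForm 𝓘(ℝ, E) M V := fun p =>
  (η (f p)).comp (mfderiv 𝓘(ℝ, E) 𝓘(ℝ, E') f p)

theorem IsSmoothForm.pullForm [IsManifold 𝓘(ℝ, E) ∞ M] [IsManifold 𝓘(ℝ, E') ∞ M']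
    {η : OneForm 𝓘(ℝ, E') M' V} (hη : IsSmoothForm η) {f : M → M'}
    (hf : ContMDiff 𝓘(ℝ, E) 𝓘(ℝ, E') ∞ f) :
    IsSmoothForm (E := E) (M := M) (LiftGerbe.pullForm f η) :=
  ContMDiff.comp hη (hf.contMDiff_tangentMap (m := ∞) (by simp))

theorem IsSmoothForm.clm_comp [IsManifold 𝓘(ℝ, E) ∞ M]
    {η : OneForm 𝓘(ℝ, E) M V} (hη : IsSmoothForm η) (c : V →L[ℝ] W) :
    IsSmoothForm (fun p => c.comp (η p)) :=
  c.contMDiff.comp hη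

theorem IsSmoothForm.add [IsManifold 𝓘(ℝ, E) ∞ M]
    {η η' : OneForm 𝓘(ℝ, E) M V} (hη : IsSmoothForm η) (hη' : IsSmoothForm η') :
    IsSmoothForm (fun p => η p + η' p) :=
  ContMDiff.add hη hη'

/-- The local expression of a smooth 1-form is smooth for the operator norm. -/
theorem IsSmoothForm.contDiffAt_formInChart [IsManifold 𝓘(ℝ, E) ∞ M]
    {η : OneForm 𝓘(ℝ, E) M V} (hη : IsSmoothForm η) (p : M) :
    ContDiffAt ℝ ∞ (formInChart η p) (extChartAt 𝓘(ℝ, E) p p) := by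
  apply contDiffAt_clm_of_uncurry
  set φ := extChartAt 𝓘(ℝ, E) p
  have ho : IsOpen φ.target := isOpen_extChartAt_target p
  have h1 : ContMDiffOn 𝓘(ℝ, E) 𝓘(ℝ, E) ∞ φ.symm φ.target := contMDiffOn_extChartAt_symm p
  have h2 := h1.contMDiffOn_tangentMapWithin (m := ∞) (by simp) ho.uniqueMDiffOn
  have h3 := ContMDiff.comp_contMDiffOn hη h2
  have h4 : ContMDiff 𝓘(ℝ, E × E) 𝓘(ℝ, E).tangent ∞
      (fun z : E × E => (⟨z.1, z.2⟩ : TangentBundle 𝓘(ℝ, E) E)) := by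
    have := (contDiff_fst (𝕜 := ℝ) (E := E) (F := E) (n := ∞)).contMDiff.prodMk
      (contDiff_snd (𝕜 := ℝ) (E := E) (F := E) (n := ∞)).contMDiff
    rw [chartedSpaceSelf_prod] at this
    exact (contMDiff_tangentBundleModelSpaceHomeomorph_symm (I := 𝓘(ℝ, E)) (n := ∞)).comp this
  have h5 := h3.comp (h4.contMDiffOn (s := (fun z : E × E => z.1) ⁻¹' φ.target))
    (fun z hz => hz)
  have h6 : (φ p, (0 : E)) ∈ (fun z : E × E => z.1) ⁻¹' φ.target := mem_extChartAt_target p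
  have ho' : IsOpen ((fun z : E × E => z.1) ⁻¹' φ.target) := ho.preimage continuous_fst
  have h7 := (contMDiffOn_iff_contDiffOn.1 h5).contDiffAt (ho'.mem_nhds h6)
  refine h7.congr_of_eventuallyEq ?_
  filter_upwards [ho'.mem_nhds h6] with z hz
  have : mfderivWithin 𝓘(ℝ, E) 𝓘(ℝ, E) φ.symm φ.target z.1 = mfderiv 𝓘(ℝ, E) 𝓘(ℝ, E) φ.symm z.1 :=
    mfderivWithin_of_isOpen ho hz
  simp only [Function.comp_apply, tangentMapWithin, formInChart]
  rw [this]
  rfl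

theorem IsSmoothForm.differentiableAt_formInChart [IsManifold 𝓘(ℝ, E) ∞ M]
    {η : OneForm 𝓘(ℝ, E) M V} (hη : IsSmoothForm η) (p : M) :
    DifferentiableAt ℝ (formInChart η p) (extChartAt 𝓘(ℝ, E) p p) :=
  (hη.contDiffAt_formInChart p).differentiableAt (by simp)

/-- In the preferred chart at `p`, the tangent space at `p` is the model space. -/
theorem extDer_apply [IsManifold 𝓘(ℝ, E) ∞ M]
    (η : OneForm 𝓘(ℝ, E) M V) (p : M) (v w : E) :
    extDer η p v w = fderiv ℝ (formInChart η p) (extChartAt 𝓘(ℝ, E) p p) v w -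
      fderiv ℝ (formInChart η p) (extChartAt 𝓘(ℝ, E) p p) w v := by
  have : IsManifold 𝓘(ℝ, E) 1 M := IsManifold.of_le (n := ∞) (by simp)
  have h := mfderiv_extChartAt_self (I := 𝓘(ℝ, E)) (x := p)
  have hv : ∀ u : E, mfderiv 𝓘(ℝ, E) 𝓘(ℝ, E) (extChartAt 𝓘(ℝ, E) p) p u = u :=
    fun u => DFunLike.congr_fun h u
  exact congrArg₂ (fun v w : E => fderiv ℝ (formInChart η p) (extChartAt 𝓘(ℝ, E) p p) v w -
      fderiv ℝ (formInChart η p) (extChartAt 𝓘(ℝ, E) p p) w v) (hv v) (hv w)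

theorem extDer_clm_comp [IsManifold 𝓘(ℝ, E) ∞ M]
    {η : OneForm 𝓘(ℝ, E) M V} (hη : IsSmoothForm η) (c : V →L[ℝ] W) (p : M)
    (v w : TangentSpace 𝓘(ℝ, E) p) :
    extDer (fun p => c.comp (η p)) p v w = c (extDer η p v w) := by
  have h : formInChart (fun p => c.comp (η p)) p = fun y => c.comp (formInChart η p y) := rfl
  have hd := (hη.differentiableAt_formInChart p).hasFDerivAt
  have h2 := ((ContinuousLinearMap.compL ℝ E V W c).hasFDerivAt.comp _ hd).fderiv
  have h3 : fderiv ℝ (fun y => c.comp (formInChart η p y)) (extChartAt 𝓘(ℝ, E) p p) = _ := h2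
  refine (extDer_apply (E := E) _ p v w).trans (Eq.trans ?_
    (congrArg c (extDer_apply (E := E) η p v w).symm))
  rw [h, h3, map_sub]
  rfl

theorem extDer_add [IsManifold 𝓘(ℝ, E) ∞ M]
    {η η' : OneForm 𝓘(ℝ, E) M V} (hη : IsSmoothForm η) (hη' : IsSmoothForm η') (p : M)
    (v w : TangentSpace 𝓘(ℝ, E) p) :
    extDer (fun p => η p + η' p) p v w = extDer η p v w + extDer η' p v w := by
  have h : formInChart (fun p => η p + η' p) p = formInChart η p + formInChart η' p := by
    funext y
    exact ContinuousLinearMap.add_comp _ _ _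
  refine (extDer_apply (E := E) _ p v w).trans (Eq.trans ?_
    (congrArg₂ (· + ·) (extDer_apply (E := E) η p v w) (extDer_apply (E := E) η' p v w)).symm)
  rw [h, fderiv_add (hη.differentiableAt_formInChart p) (hη'.differentiableAt_formInChart p)]
  exact add_sub_add_comm _ _ _ _

/-- The exterior derivative is natural: in charts, the second derivative of `f` that appears
in `d(f^*η)` is symmetric and drops out. -/
theorem extDer_pullForm [IsManifold 𝓘(ℝ, E) ∞ M] [IsManifold 𝓘(ℝ, E') ∞ M']
    {η : OneForm 𝓘(ℝ, E') M' V} (hη : IsSmoothForm η) {f : M → M'}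
    (hf : ContMDiff 𝓘(ℝ, E) 𝓘(ℝ, E') ∞ f) (p : M) (v w : TangentSpace 𝓘(ℝ, E) p) :
    extDer (pullForm f η) p v w =
      extDer η (f p) (mfderiv 𝓘(ℝ, E) 𝓘(ℝ, E') f p v) (mfderiv 𝓘(ℝ, E) 𝓘(ℝ, E') f p w) := by
  set φ := extChartAt 𝓘(ℝ, E) p with hφ
  set ψ := extChartAt 𝓘(ℝ, E') (f p) with hψ
  set F : E → E' := fun y => ψ (f (φ.symm y)) with hF
  have hp : φ.symm (φ p) = p := extChartAt_to_inv p
  -- the set on which the chart expression `F` of `f` is meaningful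
  have hU : ∀ᶠ y in 𝓝 (φ p), y ∈ φ.target ∧ f (φ.symm y) ∈ ψ.source := by
    refine Filter.Eventually.and
      ((isOpen_extChartAt_target p).mem_nhds (mem_extChartAt_target p)) ?_
    have hc : ContinuousAt (fun y => f (φ.symm y)) (φ p) :=
      hf.continuous.continuousAt.comp (continuousAt_extChartAt_symm p)
    refine hc.preimage_mem_nhds (extChartAt_source_mem_nhds' ?_)
    rw [hp]
    exact mem_extChartAt_source _
  have hFs : ∀ y, y ∈ φ.target ∧ f (φ.symm y) ∈ ψ.source →
      ContMDiffAt 𝓘(ℝ, E) 𝓘(ℝ, E') ∞ (fun y => f (φ.symm y)) y ∧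
      ContMDiffAt 𝓘(ℝ, E) 𝓘(ℝ, E') ∞ F y := by
    intro y hy
    have h1 : ContMDiffAt 𝓘(ℝ, E) 𝓘(ℝ, E) ∞ φ.symm y :=
      (contMDiffOn_extChartAt_symm p).contMDiffAt
        ((isOpen_extChartAt_target p).mem_nhds hy.1)
    have h2 := hf.contMDiffAt.comp y h1
    refine ⟨h2, ContMDiffAt.comp y (g := ψ) ?_ h2⟩
    exact (contMDiffOn_extChartAt (I := 𝓘(ℝ, E')) (x := f p)).contMDiffAt
      ((chartAt E' (f p)).open_source.mem_nhds (by simpa [hψ] using hy.2))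
  have hF2 : ContDiffAt ℝ ∞ F (φ p) :=
    contMDiffAt_iff_contDiffAt.1 (hFs _ hU.self_of_nhds).2
  -- the local expression of the pull-back
  have key : formInChart (pullForm f η) p =ᶠ[𝓝 (φ p)]
      fun y => (formInChart η (f p) (F y)).comp (fderiv ℝ F y) := by
    filter_upwards [hU.eventually_nhds] with y hy
    have hy0 := hy.self_of_nhds
    obtain ⟨s1, s2⟩ := hFs y hy0
    have e1 : (fun y => f (φ.symm y)) =ᶠ[𝓝 y] ψ.symm ∘ F := by
      filter_upwards [hy] with z hz
      exact (ψ.left_inv hz.2).symm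
    have hd1 : MDifferentiableAt 𝓘(ℝ, E') 𝓘(ℝ, E') ψ.symm (F y) :=
      ((contMDiffOn_extChartAt_symm (f p)).contMDiffAt
        ((isOpen_extChartAt_target (f p)).mem_nhds
          (ψ.map_source hy0.2))).mdifferentiableAt (n := ∞) (by simp)
    have c1 := mfderiv_comp y hd1 (s2.mdifferentiableAt (by simp))
    have c2 := mfderiv_comp (I' := 𝓘(ℝ, E)) y (g := f) (f := φ.symm)
      (hf.contMDiffAt.mdifferentiableAt (by simp))
      (((contMDiffOn_extChartAt_symm (n := ∞) p).contMDiffAt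
        ((isOpen_extChartAt_target p).mem_nhds hy0.1)).mdifferentiableAt (by simp))
    have c3 := e1.mfderiv_eq (I := 𝓘(ℝ, E)) (I' := 𝓘(ℝ, E'))
    rw [mfderiv_eq_fderiv] at c1
    ext u
    have c4 := DFunLike.congr_fun c3 u
    have c5 := DFunLike.congr_fun c2 u
    have c6 := DFunLike.congr_fun c1 u
    have c7 : (mfderiv 𝓘(ℝ, E) 𝓘(ℝ, E') f (φ.symm y) (mfderiv 𝓘(ℝ, E) 𝓘(ℝ, E) φ.symm y u) : E') =
       mfderiv 𝓘(ℝ, E') 𝓘(ℝ, E') ψ.symm (F y) (fderiv ℝ F y u) := c5.symm.trans (c4.trans c6)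
    have c8 : ψ.symm (F y) = f (φ.symm y) := ψ.left_inv hy0.2
    have c9 : ∀ q, q = f (φ.symm y) → ∀ z : E', η (f (φ.symm y)) z = η q z := by
      rintro _ rfl z
      rfl
    refine (c9 _ c8 _).trans ?_
    exact congrArg (fun z : E' => η (ψ.symm (F y)) z) c7
  have hA : DifferentiableAt ℝ (formInChart η (f p)) (F (φ p)) := by
    have : F (φ p) = ψ (f p) := by simp only [hF, hp]
    rw [this]
    exact hη.differentiableAt_formInChart _
  have hAF : HasFDerivAt (fun y => formInChart η (f p) (F y))
      ((fderiv ℝ (formInChart η (f p)) (F (φ p))).comp (fderiv ℝ F (φ p))) (φ p) :=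
    hA.hasFDerivAt.comp _ (hF2.differentiableAt (by simp)).hasFDerivAt
  have hF' : HasFDerivAt (fderiv ℝ F) (fderiv ℝ (fderiv ℝ F) (φ p)) (φ p) :=
    ((hF2.fderiv_right (m := ∞) (by simp)).differentiableAt (by simp)).hasFDerivAt
  have hsymm := hF2.isSymmSndFDerivAt (n := ∞) (by simp; exact WithTop.coe_le_coe.2 le_top)
  have hder := (hAF.clm_comp hF').fderiv
  have hFp : F (φ p) = ψ (f p) := by simp only [hF, hp]
  -- the derivative of `F` is the chart expression of the derivative of `f`
  have hdF : ∀ u : E, fderiv ℝ F (φ p) u = mfderiv 𝓘(ℝ, E) 𝓘(ℝ, E') f p u := by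
    intro u
    have h := (hf.contMDiffAt (x := p)).mdifferentiableAt (n := ∞) (by simp)
    have h' : ∀ D : E →L[ℝ] E', D = mfderiv 𝓘(ℝ, E) 𝓘(ℝ, E') f p →
        fderiv ℝ F (φ p) = D := by
      intro D hD
      have h2 : HasFDerivWithinAt F D (Set.range 𝓘(ℝ, E)) (φ p) := by
        subst hD
        exact h.hasMFDerivAt.2
      rw [modelWithCornersSelf_coe, Set.range_id, hasFDerivWithinAt_univ] at h2
      exact h2.fderiv
    exact DFunLike.congr_fun (h' _ rfl) u
  refine (extDer_apply (E := E) _ p v w).trans (Eq.trans ?_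
    (extDer_apply (E := E') η (f p) _ _).symm)
  refine Eq.trans ?_ (congrArg₂ (fun v w : E' =>
      fderiv ℝ (formInChart η (f p)) (ψ (f p)) v w -
      fderiv ℝ (formInChart η (f p)) (ψ (f p)) w v) (hdF v) (hdF w))
  rw [key.fderiv_eq, hder, hFp]
  have hs := hsymm.eq v w
  change (formInChart η (f p) (ψ (f p))) (fderiv ℝ (fderiv ℝ F) (φ p) v w) + _ -
    ((formInChart η (f p) (ψ (f p))) (fderiv ℝ (fderiv ℝ F) (φ p) w v) + _) = _
  rw [hs]
  exact add_sub_add_left_eq_sub _ _ _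

end ExteriorDerivative

/-! ### Tangent maps -/

section TangentMaps

variable {E : Type*} [NormedAddCommGroup E] [NormedSpace ℝ E]
  {H : Type*} [TopologicalSpace H] (I : ModelWithCorners ℝ E H)
  {M : Type*} [TopologicalSpace M] [ChartedSpace H M]
  {E' : Type*} [NormedAddCommGroup E'] [NormedSpace ℝ E']
  {H' : Type*} [TopologicalSpace H'] (I' : ModelWithCorners ℝ E' H')
  {M' : Type*} [TopologicalSpace M'] [ChartedSpace H' M']
  {E'' : Type*} [NormedAddCommGroup E''] [NormedSpace ℝ E'']
  {H'' : Type*} [TopologicalSpace H''] (I'' : ModelWithCorners ℝ E'' H'')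
  {M'' : Type*} [TopologicalSpace M''] [ChartedSpace H'' M'']

/-- The derivative `mfderiv` as a map between the model spaces, which are the tangent spaces
by definition. -/
def tder (f : M → M') (p : M) : E →L[ℝ] E' := mfderiv I I' f p

variable {I I' I''}

theorem tder_comp {g : M' → M''} {f : M → M'} {p : M} (hg : MDifferentiableAt I' I'' g (f p))
    (hf : MDifferentiableAt I I' f p) :
    tder I I'' (fun x => g (f x)) p = (tder I' I'' g (f p)).comp (tder I I' f p) :=
  mfderiv_comp p hg hf

theorem tder_comp_apply {g : M' → M''} {f : M → M'} {p : M}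
    (hg : MDifferentiableAt I' I'' g (f p)) (hf : MDifferentiableAt I I' f p) (v : E) :
    tder I I'' (fun x => g (f x)) p v = tder I' I'' g (f p) (tder I I' f p v) :=
  DFunLike.congr_fun (tder_comp hg hf) v

theorem tder_id (p : M) : tder I I (fun x => x) p = ContinuousLinearMap.id ℝ E :=
  mfderiv_id

theorem tder_const (p : M) (c : M') : tder I I' (fun _ => c) p = 0 :=
  mfderiv_const

theorem tder_fst (p : M × M') :
    tder (I.prod I') I (fun x : M × M' => x.1) p = ContinuousLinearMap.fst ℝ E E' :=
  mfderiv_fst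

theorem tder_snd (p : M × M') :
    tder (I.prod I') I' (fun x : M × M' => x.2) p = ContinuousLinearMap.snd ℝ E E' :=
  mfderiv_snd

theorem tder_congr {f g : M → M'} {p : M} (h : f =ᶠ[𝓝 p] g) : tder I I' f p = tder I I' g p :=
  h.mfderiv_eq

/-- The derivative of a map of two variables along a pair of maps. -/
theorem tder_comp₂ {E₃ : Type*} [NormedAddCommGroup E₃] [NormedSpace ℝ E₃]
    {H₃ : Type*} [TopologicalSpace H₃] {I₃ : ModelWithCorners ℝ E₃ H₃}
    {M₃ : Type*} [TopologicalSpace M₃] [ChartedSpace H₃ M₃]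
    {F : M' × M'' → M₃} {a : M → M'} {b : M → M''} {p : M}
    (hF : MDifferentiableAt (I'.prod I'') I₃ F (a p, b p)) (ha : MDifferentiableAt I I' a p)
    (hb : MDifferentiableAt I I'' b p) (v : E) :
    tder I I₃ (fun x => F (a x, b x)) p v =
      tder I' I₃ (fun y => F (y, b p)) (a p) (tder I I' a p v) +
        tder I'' I₃ (fun y => F (a p, y)) (b p) (tder I I'' b p v) := by
  have h1 := mfderiv_comp p (f := fun x => (a x, b x)) hF (ha.prodMk hb)
  have h2 := ha.mfderiv_prod hb
  rw [h2] at h1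
  exact (DFunLike.congr_fun h1 v).trans (mfderiv_prod_eq_add_apply hF)

end TangentMaps

/-! ### Lie brackets of related vector fields and of Lie groups -/

section RelatedFields

open VectorField

variable {E : Type*} [NormedAddCommGroup E] [NormedSpace ℝ E]
  {H : Type*} [TopologicalSpace H] {I : ModelWithCorners ℝ E H} [I.Boundaryless]
  {M : Type*} [TopologicalSpace M] [ChartedSpace H M] [IsManifold I ∞ M]
  {E' : Type*} [NormedAddCommGroup E'] [NormedSpace ℝ E']
  {H' : Type*} [TopologicalSpace H'] {I' : ModelWithCorners ℝ E' H'} [I'.Boundaryless]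
  {M' : Type*} [TopologicalSpace M'] [ChartedSpace H' M'] [IsManifold I' ∞ M']

variable (I) in
/-- The local expression of a vector field in the preferred chart at `x`. -/
def fieldInChart (V : ∀ x : M, TangentSpace I x) (x : M) : E → E :=
  mpullbackWithin 𝓘(ℝ, E) I (extChartAt I x).symm V (Set.range I)

theorem mlieBracket_eq_lieBracket_fieldInChart (V W : ∀ x : M, TangentSpace I x) (x : M) :
    mlieBracket I V W x =
      lieBracket ℝ (fieldInChart I V x) (fieldInChart I W x) (extChartAt I x x) := by
  have : IsManifold I 1 M := IsManifold.of_le (n := ∞) (by simp)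
  have h := mlieBracketWithin_apply (I := I) (V := V) (W := W) (s := Set.univ) (x₀ := x)
  rw [mlieBracketWithin_univ] at h
  have h1 : ∀ A : E →L[ℝ] E, A = ContinuousLinearMap.id ℝ E → ∀ z, A.inverse z = z := by
    rintro _ rfl z
    rw [ContinuousLinearMap.inverse_id]
    rfl
  have h2 : ∀ (s : Set E) (A B : E → E) (y : E), s = Set.univ →
      lieBracketWithin ℝ A B s y = lieBracket ℝ A B y := by
    rintro _ A B y rfl
    rw [lieBracketWithin_univ]
  exact (h.trans (h1 _ (mfderiv_extChartAt_self (I := I) (x := x)) _)).trans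
    (h2 _ _ _ _ (by rw [Set.preimage_univ, Set.univ_inter, I.range_eq_univ]))

theorem differentiableAt_fieldInChart [CompleteSpace E] {V : ∀ x : M, TangentSpace I x} {x : M}
    (hV : MDifferentiableAt I I.tangent (fun x => (V x : TangentBundle I M)) x) :
    DifferentiableAt ℝ (fieldInChart I V x) (extChartAt I x x) := by
  have : IsManifold I 2 M := IsManifold.of_le (n := ∞) (WithTop.coe_le_coe.2 le_top)
  have h := MDifferentiableWithinAt.differentiableWithinAt_mpullbackWithin_vectorField
    (I := I) (V := V) (s := Set.univ) (x := x) hV.mdifferentiableWithinAt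
  have h2 : ∀ (s : Set E) (A : E → E) (y : E), s = Set.univ →
      DifferentiableWithinAt ℝ A s y → DifferentiableAt ℝ A y := by
    rintro _ A y rfl hA
    exact differentiableWithinAt_univ.1 hA
  exact h2 _ _ _ (by rw [Set.preimage_univ, Set.univ_inter, I.range_eq_univ]) h

/-- A smooth map carries the bracket of two vector fields to the bracket of two fields
related to them: a commutator of directional derivatives does not see the second derivative
of the map. -/
theorem mfderiv_mlieBracket_of_related [CompleteSpace E] [CompleteSpace E'] {f : M → M'}
    (hf : ContMDiff I I' ∞ f)
    {V W : ∀ x : M, TangentSpace I x} {V' W' : ∀ x : M', TangentSpace I' x}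
    (hV : ∀ x, mfderiv I I' f x (V x) = V' (f x)) (hW : ∀ x, mfderiv I I' f x (W x) = W' (f x))
    {x : M}
    (dV : MDifferentiableAt I I.tangent (fun x => (V x : TangentBundle I M)) x)
    (dW : MDifferentiableAt I I.tangent (fun x => (W x : TangentBundle I M)) x)
    (dV' : MDifferentiableAt I' I'.tangent (fun x => (V' x : TangentBundle I' M')) (f x))
    (dW' : MDifferentiableAt I' I'.tangent (fun x => (W' x : TangentBundle I' M')) (f x)) :
    mfderiv I I' f x (mlieBracket I V W x) = mlieBracket I' V' W' (f x) := by
  have m1 : IsManifold I 1 M := IsManifold.of_le (n := ∞) (by simp)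
  have m2 : IsManifold I' 1 M' := IsManifold.of_le (n := ∞) (by simp)
  set φ := extChartAt I x with hφ
  set ψ := extChartAt I' (f x) with hψ
  set F : E → E' := fun y => ψ (f (φ.symm y)) with hF
  have hp : φ.symm (φ x) = x := extChartAt_to_inv x
  have hU : ∀ᶠ y in 𝓝 (φ x), y ∈ φ.target ∧ f (φ.symm y) ∈ ψ.source := by
    refine Filter.Eventually.and
      ((isOpen_extChartAt_target x).mem_nhds (mem_extChartAt_target x)) ?_
    have hc : ContinuousAt (fun y => f (φ.symm y)) (φ x) :=
      hf.continuous.continuousAt.comp (continuousAt_extChartAt_symm x)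
    refine hc.preimage_mem_nhds (extChartAt_source_mem_nhds' ?_)
    rw [hp]
    exact mem_extChartAt_source _
  have hFs : ∀ y, y ∈ φ.target ∧ f (φ.symm y) ∈ ψ.source →
      ContMDiffAt 𝓘(ℝ, E) I' ∞ (fun y => f (φ.symm y)) y ∧
      ContMDiffAt 𝓘(ℝ, E) 𝓘(ℝ, E') ∞ F y := by
    intro y hy
    have h1 : ContMDiffAt 𝓘(ℝ, E) I ∞ φ.symm y :=
      (contMDiffOn_extChartAt_symm x).contMDiffAt
        ((isOpen_extChartAt_target x).mem_nhds hy.1)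
    have h2 := hf.contMDiffAt.comp y h1
    refine ⟨h2, ContMDiffAt.comp y (g := ψ) ?_ h2⟩
    exact (contMDiffOn_extChartAt (I := I') (x := f x)).contMDiffAt
      ((chartAt H' (f x)).open_source.mem_nhds (by simpa [hψ] using hy.2))
  have hF2 : ContDiffAt ℝ ∞ F (φ x) :=
    contMDiffAt_iff_contDiffAt.1 (hFs _ hU.self_of_nhds).2
  have hFp : F (φ x) = ψ (f x) := by simp only [hF, hp]
  -- the fields are related in charts
  have key : ∀ (V : ∀ x : M, TangentSpace I x) (V' : ∀ x : M', TangentSpace I' x),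
      (∀ x, mfderiv I I' f x (V x) = V' (f x)) →
      (fun y => fderiv ℝ F y (fieldInChart I V x y)) =ᶠ[𝓝 (φ x)]
        fun y => fieldInChart I' V' (f x) (F y) := by
    intro V V' hV
    filter_upwards [hU.eventually_nhds] with y hy
    have hy0 := hy.self_of_nhds
    obtain ⟨s1, s2⟩ := hFs y hy0
    have e1 : (fun y => f (φ.symm y)) =ᶠ[𝓝 y] ψ.symm ∘ F := by
      filter_upwards [hy] with z hz
      exact (ψ.left_inv hz.2).symm
    have hd1 : MDifferentiableAt 𝓘(ℝ, E') I' ψ.symm (F y) :=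
      ((contMDiffOn_extChartAt_symm (f x)).contMDiffAt
        ((isOpen_extChartAt_target (f x)).mem_nhds
          (ψ.map_source hy0.2))).mdifferentiableAt (n := ∞) (by simp)
    have c1 := mfderiv_comp y hd1 (s2.mdifferentiableAt (by simp))
    have c2 := mfderiv_comp (I' := I) y (g := f) (f := φ.symm)
      (hf.contMDiffAt.mdifferentiableAt (by simp))
      (((contMDiffOn_extChartAt_symm (n := ∞) x).contMDiffAt
        ((isOpen_extChartAt_target x).mem_nhds hy0.1)).mdifferentiableAt (by simp))
    have c3 := e1.mfderiv_eq (I := 𝓘(ℝ, E)) (I' := I')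
    rw [mfderiv_eq_fderiv] at c1
    have i1 := isInvertible_mfderivWithin_extChartAt_symm hy0.1
    have i2 := isInvertible_mfderivWithin_extChartAt_symm (I := I') (x := f x)
      (ψ.map_source hy0.2)
    rw [I.range_eq_univ, mfderivWithin_univ] at i1
    rw [I'.range_eq_univ, mfderivWithin_univ] at i2
    set u : E := fieldInChart I V x y with hu
    have hu1 : mfderiv 𝓘(ℝ, E) I φ.symm y u = V (φ.symm y) := by
      obtain ⟨A, hA⟩ := i1
      have : u = A.symm (V (φ.symm y)) := by
        rw [hu, fieldInChart, mpullbackWithin_apply, I.range_eq_univ, mfderivWithin_univ, ← hA,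
          ContinuousLinearMap.inverse_equiv]
        rfl
      rw [this, ← hA]
      exact A.apply_symm_apply _
    obtain ⟨A, hA⟩ := i2
    have hw : fieldInChart I' V' (f x) (F y) = A.symm (V' (ψ.symm (F y))) := by
      rw [fieldInChart, mpullbackWithin_apply, I'.range_eq_univ, mfderivWithin_univ, ← hA,
          ContinuousLinearMap.inverse_equiv]
      rfl
    rw [hw]
    have c8 : ψ.symm (F y) = f (φ.symm y) := ψ.left_inv hy0.2
    have c9 : ∀ q, q = f (φ.symm y) → (V' q : E') = V' (f (φ.symm y)) := by
      rintro _ rfl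
      rfl
    have c10 : (mfderiv 𝓘(ℝ, E') I' ψ.symm (F y) (fderiv ℝ F y u) : E') = V' (ψ.symm (F y)) :=
      (DFunLike.congr_fun c1 u).symm.trans ((DFunLike.congr_fun c3 u).symm.trans
        ((DFunLike.congr_fun c2 u).trans ((congrArg (fun z : E =>
          (mfderiv I I' f (φ.symm y) z : E')) hu1).trans
            ((hV (φ.symm y)).trans (c9 _ c8).symm))))
    rw [← hA] at c10
    exact A.injective (c10.trans (A.apply_symm_apply _).symm)
  have hdF : ∀ u : E, fderiv ℝ F (φ x) u = mfderiv I I' f x u := by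
    intro u
    have h := (hf.contMDiffAt (x := x)).mdifferentiableAt (n := ∞) (by simp)
    have h' : ∀ D : E →L[ℝ] E', D = mfderiv I I' f x →
        fderiv ℝ F (φ x) = D := by
      intro D hD
      have h2 : HasFDerivWithinAt F D (Set.range I) (φ x) := by
        subst hD
        exact h.hasMFDerivAt.2
      rw [I.range_eq_univ, hasFDerivWithinAt_univ] at h2
      exact h2.fderiv
    exact DFunLike.congr_fun (h' _ rfl) u
  have b1 : (mlieBracket I V W x : E) = _ := mlieBracket_eq_lieBracket_fieldInChart V W x
  have b2 : (mlieBracket I' V' W' (f x) : E') = _ :=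
    mlieBracket_eq_lieBracket_fieldInChart V' W' (f x)
  refine (congrArg (fun z : E => (mfderiv I I' f x z : E')) b1).trans (Eq.trans ?_ b2.symm)
  refine (hdF _).symm.trans ?_
  have dV1 := differentiableAt_fieldInChart dV
  have dW1 := differentiableAt_fieldInChart dW
  have dV2 := differentiableAt_fieldInChart dV'
  have dW2 := differentiableAt_fieldInChart dW'
  rw [← hψ, ← hFp] at dV2 dW2
  rw [fderiv_apply_lieBracket hF2 (by simp; exact WithTop.coe_le_coe.2 le_top) dW1 dV1,
    (key W W' hW).fderiv_eq, (key V V' hV).fderiv_eq, lieBracket, ← hψ, ← hFp]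
  have hFd := (hF2.differentiableAt (by simp)).hasFDerivAt
  have r1 := (dV2.hasFDerivAt.comp _ hFd).fderiv
  have r2 := (dW2.hasFDerivAt.comp _ hFd).fderiv
  have k1 : fderiv ℝ F (φ x) (fieldInChart I V x (φ x)) = fieldInChart I' V' (f x) (F (φ x)) :=
    (key V V' hV).self_of_nhds
  have k2 : fderiv ℝ F (φ x) (fieldInChart I W x (φ x)) = fieldInChart I' W' (f x) (F (φ x)) :=
    (key W W' hW).self_of_nhds
  rw [← k1, ← k2]
  exact congrArg₂ (fun a b : E →L[ℝ] E' => a (fieldInChart I V x (φ x)) -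
    b (fieldInChart I W x (φ x))) r2 r1

end RelatedFields

section GroupHom

open VectorField

variable {E : Type*} [NormedAddCommGroup E] [NormedSpace ℝ E]
  {H : Type*} [TopologicalSpace H] {I : ModelWithCorners ℝ E H}
  {M : Type*} [TopologicalSpace M] [ChartedSpace H M] [Group M] [LieGroup I ∞ M]
  {E' : Type*} [NormedAddCommGroup E'] [NormedSpace ℝ E']
  {H' : Type*} [TopologicalSpace H'] {I' : ModelWithCorners ℝ E' H'}
  {M' : Type*} [TopologicalSpace M'] [ChartedSpace H' M'] [Group M'] [LieGroup I' ∞ M']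

variable (I M) in
theorem lieGroup_minSmoothness : LieGroup I (minSmoothness ℝ 3) M := by
  refine LieGroup.of_le (n := ∞) ?_
  simp only [minSmoothness_of_isRCLikeNormedField]
  exact WithTop.coe_le_coe.2 le_top

theorem mfderiv_hom_mulInvariantVectorField (f : M →* M') (hf : ContMDiff I I' ∞ f)
    (v : GroupLieAlgebra I M) (g : M) :
    (mfderiv I I' f g (mulInvariantVectorField v g) : E') =
      mulInvariantVectorField (I := I') (mfderiv I I' f 1 v : E') (f g) := by
  have hd : ∀ g, MDifferentiableAt I I' f g := fun g => hf.contMDiffAt.mdifferentiableAt (by simp)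
  have e : f ∘ (fun x => g * x) = (fun x => f g * x) ∘ f := by
    funext x
    simp
  have hl : ∀ g x : M, MDifferentiableAt I I (fun x => g * x) x := fun g x =>
    (contMDiff_mul_left (n := ∞)).contMDiffAt.mdifferentiableAt (by simp)
  have hl' : ∀ g x : M', MDifferentiableAt I' I' (fun x => g * x) x := fun g x =>
    (contMDiff_mul_left (n := ∞)).contMDiffAt.mdifferentiableAt (by simp)
  have c1 := mfderiv_comp (1 : M) (hd (g * 1)) (hl g 1)
  have c2 := mfderiv_comp (1 : M) (hl' (f g) (f 1)) (hd 1)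
  rw [e] at c1
  have c3 : ∀ a, a = g → ∀ z : E, (mfderiv I I' f g z : E') = mfderiv I I' f a z := by
    rintro _ rfl z
    rfl
  have c4 : ∀ a, a = 1 → ∀ z : E', (mfderiv I' I' (fun x => f g * x) a z : E') =
      mfderiv I' I' (fun x => f g * x) 1 z := by
    rintro _ rfl z
    rfl
  exact (c3 _ (mul_one g) _).trans ((DFunLike.congr_fun c1 v).symm.trans
    ((DFunLike.congr_fun c2 v).trans (c4 _ (map_one f) _)))

/-- The derivative at the identity of a smooth homomorphism of Lie groups is a homomorphism of
Lie algebras. -/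
theorem mfderiv_hom_bracket [CompleteSpace E] [CompleteSpace E'] [I.Boundaryless]
    [I'.Boundaryless] (f : M →* M') (hf : ContMDiff I I' ∞ f) (v w : GroupLieAlgebra I M) :
    (mfderiv I I' f 1 ⁅v, w⁆ : E') =
      @Bracket.bracket (GroupLieAlgebra I' M') (GroupLieAlgebra I' M') _
        (mfderiv I I' f 1 v : E') (mfderiv I I' f 1 w : E') := by
  have l1 : LieGroup I (minSmoothness ℝ 3) M := lieGroup_minSmoothness I M
  have l2 : LieGroup I' (minSmoothness ℝ 3) M' := lieGroup_minSmoothness I' M'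
  have h := mfderiv_mlieBracket_of_related hf
    (mfderiv_hom_mulInvariantVectorField f hf v) (mfderiv_hom_mulInvariantVectorField f hf w)
    (x := 1)
    (mdifferentiableAt_mulInvariantVectorField _) (mdifferentiableAt_mulInvariantVectorField _)
    (mdifferentiableAt_mulInvariantVectorField _) (mdifferentiableAt_mulInvariantVectorField _)
  have c : ∀ (V W : ∀ x : M', TangentSpace I' x) (a : M'), a = 1 →
      (mlieBracket I' V W a : E') = mlieBracket I' V W 1 := by
    rintro V W _ rfl
    rfl
  exact h.trans (c _ _ _ (map_one f))

end GroupHom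

section CentralExtensions

variable {EH : Type*} [NormedAddCommGroup EH] [NormedSpace ℝ EH] [CompleteSpace EH]
  {Ghat : Type*} [TopologicalSpace Ghat] [ChartedSpace EH Ghat] [Group Ghat]
  [LieGroup 𝓘(ℝ, EH) ∞ Ghat]
  {EG : Type*} [NormedAddCommGroup EG] [NormedSpace ℝ EG] [CompleteSpace EG]
  {G : Type*} [TopologicalSpace G] [ChartedSpace EG G] [Group G]
  [LieGroup 𝓘(ℝ, EG) ∞ G]

instance : LieGroup 𝓘(ℝ, LieT) ∞ Circle := LieGroup.of_le (m := ∞) (n := ω) le_top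

theorem lieBr_add_left (X Y Z : EG) : lieBr G (X + Y) Z = lieBr G X Z + lieBr G Y Z := by
  have := lieGroup_minSmoothness 𝓘(ℝ, EG) G
  exact add_lie (L := GroupLieAlgebra 𝓘(ℝ, EG) G) (M := GroupLieAlgebra 𝓘(ℝ, EG) G) X Y Z

theorem lieBr_add_right (X Y Z : EG) : lieBr G X (Y + Z) = lieBr G X Y + lieBr G X Z := by
  have := lieGroup_minSmoothness 𝓘(ℝ, EG) G
  exact lie_add (L := GroupLieAlgebra 𝓘(ℝ, EG) G) (M := GroupLieAlgebra 𝓘(ℝ, EG) G) X Y Z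

theorem lieBr_skew (X Y : EG) : lieBr G X Y = -lieBr G Y X := by
  have := lieGroup_minSmoothness 𝓘(ℝ, EG) G
  exact (lie_skew (L := GroupLieAlgebra 𝓘(ℝ, EG) G) X Y).symm

/-- If two smooth homomorphisms into `G` have commuting images, then so do the images of their
derivatives: `(z, g) ↦ f(z) f'(g)` is a homomorphism on the product, whose factors commute. -/
theorem lieBr_eq_zero_of_commute
    {E₁ : Type*} [NormedAddCommGroup E₁] [NormedSpace ℝ E₁] [CompleteSpace E₁]
    {G₁ : Type*} [TopologicalSpace G₁] [ChartedSpace E₁ G₁] [Group G₁] [LieGroup 𝓘(ℝ, E₁) ∞ G₁]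
    {E₂ : Type*} [NormedAddCommGroup E₂] [NormedSpace ℝ E₂] [CompleteSpace E₂]
    {G₂ : Type*} [TopologicalSpace G₂] [ChartedSpace E₂ G₂] [Group G₂] [LieGroup 𝓘(ℝ, E₂) ∞ G₂]
    (f₁ : G₁ →* G) (f₂ : G₂ →* G) (h₁ : ContMDiff 𝓘(ℝ, E₁) 𝓘(ℝ, EG) ∞ f₁)
    (h₂ : ContMDiff 𝓘(ℝ, E₂) 𝓘(ℝ, EG) ∞ f₂) (hc : ∀ x y, Commute (f₁ x) (f₂ y))
    (v : E₁) (w : E₂) :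
    lieBr G (tder 𝓘(ℝ, E₁) 𝓘(ℝ, EG) f₁ 1 v) (tder 𝓘(ℝ, E₂) 𝓘(ℝ, EG) f₂ 1 w) = 0 := by
  let J := 𝓘(ℝ, E₁).prod 𝓘(ℝ, E₂)
  let m : G₁ × G₂ →* G := MonoidHom.noncommCoprod f₁ f₂ hc
  have hm : ContMDiff J 𝓘(ℝ, EG) ∞ m := (h₁.comp contMDiff_fst).mul (h₂.comp contMDiff_snd)
  have l0 := lieGroup_minSmoothness J (G₁ × G₂)
  have l1 := lieGroup_minSmoothness 𝓘(ℝ, E₁) G₁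
  have l2 := lieGroup_minSmoothness 𝓘(ℝ, E₂) G₂
  let V : GroupLieAlgebra J (G₁ × G₂) := ((v, 0) : E₁ × E₂)
  let W : GroupLieAlgebra J (G₁ × G₂) := ((0, w) : E₁ × E₂)
  have b1 := mfderiv_hom_bracket (I' := 𝓘(ℝ, E₁)) (MonoidHom.fst G₁ G₂) contMDiff_fst V W
  have b2 := mfderiv_hom_bracket (I' := 𝓘(ℝ, E₂)) (MonoidHom.snd G₁ G₂) contMDiff_snd V W
  have b3 := mfderiv_hom_bracket m hm V W
  have d1 : ∀ z : E₁ × E₂, mfderiv J 𝓘(ℝ, E₁) (MonoidHom.fst G₁ G₂) 1 z = z.1 := fun z =>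
    DFunLike.congr_fun (mfderiv_fst (I := 𝓘(ℝ, E₁)) (I' := 𝓘(ℝ, E₂)) (x := (1 : G₁ × G₂))) z
  have d2 : ∀ z : E₁ × E₂, mfderiv J 𝓘(ℝ, E₂) (MonoidHom.snd G₁ G₂) 1 z = z.2 := fun z =>
    DFunLike.congr_fun (mfderiv_snd (I := 𝓘(ℝ, E₁)) (I' := 𝓘(ℝ, E₂)) (x := (1 : G₁ × G₂))) z
  have hmd : MDifferentiableAt J 𝓘(ℝ, EG) m (1, 1) := hm.contMDiffAt.mdifferentiableAt (by simp)
  have d3 : ∀ z : E₁ × E₂, tder J 𝓘(ℝ, EG) m 1 z =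
      tder 𝓘(ℝ, E₁) 𝓘(ℝ, EG) f₁ 1 z.1 + tder 𝓘(ℝ, E₂) 𝓘(ℝ, EG) f₂ 1 z.2 := by
    intro z
    have h : tder J 𝓘(ℝ, EG) m 1 z = tder 𝓘(ℝ, E₁) 𝓘(ℝ, EG) (fun x => m (x, 1)) 1 z.1 +
        tder 𝓘(ℝ, E₂) 𝓘(ℝ, EG) (fun x => m (1, x)) 1 z.2 :=
      mfderiv_prod_eq_add_apply (v := z) hmd
    have e1 : (fun x : G₁ => m (x, 1)) = f₁ := by
      funext x
      simp [m]
    have e2 : (fun x : G₂ => m (1, x)) = f₂ := by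
      funext x
      simp [m]
    rwa [e1, e2] at h
  let b : E₁ × E₂ := @Bracket.bracket (GroupLieAlgebra J (G₁ × G₂)) (GroupLieAlgebra J (G₁ × G₂)) _
    V W
  have z1 : b.1 = 0 := by
    refine (d1 _).symm.trans (b1.trans ?_)
    refine (congrArg₂ (fun a b : E₁ => lieBr G₁ a b) (d1 V) (d1 W)).trans ?_
    exact lie_zero (L := GroupLieAlgebra 𝓘(ℝ, E₁) G₁) (M := GroupLieAlgebra 𝓘(ℝ, E₁) G₁) v
  have z2 : b.2 = 0 := by
    refine (d2 _).symm.trans (b2.trans ?_)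
    refine (congrArg₂ (fun a b : E₂ => lieBr G₂ a b) (d2 V) (d2 W)).trans ?_
    exact zero_lie (L := GroupLieAlgebra 𝓘(ℝ, E₂) G₂) (M := GroupLieAlgebra 𝓘(ℝ, E₂) G₂) w
  have z3 : b = 0 := Prod.ext z1 z2
  have e1 := d3 (v, 0)
  have e2 := d3 (0, w)
  rw [map_zero, add_zero] at e1
  rw [map_zero, zero_add] at e2
  have b4 : tder J 𝓘(ℝ, EG) m 1 b = lieBr G (tder J 𝓘(ℝ, EG) m 1 (v, 0))
    (tder J 𝓘(ℝ, EG) m 1 (0, w)) := b3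
  rw [e1, e2, z3, map_zero] at b4
  exact b4.symm

theorem lieBr_circle (z w : LieT) : lieBr Circle z w = 0 := by
  have h := lieBr_eq_zero_of_commute (MonoidHom.id Circle) (MonoidHom.id Circle)
    (contMDiff_id (I := 𝓘(ℝ, LieT))) (contMDiff_id (I := 𝓘(ℝ, LieT)))
    (fun x y => Commute.all x y) z w
  have d : ∀ z : LieT, (mfderiv 𝓘(ℝ, LieT) 𝓘(ℝ, LieT) (MonoidHom.id Circle) 1 z : LieT) = z :=
    fun z => DFunLike.congr_fun (mfderiv_id (I := 𝓘(ℝ, LieT)) (x := (1 : Circle))) z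
  exact (congrArg₂ (fun a b : LieT => lieBr Circle a b) (d z) (d w)).symm.trans h

namespace CentralExtension

variable (C : CentralExtension EH Ghat EG G)

theorem dq_lieBr (X Y : EH) : C.dq (lieBr Ghat X Y) = lieBr G (C.dq X) (C.dq Y) :=
  mfderiv_hom_bracket C.q C.contMDiff_q X Y

theorem lieBr_dincl_left (z : LieT) (Y : EH) : lieBr Ghat (C.dincl z) Y = 0 := by
  have h := lieBr_eq_zero_of_commute C.incl (MonoidHom.id Ghat) C.contMDiff_incl
    (contMDiff_id (I := 𝓘(ℝ, EH))) (fun x y => C.central x y) z Y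
  have d : (mfderiv 𝓘(ℝ, EH) 𝓘(ℝ, EH) (MonoidHom.id Ghat) 1 Y : EH) = Y :=
    DFunLike.congr_fun (mfderiv_id (I := 𝓘(ℝ, EH)) (x := (1 : Ghat))) Y
  exact (congrArg (fun b : EH => lieBr Ghat (C.dincl z) b) d).symm.trans h

theorem lieBr_dincl_right (Y : EH) (z : LieT) : lieBr Ghat Y (C.dincl z) = 0 := by
  rw [lieBr_skew, lieBr_dincl_left, neg_zero]

end CentralExtension

end CentralExtensions

/-! ### Local sections and division in principal bundles -/

section PrincipalBundles

variable {EG : Type*} [NormedAddCommGroup EG] [NormedSpace ℝ EG]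
  {G : Type*} [TopologicalSpace G] [ChartedSpace EG G] [Group G] [LieGroup 𝓘(ℝ, EG) ∞ G]
  {EP : Type*} [NormedAddCommGroup EP] [NormedSpace ℝ EP]
  {P : Type*} [TopologicalSpace P] [ChartedSpace EP P]
  {EX : Type*} [NormedAddCommGroup EX] [NormedSpace ℝ EX]
  {X : Type*} [TopologicalSpace X] [ChartedSpace EX X]
  {EM : Type*} [NormedAddCommGroup EM] [NormedSpace ℝ EM]
  {HM : Type*} [TopologicalSpace HM] {IM : ModelWithCorners ℝ EM HM}
  {M : Type*} [TopologicalSpace M] [ChartedSpace HM M]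

namespace PrincipalBundle

theorem proj_surjective (B : PrincipalBundle EG G EP P EX X) : Function.Surjective B.proj := by
  intro x
  obtain ⟨e, hx, -⟩ := B.locally_trivial x
  exact ⟨e.toOpenPartialHomeomorph.symm (x, 1), e.proj_symm_apply' hx⟩

/-- Through every point of a principal bundle passes a local smooth section `s`, and every point
`p` over its domain is `s(x)δ(p)` for a smooth `δ`. -/
theorem exists_section (B : PrincipalBundle EG G EP P EX X) (p₀ : P) :
    ∃ (U : Set X) (s : X → P) (δ : P → G), IsOpen U ∧ B.proj p₀ ∈ U ∧
      ContMDiffOn 𝓘(ℝ, EX) 𝓘(ℝ, EP) ∞ s U ∧ (∀ x ∈ U, B.proj (s x) = x) ∧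
      s (B.proj p₀) = p₀ ∧ ContMDiffOn 𝓘(ℝ, EP) 𝓘(ℝ, EG) ∞ δ (B.proj ⁻¹' U) ∧
      ∀ p, B.proj p ∈ U → B.act (s (B.proj p)) (δ p) = p := by
  obtain ⟨e, hx, he, hs, hact⟩ := B.locally_trivial (B.proj p₀)
  have hsrc : ∀ p, B.proj p ∈ e.baseSet → p ∈ e.source := fun p hp => e.mem_source.2 hp
  have hproj : ∀ x ∈ e.baseSet, ∀ g, B.proj (e.toOpenPartialHomeomorph.symm (x, g)) = x :=
    fun x hx g => e.proj_symm_apply' hx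
  refine ⟨e.baseSet, fun x => e.toOpenPartialHomeomorph.symm (x, (e p₀).2),
    fun p => (e p₀).2⁻¹ * (e p).2, e.open_baseSet, hx, ?_, fun x hx => hproj x hx _, ?_, ?_, ?_⟩
  · refine hs.comp (contMDiffOn_id.prodMk contMDiffOn_const) ?_
    intro x hx
    exact e.mem_target.2 hx
  · have h1 : e p₀ = (B.proj p₀, (e p₀).2) := Prod.ext (e.coe_fst (hsrc _ hx)) rfl
    change e.toOpenPartialHomeomorph.symm (B.proj p₀, (e p₀).2) = p₀
    rw [← h1]
    exact e.toOpenPartialHomeomorph.left_inv (hsrc _ hx)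
  · have h1 : ContMDiffOn 𝓘(ℝ, EP) 𝓘(ℝ, EG) ∞ (fun p => (e p).2) (B.proj ⁻¹' e.baseSet) := by
      rw [← e.source_eq]
      exact contMDiff_snd.comp_contMDiffOn he
    exact contMDiffOn_const.mul h1
  · intro p hp
    set q := e.toOpenPartialHomeomorph.symm (B.proj p, (e p₀).2) with hq
    have hq1 : B.proj q = B.proj p := hproj _ hp _
    have hqs : q ∈ e.source := hsrc _ (hq1 ▸ hp)
    have hq2 : (e q).2 = (e p₀).2 := by
      have := e.apply_symm_apply' (x := (e p₀).2) hp
      rw [hq, this]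
    have hmem : B.act q ((e p₀).2⁻¹ * (e p).2) ∈ e.source :=
      hsrc _ (by rw [B.proj_act, hq1]; exact hp)
    refine e.injOn hmem (hsrc _ hp) (Prod.ext ?_ ?_)
    · exact (e.coe_fst hmem).trans
        ((B.proj_act _ _).trans (hq1.trans (e.coe_fst (hsrc _ hp)).symm))
    · exact (hact q hqs _).trans (by rw [hq2, mul_inv_cancel_left]; rfl)

/-- Two smooth maps into a principal bundle with the same projection differ by a smooth map
into the structure group. -/
theorem exists_smooth_div (B : PrincipalBundle EG G EP P EX X) {a b : M → P} {U : Set M}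
    (ha : ContMDiffOn IM 𝓘(ℝ, EP) ∞ a U) (hb : ContMDiffOn IM 𝓘(ℝ, EP) ∞ b U)
    (h : ∀ m ∈ U, B.proj (a m) = B.proj (b m)) :
    ∃ u : M → G, ContMDiffOn IM 𝓘(ℝ, EG) ∞ u U ∧ ∀ m ∈ U, B.act (a m) (u m) = b m := by
  classical
  have hex : ∀ m, ∃ g, m ∈ U → B.act (a m) g = b m := fun m =>
    if hm : m ∈ U then (exists_act (h m hm)).imp fun g hg _ => hg else ⟨1, fun h => absurd h hm⟩
  choose u hu using hex
  refine ⟨u, fun m hm => ?_, hu⟩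
  obtain ⟨W, s, δ, hW, hmW, -, -, -, hδ, hsδ⟩ := B.exists_section (a m)
  have key : ∀ n ∈ U, B.proj (a n) ∈ W → u n = (δ (a n))⁻¹ * δ (b n) := by
    intro n hn hnW
    apply B.act_injective (a n)
    have h1 := hsδ _ hnW
    have h2 := hsδ (b n) (h n hn ▸ hnW)
    rw [← h n hn] at h2
    calc B.act (a n) (u n) = b n := hu n hn
      _ = B.act (s (B.proj (a n))) (δ (a n) * ((δ (a n))⁻¹ * δ (b n))) := by
        rw [mul_inv_cancel_left, h2]
      _ = _ := by rw [B.act_mul, h1]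
  have hpre : ContMDiffWithinAt IM 𝓘(ℝ, EG) ∞ (fun n => (δ (a n))⁻¹ * δ (b n)) U m := by
    have hW' : IsOpen (B.proj ⁻¹' W) := hW.preimage B.contMDiff_proj.continuous
    have h1 : ContMDiffAt 𝓘(ℝ, EP) 𝓘(ℝ, EG) ∞ δ (a m) := hδ.contMDiffAt (hW'.mem_nhds hmW)
    have h2 : ContMDiffAt 𝓘(ℝ, EP) 𝓘(ℝ, EG) ∞ δ (b m) :=
      hδ.contMDiffAt (hW'.mem_nhds (by rw [Set.mem_preimage, ← h m hm]; exact hmW))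
    exact (h1.comp_contMDiffWithinAt m (ha m hm)).inv.mul (h2.comp_contMDiffWithinAt m (hb m hm))
  refine hpre.congr_of_eventuallyEq ?_ (key m hm hmW)
  have hc : ContinuousWithinAt (fun n => B.proj (a n)) U m :=
    B.contMDiff_proj.continuous.continuousAt.comp_continuousWithinAt (ha m hm).continuousWithinAt
  filter_upwards [hc (hW.mem_nhds hmW), self_mem_nhdsWithin] with n hn1 hn2
  exact key n hn2 hn1

/-- A free action with local smooth sections `s` for which every point `p` over the domain is
`s(x)δ(p)` with `δ` smooth is a principal bundle: `p ↦ (x, δ(p))` is a trivialization. -/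
def ofSections (proj : P → X) (act : P → G → P) (act_one : ∀ p, act p 1 = p)
    (act_mul : ∀ p g h, act p (g * h) = act (act p g) h)
    (proj_act : ∀ p g, proj (act p g) = proj p)
    (contMDiff_proj : ContMDiff 𝓘(ℝ, EP) 𝓘(ℝ, EX) ∞ proj)
    (contMDiff_act : ContMDiff (𝓘(ℝ, EP).prod 𝓘(ℝ, EG)) 𝓘(ℝ, EP) ∞
      (fun x : P × G => act x.1 x.2))
    (free : ∀ p g h, act p g = act p h → g = h)
    (sections : ∀ x : X, ∃ (U : Set X) (s : X → P) (δ : P → G), IsOpen U ∧ x ∈ U ∧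
      ContMDiffOn 𝓘(ℝ, EX) 𝓘(ℝ, EP) ∞ s U ∧ (∀ x ∈ U, proj (s x) = x) ∧
      ContMDiffOn 𝓘(ℝ, EP) 𝓘(ℝ, EG) ∞ δ (proj ⁻¹' U) ∧
      ∀ p, proj p ∈ U → act (s (proj p)) (δ p) = p) :
    PrincipalBundle EG G EP P EX X where
  proj := proj
  act := act
  act_one := act_one
  act_mul := act_mul
  proj_act := proj_act
  contMDiff_proj := contMDiff_proj
  contMDiff_act := contMDiff_act
  locally_trivial x := by
    obtain ⟨U, s, δ, hU, hx, hs, hps, hδ, hsδ⟩ := sections x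
    have hU' : IsOpen (proj ⁻¹' U) := hU.preimage contMDiff_proj.continuous
    have hδs : ∀ x ∈ U, ∀ g, δ (act (s x) g) = g := by
      intro x hx g
      have h1 := hsδ (act (s x) g) (by rw [proj_act, hps x hx]; exact hx)
      rw [proj_act, hps x hx] at h1
      exact free _ _ _ h1
    have c1 : ContMDiffOn 𝓘(ℝ, EP) (𝓘(ℝ, EX).prod 𝓘(ℝ, EG)) ∞ (fun p => (proj p, δ p))
        (proj ⁻¹' U) := contMDiff_proj.contMDiffOn.prodMk hδ
    have c2 : ContMDiffOn (𝓘(ℝ, EX).prod 𝓘(ℝ, EG)) 𝓘(ℝ, EP) ∞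
        (fun y : X × G => act (s y.1) y.2) (U ×ˢ Set.univ) := by
      refine contMDiff_act.comp_contMDiffOn (f := fun y : X × G => (s y.1, y.2)) ?_
      exact (hs.comp contMDiffOn_fst fun y hy => hy.1).prodMk contMDiffOn_snd
    let e : Bundle.Trivialization G proj :=
      { toFun := fun p => (proj p, δ p)
        invFun := fun y => act (s y.1) y.2
        source := proj ⁻¹' U
        target := U ×ˢ Set.univ
        map_source' := fun p hp => ⟨hp, trivial⟩
        map_target' := fun y hy => by
          simp only [Set.mem_preimage, proj_act, hps _ hy.1]
          exact hy.1
        left_inv' := fun p hp => hsδ p hp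
        right_inv' := fun y hy => Prod.ext ((proj_act _ _).trans (hps _ hy.1)) (hδs _ hy.1 _)
        open_source := hU'
        open_target := hU.prod isOpen_univ
        continuousOn_toFun := c1.continuousOn
        continuousOn_invFun := c2.continuousOn
        baseSet := U
        open_baseSet := hU
        source_eq := rfl
        target_eq := rfl
        proj_toFun := fun p _ => rfl }
    refine ⟨e, hx, c1, c2, fun p hp g => ?_⟩
    change δ (act p g) = δ p * g
    apply free (s (proj p))
    have h1 := hsδ p hp
    have h2 := hsδ (act p g) (by rw [proj_act]; exact hp)
    rw [proj_act] at h2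
    rw [h2, act_mul, h1]

end PrincipalBundle

end PrincipalBundles

/-! ### Calculus on Lie groups and connections -/

section LieGroupCalculus

variable {EG : Type*} [NormedAddCommGroup EG] [NormedSpace ℝ EG]
  {G : Type*} [TopologicalSpace G] [ChartedSpace EG G] [Group G] [LieGroup 𝓘(ℝ, EG) ∞ G]
  {EH : Type*} [NormedAddCommGroup EH] [NormedSpace ℝ EH]
  {Ghat : Type*} [TopologicalSpace Ghat] [ChartedSpace EH Ghat] [Group Ghat]
  [LieGroup 𝓘(ℝ, EH) ∞ Ghat]

theorem Ad_eq_tder (g : G) : Ad g = tder 𝓘(ℝ, EG) 𝓘(ℝ, EG) (fun x : G => g * x * g⁻¹) 1 := rfl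

variable (EG) in
theorem contMDiff_conj (g : G) : ContMDiff 𝓘(ℝ, EG) 𝓘(ℝ, EG) ∞ (fun x : G => g * x * g⁻¹) :=
  (contMDiff_mul_left (a := g)).mul contMDiff_const

theorem mdifferentiableAt_of_contMDiff
    {E : Type*} [NormedAddCommGroup E] [NormedSpace ℝ E]
    {H : Type*} [TopologicalSpace H] {I : ModelWithCorners ℝ E H}
    {M : Type*} [TopologicalSpace M] [ChartedSpace H M]
    {E' : Type*} [NormedAddCommGroup E'] [NormedSpace ℝ E']
    {H' : Type*} [TopologicalSpace H'] {I' : ModelWithCorners ℝ E' H'}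
    {M' : Type*} [TopologicalSpace M'] [ChartedSpace H' M']
    {f : M → M'} (hf : ContMDiff I I' ∞ f) (p : M) : MDifferentiableAt I I' f p :=
  hf.mdifferentiable (by simp) p

/-- Homomorphisms intertwine the adjoint actions. -/
theorem tder_hom_Ad (f : Ghat →* G) (hf : ContMDiff 𝓘(ℝ, EH) 𝓘(ℝ, EG) ∞ f) (g : Ghat) (Y : EH) :
    tder 𝓘(ℝ, EH) 𝓘(ℝ, EG) f 1 (Ad g Y) = Ad (f g) (tder 𝓘(ℝ, EH) 𝓘(ℝ, EG) f 1 Y) := by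
  have h1 := tder_comp_apply (I := 𝓘(ℝ, EH)) (I' := 𝓘(ℝ, EH)) (I'' := 𝓘(ℝ, EG)) (g := f)
    (f := fun x => g * x * g⁻¹) (p := 1) (mdifferentiableAt_of_contMDiff hf _)
    (mdifferentiableAt_of_contMDiff (contMDiff_conj EH g) _) Y
  have h2 := tder_comp_apply (I := 𝓘(ℝ, EH)) (I' := 𝓘(ℝ, EG)) (I'' := 𝓘(ℝ, EG))
    (g := fun x => f g * x * (f g)⁻¹) (f := f) (p := 1)
    (mdifferentiableAt_of_contMDiff (contMDiff_conj EG (f g)) _)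
    (mdifferentiableAt_of_contMDiff hf _) Y
  simp only [map_mul, map_inv, mul_one, mul_inv_cancel, map_one] at h1 h2
  rw [Ad_eq_tder, Ad_eq_tder, ← h1, h2]

/-- Homomorphisms intertwine the Maurer-Cartan forms. -/
theorem tder_hom_maurerCartan (f : Ghat →* G) (hf : ContMDiff 𝓘(ℝ, EH) 𝓘(ℝ, EG) ∞ f) (g : Ghat)
    (v : EH) :
    tder 𝓘(ℝ, EH) 𝓘(ℝ, EG) f 1 (maurerCartan g v) =
      maurerCartan (f g) (tder 𝓘(ℝ, EH) 𝓘(ℝ, EG) f g v) := by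
  have h1 := tder_comp_apply (I := 𝓘(ℝ, EH)) (I' := 𝓘(ℝ, EH)) (I'' := 𝓘(ℝ, EG)) (g := f)
    (f := fun x => g⁻¹ * x) (p := g) (mdifferentiableAt_of_contMDiff hf _)
    (mdifferentiableAt_of_contMDiff contMDiff_mul_left _) v
  have h2 := tder_comp_apply (I := 𝓘(ℝ, EH)) (I' := 𝓘(ℝ, EG)) (I'' := 𝓘(ℝ, EG))
    (g := fun x => (f g)⁻¹ * x) (f := f) (p := g)
    (mdifferentiableAt_of_contMDiff contMDiff_mul_left _)
    (mdifferentiableAt_of_contMDiff hf _) v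
  simp only [map_mul, map_inv, inv_mul_cancel] at h1 h2
  exact h1.symm.trans h2

theorem Ad_circle (u : Circle) (z : LieT) : Ad u z = z := by
  have : (fun x : Circle => u * x * u⁻¹) = fun x => x := by
    funext x
    rw [mul_comm u, mul_inv_cancel_right]
  rw [Ad_eq_tder, this, tder_id]
  rfl

theorem maurerCartan_one (v : EG) : maurerCartan (1 : G) v = v := by
  have : (fun x : G => (1 : G)⁻¹ * x) = fun x => x := by
    funext x
    simp
  exact DFunLike.congr_fun ((congrArg (fun f : G → G => tder 𝓘(ℝ, EG) 𝓘(ℝ, EG) f 1) this).trans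
    (tder_id 1)) v

namespace CentralExtension

variable (C : CentralExtension EH Ghat EG G)

theorem q_incl (z : Circle) : C.q (C.incl z) = 1 := (C.ker_q _).2 ⟨z, rfl⟩

theorem dq_Ad (g : Ghat) (Y : EH) : C.dq (Ad g Y) = Ad (C.q g) (C.dq Y) :=
  tder_hom_Ad C.q C.contMDiff_q g Y

theorem dq_maurerCartan (g : Ghat) (v : EH) :
    C.dq (maurerCartan g v) = maurerCartan (C.q g) (tder 𝓘(ℝ, EH) 𝓘(ℝ, EG) C.q g v) :=
  tder_hom_maurerCartan C.q C.contMDiff_q g v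

theorem scalar_dincl (z : LieT) : C.scalar (C.dincl z) = z := C.exists_retraction.choose_spec z

theorem dq_dincl (z : LieT) : C.dq (C.dincl z) = 0 := by
  have h1 := tder_comp_apply (I := 𝓘(ℝ, LieT)) (I' := 𝓘(ℝ, EH)) (I'' := 𝓘(ℝ, EG)) (g := C.q)
    (f := C.incl) (p := 1) (mdifferentiableAt_of_contMDiff C.contMDiff_q _)
    (mdifferentiableAt_of_contMDiff C.contMDiff_incl _) z
  simp only [C.q_incl, tder_const, map_one] at h1
  exact h1.symm

theorem Ad_dincl (g : Ghat) (z : LieT) : Ad g (C.dincl z) = C.dincl z := by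
  have h1 := tder_comp_apply (I := 𝓘(ℝ, LieT)) (I' := 𝓘(ℝ, EH)) (I'' := 𝓘(ℝ, EH))
    (g := fun x => g * x * g⁻¹)
    (f := C.incl) (p := 1) (mdifferentiableAt_of_contMDiff (contMDiff_conj EH g) _)
    (mdifferentiableAt_of_contMDiff C.contMDiff_incl _) z
  simp only [← C.central, mul_inv_cancel_right, map_one] at h1
  exact h1.symm

theorem Ad_incl (u : Circle) (Y : EH) : Ad (C.incl u) Y = Y := by
  have : (fun x : Ghat => C.incl u * x * (C.incl u)⁻¹) = fun x => x := by
    funext x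
    rw [C.central, mul_inv_cancel_right]
  rw [Ad_eq_tder, this, tder_id]
  rfl

theorem AdHat_q (g : Ghat) : C.AdHat (C.q g) = Ad g := by
  have h1 : C.q (Function.surjInv C.q_surjective (C.q g)) = C.q g := Function.surjInv_eq _ _
  set g' := Function.surjInv C.q_surjective (C.q g)
  obtain ⟨u, hu⟩ := (C.ker_q (g⁻¹ * g')).1 (by simp [h1])
  have h2 : g' = C.incl u * g := by rw [C.central, hu, mul_inv_cancel_left]
  have h3 : (fun x : Ghat => g' * x * g'⁻¹) = fun x => g * x * g⁻¹ := by
    funext x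
    rw [h2, mul_assoc (C.incl u), mul_assoc (C.incl u), C.central, mul_inv_rev]
    simp [mul_assoc]
  change Ad g' = Ad g
  rw [Ad_eq_tder, h3, Ad_eq_tder]

/-- Exactness of `iℝ → Lie Ĝ → Lie G` in the middle: near `1`, an element of `Ĝ` is
`s(q(g)) δ(g)` for a local section `s` through `1` and a smooth map `δ` to the circle. -/
theorem exists_dincl_eq {Z : EH} (hZ : C.dq Z = 0) : ∃ z, C.dincl z = Z := by
  obtain ⟨U, s, δ, hU, h1U, hs, -, hs1, hδ, hsδ⟩ := C.bundle.exists_section 1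
  have hp : C.bundle.proj = C.q := C.bundle_proj
  simp only [hp, map_one, C.bundle_act] at h1U hs1 hδ hsδ
  have hU' : C.q ⁻¹' U ∈ 𝓝 (1 : Ghat) :=
    (hU.preimage C.contMDiff_q.continuous).mem_nhds (by simpa using h1U)
  have hδ1 : MDifferentiableAt 𝓘(ℝ, EH) 𝓘(ℝ, LieT) δ 1 :=
    (hδ.contMDiffAt hU').mdifferentiableAt (by simp)
  have hs1' : MDifferentiableAt 𝓘(ℝ, EG) 𝓘(ℝ, EH) s 1 :=
    (hs.contMDiffAt (hU.mem_nhds h1U)).mdifferentiableAt (by simp)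
  have hδ2 : δ 1 = 1 := by
    have := hsδ 1 (by simpa using h1U)
    rw [map_one, hs1, one_mul] at this
    exact C.incl_injective (by rw [this, map_one])
  have e : (fun g => s (C.q g) * C.incl (δ g)) =ᶠ[𝓝 1] fun g => g := by
    filter_upwards [hU'] with g hg
    exact hsδ g hg
  have h1 := tder_congr (I := 𝓘(ℝ, EH)) (I' := 𝓘(ℝ, EH)) e
  have dq1 : MDifferentiableAt 𝓘(ℝ, EH) 𝓘(ℝ, EG) C.q 1 :=
    mdifferentiableAt_of_contMDiff C.contMDiff_q 1
  have hq1 : MDifferentiableAt 𝓘(ℝ, EG) 𝓘(ℝ, EH) s (C.q 1) := by rwa [map_one]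
  have hi1 : MDifferentiableAt 𝓘(ℝ, LieT) 𝓘(ℝ, EH) C.incl (δ 1) :=
    mdifferentiableAt_of_contMDiff C.contMDiff_incl _
  have h2 := tder_comp₂ (I := 𝓘(ℝ, EH)) (I' := 𝓘(ℝ, EH)) (I'' := 𝓘(ℝ, EH)) (I₃ := 𝓘(ℝ, EH))
    (F := fun x : Ghat × Ghat => x.1 * x.2) (a := fun g => s (C.q g)) (b := fun g => C.incl (δ g))
    (p := 1) (mdifferentiableAt_of_contMDiff (contMDiff_mul 𝓘(ℝ, EH) ∞) _)
    (hq1.comp 1 dq1) (hi1.comp 1 hδ1) Z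
  have h3 : tder 𝓘(ℝ, EH) 𝓘(ℝ, EG) C.q 1 Z = 0 := hZ
  rw [h1, tder_id, tder_comp_apply hq1 dq1, tder_comp_apply hi1 hδ1, h3] at h2
  simp only [map_zero, zero_add, hδ2, map_one, hs1, one_mul, tder_id] at h2
  exact ⟨tder 𝓘(ℝ, EH) 𝓘(ℝ, LieT) δ 1 Z, h2.symm⟩

theorem dincl_scalar {Z : EH} (hZ : C.dq Z = 0) : C.dincl (C.scalar Z) = Z := by
  obtain ⟨z, rfl⟩ := C.exists_dincl_eq hZ
  rw [C.scalar_dincl]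

end CentralExtension

end LieGroupCalculus

section ConnectionCalculus

variable {EG : Type*} [NormedAddCommGroup EG] [NormedSpace ℝ EG]
  {G : Type*} [TopologicalSpace G] [ChartedSpace EG G] [Group G] [LieGroup 𝓘(ℝ, EG) ∞ G]
  {EP : Type*} [NormedAddCommGroup EP] [NormedSpace ℝ EP]
  {P : Type*} [TopologicalSpace P] [ChartedSpace EP P] [IsManifold 𝓘(ℝ, EP) ∞ P]
  {EX : Type*} [NormedAddCommGroup EX] [NormedSpace ℝ EX]
  {X : Type*} [TopologicalSpace X] [ChartedSpace EX X]
  {EM : Type*} [NormedAddCommGroup EM] [NormedSpace ℝ EM]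
  {HM : Type*} [TopologicalSpace HM] {IM : ModelWithCorners ℝ EM HM}
  {M : Type*} [TopologicalSpace M] [ChartedSpace HM M]
  {B : PrincipalBundle EG G EP P EX X}

/-- A connection form as a function into linear maps of the model spaces. -/
def Connection.val (θ : Connection B) (p : P) : EP →L[ℝ] EG := θ.form p

theorem PrincipalBundle.contMDiff_act_right (B : PrincipalBundle EG G EP P EX X) (g : G) :
    ContMDiff 𝓘(ℝ, EP) 𝓘(ℝ, EP) ∞ (fun p => B.act p g) :=
  B.contMDiff_act.comp (f := fun p => (p, g)) (contMDiff_id.prodMk contMDiff_const)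

theorem PrincipalBundle.contMDiff_orbit (B : PrincipalBundle EG G EP P EX X) (p : P) :
    ContMDiff 𝓘(ℝ, EG) 𝓘(ℝ, EP) ∞ (fun g => B.act p g) :=
  B.contMDiff_act.comp (f := fun g => (p, g)) (contMDiff_const.prodMk contMDiff_id)

/-- The Leibniz rule for a connection: `θ(d(ag)) = Ad(g⁻¹)θ(da) + μ(dg)`. -/
theorem Connection.val_act (θ : Connection B) {a : M → P} {g : M → G} {m : M}
    (ha : MDifferentiableAt IM 𝓘(ℝ, EP) a m) (hg : MDifferentiableAt IM 𝓘(ℝ, EG) g m) (v : EM) :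
    θ.val (B.act (a m) (g m)) (tder IM 𝓘(ℝ, EP) (fun x => B.act (a x) (g x)) m v) =
      Ad (g m)⁻¹ (θ.val (a m) (tder IM 𝓘(ℝ, EP) a m v)) +
        (maurerCartan (g m) (tder IM 𝓘(ℝ, EG) g m v) : EG) := by
  have h1 := tder_comp₂ (F := fun x : P × G => B.act x.1 x.2) (p := m)
    (mdifferentiableAt_of_contMDiff B.contMDiff_act _) ha hg v
  have h2 : θ.val (B.act (a m) (g m)) (tder 𝓘(ℝ, EP) 𝓘(ℝ, EP) (fun p => B.act p (g m)) (a m)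
      (tder IM 𝓘(ℝ, EP) a m v)) = Ad (g m)⁻¹ (θ.val (a m) (tder IM 𝓘(ℝ, EP) a m v)) :=
    θ.form_act (a m) (g m) _
  have h3 : tder 𝓘(ℝ, EG) 𝓘(ℝ, EP) (fun h => B.act (a m) h) (g m) (tder IM 𝓘(ℝ, EG) g m v) =
      tder 𝓘(ℝ, EG) 𝓘(ℝ, EP) (fun h => B.act (B.act (a m) (g m)) h) 1
        (maurerCartan (g m) (tder IM 𝓘(ℝ, EG) g m v)) := by
    have h4 := tder_comp_apply (I := 𝓘(ℝ, EG)) (I' := 𝓘(ℝ, EG)) (I'' := 𝓘(ℝ, EP))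
      (g := fun h => B.act (B.act (a m) (g m)) h) (f := fun h => (g m)⁻¹ * h) (p := g m)
      (mdifferentiableAt_of_contMDiff (B.contMDiff_orbit _) _)
      (mdifferentiableAt_of_contMDiff contMDiff_mul_left _) (tder IM 𝓘(ℝ, EG) g m v)
    simp only [← B.act_mul, mul_inv_cancel_left, inv_mul_cancel] at h4
    simp only [← B.act_mul]
    exact h4
  rw [h1, map_add, h2, h3]
  exact congrArg _ (θ.form_fundamental _ _)

end ConnectionCalculus

/-! ### The smooth structure of `J_B` -/

section LiftJ

variable {EH : Type*} [NormedAddCommGroup EH] [NormedSpace ℝ EH]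
  {Ghat : Type*} [TopologicalSpace Ghat] [ChartedSpace EH Ghat] [Group Ghat]
  {EG : Type*} [NormedAddCommGroup EG] [NormedSpace ℝ EG]
  {G : Type*} [TopologicalSpace G] [ChartedSpace EG G] [Group G]
  {EX : Type*} [NormedAddCommGroup EX] [NormedSpace ℝ EX]
  {X : Type*} [TopologicalSpace X] [ChartedSpace EX X]
  {EB : Type*} [NormedAddCommGroup EB] [NormedSpace ℝ EB]
  {B : Type*} [TopologicalSpace B] [ChartedSpace EB B]

namespace LiftJ

variable (C : CentralExtension EH Ghat EG G) (β : PrincipalBundle EG G EB B EX X)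

/-- The charts of `J_B` are those of `B × Ĝ` composed with `homeo`, which therefore is the identity
in charts. -/
theorem contMDiff_homeo :
    ContMDiff (𝓘(ℝ, EB).prod 𝓘(ℝ, EH)) (𝓘(ℝ, EB).prod 𝓘(ℝ, EH)) ∞ (homeo C β) := by
  intro x
  rw [contMDiffAt_iff]
  refine ⟨(homeo C β).continuous.continuousAt, ?_⟩
  set φ := extChartAt (𝓘(ℝ, EB).prod 𝓘(ℝ, EH)) (homeo C β x)
  have hφ : extChartAt (𝓘(ℝ, EB).prod 𝓘(ℝ, EH)) x x = φ (homeo C β x) := rfl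
  refine contDiffWithinAt_id.congr_of_eventuallyEq ?_ ?_
  · have := extChartAt_target_mem_nhdsWithin (I := 𝓘(ℝ, EB).prod 𝓘(ℝ, EH)) (homeo C β x)
    rw [hφ]
    filter_upwards [this] with y hy
    refine Eq.trans ?_ (φ.right_inv hy)
    exact congrArg φ ((homeo C β).apply_symm_apply (φ.symm y))
  · rw [hφ]
    refine Eq.trans ?_ (φ.right_inv (mem_extChartAt_target (homeo C β x)))
    exact congrArg φ ((homeo C β).apply_symm_apply (φ.symm _))

theorem contMDiff_homeo_symm :
    ContMDiff (𝓘(ℝ, EB).prod 𝓘(ℝ, EH)) (𝓘(ℝ, EB).prod 𝓘(ℝ, EH)) ∞ (homeo C β).symm := by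
  intro y
  obtain ⟨x, rfl⟩ := (homeo C β).surjective y
  rw [contMDiffAt_iff]
  refine ⟨(homeo C β).symm.continuous.continuousAt, ?_⟩
  rw [Homeomorph.symm_apply_apply]
  set φ := extChartAt (𝓘(ℝ, EB).prod 𝓘(ℝ, EH)) (homeo C β x) with hφ
  have key : ∀ y, (extChartAt (𝓘(ℝ, EB).prod 𝓘(ℝ, EH)) x ∘ (homeo C β).symm ∘ φ.symm) y =
      φ (φ.symm y) := fun y => congrArg φ ((homeo C β).apply_symm_apply (φ.symm y))
  refine contDiffWithinAt_id.congr_of_eventuallyEq ?_ ?_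
  · have := extChartAt_target_mem_nhdsWithin (I := 𝓘(ℝ, EB).prod 𝓘(ℝ, EH)) (homeo C β x)
    filter_upwards [this] with y hy
    exact (key y).trans (φ.right_inv hy)
  · exact (key _).trans (φ.right_inv (mem_extChartAt_target (homeo C β x)))

theorem contMDiff_fst : ContMDiff (𝓘(ℝ, EB).prod 𝓘(ℝ, EH)) 𝓘(ℝ, EB) ∞
    (fun x : LiftJ C β => x.1.1) :=
  ContMDiff.comp (g := fun y : B × Ghat => y.1) (f := homeo C β) _root_.contMDiff_fst
    (contMDiff_homeo C β)

theorem contMDiff_elt : ContMDiff (𝓘(ℝ, EB).prod 𝓘(ℝ, EH)) 𝓘(ℝ, EH) ∞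
    (fun x : LiftJ C β => x.1.2.2) :=
  ContMDiff.comp (g := fun y : B × Ghat => y.2) (f := homeo C β) contMDiff_snd
    (contMDiff_homeo C β)

end LiftJ

end LiftJ

/-! ### Cocycles and the curvature of compatible connections -/

section Curvature

variable {EH : Type*} [NormedAddCommGroup EH] [NormedSpace ℝ EH] [CompleteSpace EH]
  {Ghat : Type*} [TopologicalSpace Ghat] [ChartedSpace EH Ghat] [Group Ghat]
  [LieGroup 𝓘(ℝ, EH) ∞ Ghat]
  {EG : Type*} [NormedAddCommGroup EG] [NormedSpace ℝ EG] [CompleteSpace EG]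
  {G : Type*} [TopologicalSpace G] [ChartedSpace EG G] [Group G]
  [LieGroup 𝓘(ℝ, EG) ∞ G]
  {EX : Type*} [NormedAddCommGroup EX] [NormedSpace ℝ EX]
  {X : Type*} [TopologicalSpace X] [ChartedSpace EX X]
  {EB : Type*} [NormedAddCommGroup EB] [NormedSpace ℝ EB]
  {B : Type*} [TopologicalSpace B] [ChartedSpace EB B] [IsManifold 𝓘(ℝ, EB) ∞ B]
  {C : CentralExtension EH Ghat EG G} {β : PrincipalBundle EG G EB B EX X}
  {σ : EG →L[ℝ] EH}

namespace CentralExtension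

theorem dincl_groupCocycle (hσ : C.IsSplit σ) (g : Ghat) (Y : EG) :
    C.dincl (C.groupCocycle σ (C.q g)⁻¹ Y) = Ad g⁻¹ (σ Y) - σ (Ad (C.q g)⁻¹ Y) := by
  have h : C.groupCocycle σ (C.q g)⁻¹ Y = C.scalar (Ad g⁻¹ (σ Y) - σ (Ad (C.q g)⁻¹ Y)) := by
    rw [← C.AdHat_q, map_inv]
    rfl
  rw [h, C.dincl_scalar]
  rw [map_sub, C.dq_Ad, hσ, hσ, map_inv, sub_self]

theorem dincl_lieCocycle (hσ : C.IsSplit σ) (Y Z : EG) :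
    C.dincl (C.lieCocycle σ Y Z) = lieBr Ghat (σ Y) (σ Z) - σ (lieBr G Y Z) := by
  rw [lieCocycle, C.dincl_scalar]
  rw [map_sub, C.dq_lieBr, hσ, hσ, hσ, sub_self]

theorem dincl_nu (hσ : C.IsSplit σ) (g : Ghat) (v : EH) :
    C.dincl (C.nu σ g v) =
      (maurerCartan g v : EH) - σ (maurerCartan (C.q g) (tder 𝓘(ℝ, EH) 𝓘(ℝ, EG) C.q g v)) := by
  have h : C.nu σ g v = C.scalar ((maurerCartan g v : EH) -
      σ (maurerCartan (C.q g) (tder 𝓘(ℝ, EH) 𝓘(ℝ, EG) C.q g v))) := rfl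
  rw [h, C.dincl_scalar]
  rw [map_sub, C.dq_maurerCartan, hσ, sub_self]

theorem dincl_injective : Function.Injective C.dincl :=
  Function.LeftInverse.injective C.scalar_dincl

end CentralExtension

theorem Splitting.bar_dincl (L : Splitting C β) (b : B) (z : LieT) :
    L.bar b (C.dincl z) = z := by
  have h := (L.L_mk b (C.dincl z)).symm.trans (L.L_incl b z)
  -- the second component is well defined on `B ×_Ad iℝ`, where the action is trivial
  let f : AssocBundle β (fun (_ : G) (z : LieT) => z) → LieT := Quot.lift (fun x => x.2) (by
    rintro x y ⟨g, rfl⟩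
    rfl)
  exact congrArg f h

variable {EL : Type*} [NormedAddCommGroup EL] [NormedSpace ℝ EL]
  {Bhat : Type*} [TopologicalSpace Bhat] [ChartedSpace EL Bhat] [IsManifold 𝓘(ℝ, EL) ∞ Bhat]
  {βhat : PrincipalBundle EH Ghat EL Bhat EX X}

/-- If `θ̂ = σ(q̂^*θ) + η` with a scalar form `η`, then the scalar curvature of `θ̂` is
`dη - q̂^*f`, where `f` is the curving of the lifting bundle gerbe. -/
theorem bar_curvature (hσ : C.IsSplit σ) (θ : Connection β) (L : Splitting C β) {qhat : Bhat → B}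
    (hq : ContMDiff 𝓘(ℝ, EL) 𝓘(ℝ, EB) ∞ qhat) (θhat : Connection βhat)
    {η : OneForm 𝓘(ℝ, EL) Bhat LieT} (hη : IsSmoothForm η)
    (h : ∀ (b : Bhat) (v : EL), θhat.val b v =
      σ (θ.val (qhat b) (tder 𝓘(ℝ, EL) 𝓘(ℝ, EB) qhat b v)) + C.dincl (η b v))
    (b : Bhat) (v w : EL) :
    L.bar (qhat b) (θhat.curvature b v w) = extDer η b v w -
      liftCurving θ L σ (qhat b) (tder 𝓘(ℝ, EL) 𝓘(ℝ, EB) qhat b v)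
        (tder 𝓘(ℝ, EL) 𝓘(ℝ, EB) qhat b w) := by
  have hp : IsSmoothForm (pullForm qhat θ.form) := θ.smooth.pullForm hq
  have hform : θhat.form = fun b => σ.comp (pullForm qhat θ.form b) + C.dincl.comp (η b) := by
    funext b
    exact ContinuousLinearMap.ext (h b)
  set v' := tder 𝓘(ℝ, EL) 𝓘(ℝ, EB) qhat b v with hv'
  set w' := tder 𝓘(ℝ, EL) 𝓘(ℝ, EB) qhat b w with hw'
  have hd : extDer θhat.form b v w = σ (extDer θ.form (qhat b) v' w') +
      C.dincl (extDer η b v w) := by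
    rw [hform]
    refine (extDer_add (hp.clm_comp σ) (hη.clm_comp C.dincl) b v w).trans ?_
    exact congrArg₂ (· + ·) ((extDer_clm_comp hp σ b v w).trans
      (congrArg σ (extDer_pullForm θ.smooth hq b v w))) (extDer_clm_comp hη C.dincl b v w)
  have hbr : lieBr Ghat (θhat.val b v) (θhat.val b w) =
      σ (lieBr G (θ.val (qhat b) v') (θ.val (qhat b) w')) +
        C.dincl (C.lieCocycle σ (θ.val (qhat b) v') (θ.val (qhat b) w')) := by
    rw [h, h, lieBr_add_left, lieBr_add_right, C.lieBr_dincl_left, C.lieBr_dincl_right,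
      C.dincl_lieCocycle hσ]
    abel
  have hF : θhat.curvature b v w = σ (θ.curvature (qhat b) v' w') + C.dincl (extDer η b v w +
      C.lieCocycle σ (θ.val (qhat b) v') (θ.val (qhat b) w')) := by
    have h1 : θhat.curvature b v w = extDer θhat.form b v w +
      lieBr Ghat (θhat.val b v) (θhat.val b w) := rfl
    have h2 : θ.curvature (qhat b) v' w' = extDer θ.form (qhat b) v' w' +
      lieBr G (θ.val (qhat b) v') (θ.val (qhat b) w') := rfl
    rw [h1, h2, hd, hbr, map_add, map_add]
    abel
  have hf : liftCurving θ L σ (qhat b) v' w' =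
      -C.lieCocycle σ (θ.val (qhat b) v') (θ.val (qhat b) w') -
        L.bar (qhat b) (σ (θ.curvature (qhat b) v' w')) := rfl
  rw [hF, hf, map_add, L.bar_dincl]
  abel

/-- The curvature of a connection on a circle bundle is its exterior derivative. -/
theorem curvature_circle (κ : PrincipalBundle LieT Circle EL Bhat EB B) (α : Connection κ)
    (b : Bhat) (v w : EL) : α.curvature b v w = extDer α.form b v w := by
  refine (congrArg (fun z : LieT => extDer α.form b v w + z) (lieBr_circle _ _)).trans ?_
  exact add_zero _

end Curvature

/-! ### The bundle `δ(Q)` -/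

section Delta

variable {X : Type*}
  {EY : Type*} [NormedAddCommGroup EY] [NormedSpace ℝ EY]
  {Y : Type*} [TopologicalSpace Y] [ChartedSpace EY Y]
  {EQ : Type*} [NormedAddCommGroup EQ] [NormedSpace ℝ EQ]
  {Q : Type*} [TopologicalSpace Q] [ChartedSpace EQ Q]
  {π : Y → X} {κ : PrincipalBundle LieT Circle EQ Q EY Y}

theorem Delta.mk_eq_mk_iff {q₁ q₂ q₁' q₂' : Q} {h : π (κ.proj q₁) = π (κ.proj q₂)}
    {h' : π (κ.proj q₁') = π (κ.proj q₂')} :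
    Delta.mk π κ q₁ q₂ h = Delta.mk π κ q₁' q₂' h' ↔
      ∃ z, q₁' = κ.act q₁ z ∧ q₂' = κ.act q₂ z := by
  constructor
  · intro e
    have h1 := Quot.eqvGen_exact e
    refine (Equivalence.eqvGen_iff (r := fun x y : {x : Q × Q // π (κ.proj x.1) = π (κ.proj x.2)} =>
      ∃ z : Circle, y.1 = (κ.act x.1.1 z, κ.act x.1.2 z)) ⟨?_, ?_, ?_⟩).1 h1 |>.imp
        fun z hz => Prod.ext_iff.1 hz
    · exact fun x => ⟨1, by simp [κ.act_one]⟩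
    · rintro x y ⟨z, hz⟩
      exact ⟨z⁻¹, by simp [hz, ← κ.act_mul, κ.act_one]⟩
    · rintro x y w ⟨z, hz⟩ ⟨z', hz'⟩
      exact ⟨z * z', by simp [hz, hz', κ.act_mul]⟩
  · rintro ⟨z, rfl, rfl⟩
    exact Quot.sound ⟨z, rfl⟩

theorem Delta.mk_right_injective {q₁ q₂ q₂' : Q} {h : π (κ.proj q₁) = π (κ.proj q₂)}
    {h' : π (κ.proj q₁) = π (κ.proj q₂')} (e : Delta.mk π κ q₁ q₂ h = Delta.mk π κ q₁ q₂' h') :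
    q₂ = q₂' := by
  obtain ⟨z, h1, h2⟩ := Delta.mk_eq_mk_iff.1 e
  have : z = 1 := κ.act_injective q₁ (by rw [← h1, κ.act_one])
  rw [h2, this, κ.act_one]

theorem Delta.exists_mk (d : Delta π κ) {q : Q} (hq : κ.proj q = Delta.fst π κ d) :
    ∃ q' h, d = Delta.mk π κ q q' h := by
  induction d using Quot.ind with
  | mk x =>
    obtain ⟨⟨q₁, q₂⟩, h⟩ := x
    obtain ⟨z, hz⟩ := PrincipalBundle.exists_act (B := κ) (p := q₁) (p' := q) hq.symm
    refine ⟨κ.act q₂ z, ?_, ?_⟩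
    · rw [κ.proj_act, hq]
      exact h
    · exact Delta.mk_eq_mk_iff.2 ⟨z, hz.symm, rfl⟩

end Delta

/-! ### The trivialization defined by a lifting -/

section Forward

variable {EH : Type*} [NormedAddCommGroup EH] [NormedSpace ℝ EH] [CompleteSpace EH]
  {Ghat : Type*} [TopologicalSpace Ghat] [ChartedSpace EH Ghat] [Group Ghat]
  [LieGroup 𝓘(ℝ, EH) ∞ Ghat]
  {EG : Type*} [NormedAddCommGroup EG] [NormedSpace ℝ EG] [CompleteSpace EG]
  {G : Type*} [TopologicalSpace G] [ChartedSpace EG G] [Group G]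
  [LieGroup 𝓘(ℝ, EG) ∞ G]
  {EX : Type*} [NormedAddCommGroup EX] [NormedSpace ℝ EX]
  {X : Type*} [TopologicalSpace X] [ChartedSpace EX X]
  {EB : Type*} [NormedAddCommGroup EB] [NormedSpace ℝ EB]
  {B : Type*} [TopologicalSpace B] [ChartedSpace EB B] [IsManifold 𝓘(ℝ, EB) ∞ B]
  {EL : Type*} [NormedAddCommGroup EL] [NormedSpace ℝ EL]
  {Bhat : Type*} [TopologicalSpace Bhat] [ChartedSpace EL Bhat] [IsManifold 𝓘(ℝ, EL) ∞ Bhat]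
  {C : CentralExtension EH Ghat EG G} {β : PrincipalBundle EG G EB B EX X}

namespace Lifting

variable (Λ : Lifting C β EL Bhat)

theorem qhat_act_incl (b : Bhat) (u : Circle) :
    Λ.qhat (Λ.bundle.act b (C.incl u)) = Λ.qhat b := by
  rw [Λ.qhat_act, C.q_incl, β.act_one]

/-- A lifting `B̂`, as a principal circle bundle over `B`. -/
def circleBundle : PrincipalBundle LieT Circle EL Bhat EB B :=
  PrincipalBundle.ofSections Λ.qhat (fun b u => Λ.bundle.act b (C.incl u))
    (fun b => by rw [map_one, Λ.bundle.act_one])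
    (fun b u v => by rw [map_mul, Λ.bundle.act_mul])
    Λ.qhat_act_incl Λ.contMDiff_qhat
    (Λ.bundle.contMDiff_act.comp (f := fun x : Bhat × Circle => (x.1, C.incl x.2))
      (contMDiff_fst.prodMk (C.contMDiff_incl.comp contMDiff_snd)))
    (fun b u v h => C.incl_injective (Λ.bundle.act_injective b h))
    (by
      intro b₀
      obtain ⟨c₀, hc₀⟩ := Λ.bundle.proj_surjective (β.proj b₀)
      -- `s` is a local section of `B̂` over `X`, and `q̂ ∘ s` one of `B`
      obtain ⟨U, s, δ, hU, hU₀, hs, hps, -, hδ, hsδ⟩ := Λ.bundle.exists_section c₀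
      rw [hc₀] at hU₀
      have hV : IsOpen (β.proj ⁻¹' U) := hU.preimage β.contMDiff_proj.continuous
      have hs' : ContMDiffOn 𝓘(ℝ, EB) 𝓘(ℝ, EL) ∞ (fun b => s (β.proj b)) (β.proj ⁻¹' U) :=
        hs.comp β.contMDiff_proj.contMDiffOn fun b hb => hb
      obtain ⟨γ, hγ, hγ'⟩ := β.exists_smooth_div
        (a := fun b => Λ.qhat (s (β.proj b))) (b := fun b => b) (U := β.proj ⁻¹' U)
        (Λ.contMDiff_qhat.comp_contMDiffOn hs') contMDiffOn_id
        (fun b hb => (Λ.proj_qhat _).trans (hps _ hb))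
      obtain ⟨g₀, hg₀⟩ := C.q_surjective (γ b₀)
      obtain ⟨W, t, ε, hW, hW₀, ht, hpt, -, hε, htε⟩ := C.bundle.exists_section g₀
      have hpq : C.bundle.proj = C.q := C.bundle_proj
      simp only [hpq, C.bundle_act] at hW₀ hpt hε htε
      rw [hg₀] at hW₀
      refine ⟨β.proj ⁻¹' U ∩ γ ⁻¹' W, fun b => Λ.bundle.act (s (β.proj b)) (t (γ b)),
        fun c => ε (δ c), hγ.continuousOn.isOpen_inter_preimage hV hW, ⟨hU₀, hW₀⟩, ?_, ?_, ?_, ?_⟩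
      · refine Λ.bundle.contMDiff_act.comp_contMDiffOn
          (f := fun b => (s (β.proj b), t (γ b))) ?_
        exact (hs'.mono Set.inter_subset_left).prodMk
          (ht.comp (hγ.mono Set.inter_subset_left) fun b hb => hb.2)
      · rintro b ⟨hb, hb'⟩
        rw [Λ.qhat_act, hpt _ hb', hγ' b hb]
      all_goals
        have key : ∀ c, β.proj (Λ.qhat c) ∈ U → γ (Λ.qhat c) = C.q (δ c) := by
          intro c hc
          apply β.act_injective (Λ.qhat (s (β.proj (Λ.qhat c))))
          rw [hγ' _ hc, ← Λ.qhat_act, Λ.proj_qhat, hsδ c (Λ.proj_qhat c ▸ hc)]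
      · refine hε.comp (hδ.mono ?_) ?_
        · rintro c ⟨hc, -⟩
          rwa [Set.mem_preimage, ← Λ.proj_qhat]
        · rintro c ⟨hc, hc'⟩
          rwa [Set.mem_preimage, Set.mem_preimage, ← key c hc]
      · rintro c ⟨hc, hc'⟩
        rw [Set.mem_preimage, key c hc] at hc'
        beta_reduce
        rw [key c hc, ← Λ.bundle.act_mul, htε _ hc', Λ.proj_qhat, hsδ c (Λ.proj_qhat c ▸ hc)])

theorem circleBundle_act (b : Bhat) (u : Circle) :
    Λ.circleBundle.act b u = Λ.bundle.act b (C.incl u) := rfl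

theorem circleBundle_proj (b : Bhat) : Λ.circleBundle.proj b = Λ.qhat b := rfl

variable {σ : EG →L[ℝ] EH} {θ : Connection β} (θhat : Connection Λ.bundle)

variable (σ θ) in
/-- The scalar part `θ̂ - σ(q̂^*θ)` of a connection `θ̂` compatible with `θ`. -/
def scalarForm : OneForm 𝓘(ℝ, EL) Bhat LieT := fun b =>
  C.scalar.comp (θhat.form b) + (-(C.scalar.comp σ)).comp (pullForm Λ.qhat θ.form b)

theorem scalarForm_apply (b : Bhat) (v : EL) :
    Λ.scalarForm σ θ θhat b v = C.scalar (θhat.val b v -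
      σ (θ.val (Λ.qhat b) (tder 𝓘(ℝ, EL) 𝓘(ℝ, EB) Λ.qhat b v))) := by
  rw [map_sub, sub_eq_add_neg]
  rfl

theorem isSmoothForm_scalarForm : IsSmoothForm (Λ.scalarForm σ θ θhat) :=
  (θhat.smooth.clm_comp _).add ((θ.smooth.pullForm Λ.contMDiff_qhat).clm_comp _)

theorem val_eq_add_scalarForm (hσ : C.IsSplit σ) (hc : Λ.IsCompatible θ θhat) (b : Bhat) (v : EL) :
    θhat.val b v = σ (θ.val (Λ.qhat b) (tder 𝓘(ℝ, EL) 𝓘(ℝ, EB) Λ.qhat b v)) +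
      C.dincl (Λ.scalarForm σ θ θhat b v) := by
  have h1 : C.dq (θhat.val b v) = θ.val (Λ.qhat b) (tder 𝓘(ℝ, EL) 𝓘(ℝ, EB) Λ.qhat b v) := hc b v
  rw [scalarForm_apply, C.dincl_scalar, add_sub_cancel]
  rw [map_sub, hσ, h1, sub_self]

variable (σ θ) in
/-- The scalar part of a connection on the lifting is a connection on the circle bundle
`B̂ → B`. -/
def circleConnection : Connection Λ.circleBundle where
  form := Λ.scalarForm σ θ θhat
  smooth := Λ.isSmoothForm_scalarForm θhat
  form_fundamental b z := by
    have h1 := θhat.val_act (IM := 𝓘(ℝ, LieT)) (a := fun _ : Circle => b) (g := C.incl) (m := 1)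
      mdifferentiableAt_const (mdifferentiableAt_of_contMDiff C.contMDiff_incl _) z
    rw [map_one, tder_const, maurerCartan_one, Λ.bundle.act_one] at h1
    simp only [zero_apply, map_zero, zero_add] at h1
    have h2 := tder_comp_apply (I := 𝓘(ℝ, LieT)) (I' := 𝓘(ℝ, EL)) (I'' := 𝓘(ℝ, EB))
      (g := Λ.qhat) (f := fun u => Λ.bundle.act b (C.incl u)) (p := 1)
      (mdifferentiableAt_of_contMDiff Λ.contMDiff_qhat _)
      (mdifferentiableAt_of_contMDiff (Λ.circleBundle.contMDiff_orbit b) _) z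
    simp only [Λ.qhat_act_incl, tder_const, map_one, Λ.bundle.act_one,
      zero_apply] at h2
    refine (Λ.scalarForm_apply θhat b _).trans ?_
    change C.scalar (θhat.val b (tder 𝓘(ℝ, LieT) 𝓘(ℝ, EL)
      (fun u => Λ.bundle.act b (C.incl u)) 1 z) - σ (θ.val (Λ.qhat b)
        (tder 𝓘(ℝ, EL) 𝓘(ℝ, EB) Λ.qhat b (tder 𝓘(ℝ, LieT) 𝓘(ℝ, EL)
      (fun u => Λ.bundle.act b (C.incl u)) 1 z)))) = z
    rw [h1, ← h2, map_zero, map_zero, sub_zero]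
    exact C.scalar_dincl z
  form_act b u v := by
    have h1 : θhat.val (Λ.bundle.act b (C.incl u)) (tder 𝓘(ℝ, EL) 𝓘(ℝ, EL)
        (fun x => Λ.bundle.act x (C.incl u)) b v) = θhat.val b v := by
      refine (θhat.form_act b (C.incl u) v).trans ?_
      rw [← map_inv]
      exact C.Ad_incl u⁻¹ _
    have h2 := tder_comp_apply (I := 𝓘(ℝ, EL)) (I' := 𝓘(ℝ, EL)) (I'' := 𝓘(ℝ, EB))
      (g := Λ.qhat) (f := fun x => Λ.bundle.act x (C.incl u)) (p := b)
      (mdifferentiableAt_of_contMDiff Λ.contMDiff_qhat _)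
      (mdifferentiableAt_of_contMDiff (Λ.bundle.contMDiff_act_right _) _) v
    simp only [Λ.qhat_act_incl] at h2
    refine (Λ.scalarForm_apply θhat _ _).trans
      (Eq.trans ?_ ((Ad_circle _ _).trans (Λ.scalarForm_apply θhat b v)).symm)
    change C.scalar (θhat.val (Λ.bundle.act b (C.incl u)) (tder 𝓘(ℝ, EL) 𝓘(ℝ, EL)
        (fun x => Λ.bundle.act x (C.incl u)) b v) -
      σ (θ.val (Λ.qhat (Λ.bundle.act b (C.incl u))) (tder 𝓘(ℝ, EL) 𝓘(ℝ, EB) Λ.qhat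
        (Λ.bundle.act b (C.incl u)) (tder 𝓘(ℝ, EL) 𝓘(ℝ, EL)
          (fun x => Λ.bundle.act x (C.incl u)) b v)))) = _
    rw [h1, ← h2, Λ.qhat_act_incl]

/-- The map `J_B → δ(B̂)`, `(b, bq(γ̂), γ̂) ↦ b̂^* ⊗ b̂γ̂`, where `b̂` is any lift of `b`. -/
def toDelta (x : LiftJ C β) : Delta β.proj Λ.circleBundle :=
  Delta.mk β.proj Λ.circleBundle (Function.surjInv Λ.circleBundle.proj_surjective x.1.1)
    (Λ.bundle.act (Function.surjInv Λ.circleBundle.proj_surjective x.1.1) x.1.2.2) (by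
      simp only [circleBundle_proj, Λ.proj_qhat, Λ.bundle.proj_act])

theorem toDelta_eq {x : LiftJ C β} {b : Bhat} (hb : Λ.qhat b = x.1.1) :
    ∃ h, Λ.toDelta x = Delta.mk β.proj Λ.circleBundle b (Λ.bundle.act b x.1.2.2) h := by
  refine ⟨by simp only [circleBundle_proj, Λ.proj_qhat, Λ.bundle.proj_act], ?_⟩
  set c := Function.surjInv Λ.circleBundle.proj_surjective x.1.1 with hc
  have hc' : Λ.circleBundle.proj c = x.1.1 := Function.surjInv_eq _ _
  obtain ⟨z, hz⟩ := PrincipalBundle.exists_act (B := Λ.circleBundle) (hc'.trans hb.symm)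
  refine Delta.mk_eq_mk_iff.2 ⟨z, hz.symm, ?_⟩
  rw [← hz, circleBundle_act, circleBundle_act, ← Λ.bundle.act_mul, ← Λ.bundle.act_mul, C.central]

theorem eq_of_toDelta_eq_mk {x : LiftJ C β} {a b : Bhat} {h}
    (e : Λ.toDelta x = Delta.mk β.proj Λ.circleBundle a b h) :
    Λ.qhat a = x.1.1 ∧ b = Λ.bundle.act a x.1.2.2 := by
  have h1 : Λ.qhat a = x.1.1 :=
    (congrArg (Delta.fst β.proj Λ.circleBundle) e).symm.trans
      (Function.surjInv_eq Λ.circleBundle.proj_surjective _)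
  obtain ⟨h', h2⟩ := Λ.toDelta_eq h1
  exact ⟨h1, Delta.mk_right_injective (e.symm.trans h2)⟩

/-- For a pair of local maps `(a, b)` representing `J_B → δ(B̂)`, that is `b = aγ̂`, the difference
of the pull-backs of the scalar part of `θ̂` is the connection of the lifting bundle gerbe. -/
theorem liftConn_eq (hσ : C.IsSplit σ) (hc : Λ.IsCompatible θ θhat) {U : Set (LiftJ C β)}
    (hU : IsOpen U) {a : LiftJ C β → Bhat}
    (ha : ContMDiffOn (𝓘(ℝ, EB).prod 𝓘(ℝ, EH)) 𝓘(ℝ, EL) ∞ a U)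
    (hqa : ∀ x ∈ U, Λ.qhat (a x) = x.1.1) {x : LiftJ C β} (hx : x ∈ U) (v : EB × EH) :
    liftConn C θ σ x v =
      -Λ.scalarForm σ θ θhat (a x) (tder (𝓘(ℝ, EB).prod 𝓘(ℝ, EH)) 𝓘(ℝ, EL) a x v) +
        Λ.scalarForm σ θ θhat (Λ.bundle.act (a x) x.1.2.2)
          (tder (𝓘(ℝ, EB).prod 𝓘(ℝ, EH)) 𝓘(ℝ, EL) (fun y => Λ.bundle.act (a y) y.1.2.2) x v) := by
  set J := 𝓘(ℝ, EB).prod 𝓘(ℝ, EH)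
  set Ta := tder J 𝓘(ℝ, EL) a x v with hTa
  set Tb := tder J 𝓘(ℝ, EL) (fun y => Λ.bundle.act (a y) y.1.2.2) x v with hTb
  set g := x.1.2.2 with hg
  set Tg := tder J 𝓘(ℝ, EH) (fun y : LiftJ C β => y.1.2.2) x v with hTg
  set Tf := tder J 𝓘(ℝ, EB) (fun y : LiftJ C β => y.1.1) x v with hTf
  have da : MDifferentiableAt J 𝓘(ℝ, EL) a x :=
    (ha.contMDiffAt (hU.mem_nhds hx)).mdifferentiableAt (by simp)
  have dg : MDifferentiableAt J 𝓘(ℝ, EH) (fun y : LiftJ C β => y.1.2.2) x :=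
    mdifferentiableAt_of_contMDiff (LiftJ.contMDiff_elt C β) x
  have df : MDifferentiableAt J 𝓘(ℝ, EB) (fun y : LiftJ C β => y.1.1) x :=
    mdifferentiableAt_of_contMDiff (LiftJ.contMDiff_fst C β) x
  have db : MDifferentiableAt J 𝓘(ℝ, EL) (fun y => Λ.bundle.act (a y) y.1.2.2) x :=
    (mdifferentiableAt_of_contMDiff Λ.bundle.contMDiff_act (a x, x.1.2.2)).comp x
      (da.prodMk dg)
  have dq : ∀ c, MDifferentiableAt 𝓘(ℝ, EL) 𝓘(ℝ, EB) Λ.qhat c :=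
    mdifferentiableAt_of_contMDiff Λ.contMDiff_qhat
  have dCq : ∀ c, MDifferentiableAt 𝓘(ℝ, EH) 𝓘(ℝ, EG) C.q c :=
    mdifferentiableAt_of_contMDiff C.contMDiff_q
  have dqg : MDifferentiableAt J 𝓘(ℝ, EG) (fun y : LiftJ C β => C.q y.1.2.2) x :=
    (dCq _).comp x dg
  have t1 : tder 𝓘(ℝ, EL) 𝓘(ℝ, EB) Λ.qhat (a x) Ta = Tf := by
    rw [hTa, ← tder_comp_apply (dq _) da]
    exact DFunLike.congr_fun (tder_congr (Filter.eventuallyEq_of_mem (hU.mem_nhds hx) hqa)) v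
  have t2 : tder 𝓘(ℝ, EL) 𝓘(ℝ, EB) Λ.qhat (Λ.bundle.act (a x) g) Tb =
      tder J 𝓘(ℝ, EB) (fun y : LiftJ C β => β.act y.1.1 (C.q y.1.2.2)) x v := by
    rw [hTb, ← tder_comp_apply (dq _) db]
    refine DFunLike.congr_fun (tder_congr (Filter.eventuallyEq_of_mem (hU.mem_nhds hx) ?_)) v
    intro y hy
    exact (Λ.qhat_act _ _).trans (by rw [hqa y hy])
  have t3 := θ.val_act df dqg v
  have t4 := θhat.val_act da dg v
  have t5 : tder J 𝓘(ℝ, EG) (fun y : LiftJ C β => C.q y.1.2.2) x v =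
      tder 𝓘(ℝ, EH) 𝓘(ℝ, EG) C.q g Tg := tder_comp_apply (dCq _) dg v
  have e1 := Λ.val_eq_add_scalarForm θhat hσ hc (a x) Ta
  have e2 := Λ.val_eq_add_scalarForm θhat hσ hc (Λ.bundle.act (a x) g) Tb
  have hl : liftConn C θ σ x v = C.nu σ g Tg + C.groupCocycle σ (C.q g)⁻¹ (θ.val x.1.1 Tf) := rfl
  apply C.dincl_injective
  rw [hl, map_add, C.dincl_nu hσ, C.dincl_groupCocycle hσ, map_add, map_neg,
    ← sub_eq_iff_eq_add'.2 e1, ← sub_eq_iff_eq_add'.2 e2, t1, t2, Λ.qhat_act, hqa x hx, t3, t4,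
    t5, e1, t1, hqa x hx]
  simp only [map_add, C.Ad_dincl]
  abel

theorem liftCurving_eq_curvature (hσ : C.IsSplit σ) (L : Splitting C β)
    (hc : Λ.IsCompatible θ θhat) (hK : Λ.IsScalarCurvature L θhat 0) (b : Bhat) (v w : EL) :
    liftCurving θ L σ (Λ.qhat b) (tder 𝓘(ℝ, EL) 𝓘(ℝ, EB) Λ.qhat b v)
      (tder 𝓘(ℝ, EL) 𝓘(ℝ, EB) Λ.qhat b w) = (Λ.circleConnection σ θ θhat).curvature b v w := by
  have h1 := bar_curvature hσ θ L Λ.contMDiff_qhat θhat (Λ.isSmoothForm_scalarForm θhat)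
    (Λ.val_eq_add_scalarForm θhat hσ hc) b v w
  have h2 : L.bar (Λ.qhat b) (θhat.curvature b v w) = 0 := (hK b v w).symm
  have h3 : (Λ.circleConnection σ θ θhat).curvature b v w =
    extDer (Λ.scalarForm σ θ θhat) b v w := curvature_circle Λ.circleBundle _ b v w
  rw [h2] at h1
  rw [h3]
  exact (sub_eq_zero.1 h1.symm).symm

/-- A lifting with a compatible connection of vanishing scalar curvature trivializes the lifting
bundle gerbe. -/
theorem isTrivial (hσ : C.IsSplit σ) (L : Splitting C β) (hc : Λ.IsCompatible θ θhat)
    (hK : Λ.IsScalarCurvature L θhat 0) :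
    Nonempty (IsoToDelta (liftingBundleGerbe θ L σ) β.proj Λ.circleBundle
      (Λ.circleConnection σ θ θhat)) := by
  refine ⟨{
    F := Diffeomorph.refl 𝓘(ℝ, EB) B ∞
    Φ := Λ.toDelta
    proj_F := fun y => rfl
    fst_Φ := fun x => Function.surjInv_eq Λ.circleBundle.proj_surjective x.1.1
    snd_Φ := fun x => ?_
    Φ_act := fun x u => ?_
    Φ_mul := fun x y h q₁ q₂ q₃ h₁₂ h₂₃ e₁ e₂ => ?_
    smooth_Φ := fun x => ?_
    conn_eq := fun U a b hl x hx v => ?_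
    curv := liftCurving θ L σ
    curv_eq := fun b v w => ?_
    curving_eq := fun b v w => ?_ }⟩
  · obtain ⟨b, hb⟩ := Λ.circleBundle.proj_surjective x.1.1
    obtain ⟨h, e⟩ := Λ.toDelta_eq hb
    rw [e]
    change Λ.qhat (Λ.bundle.act b x.1.2.2) = x.1.2.1
    rw [Λ.qhat_act, ← x.2]
    exact congrArg (fun b => β.act b (C.q x.1.2.2)) hb
  · obtain ⟨b, hb⟩ := Λ.circleBundle.proj_surjective x.1.1
    obtain ⟨h, e⟩ := Λ.toDelta_eq hb
    obtain ⟨h', e'⟩ := Λ.toDelta_eq (x := (liftingBundleGerbe θ L σ).act x u) hb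
    rw [e, e']
    refine Delta.mk_eq_mk_iff.2 ⟨1, (Λ.circleBundle.act_one _).symm, ?_⟩
    rw [Λ.circleBundle.act_one]
    exact (Λ.bundle.act_mul b x.1.2.2 (C.incl u)).symm
  · obtain ⟨r1, r2⟩ := Λ.eq_of_toDelta_eq_mk e₁
    obtain ⟨r3, r4⟩ := Λ.eq_of_toDelta_eq_mk e₂
    obtain ⟨h', e'⟩ := Λ.toDelta_eq (x := (liftingBundleGerbe θ L σ).mul x y h) r1
    rw [e']
    refine Delta.mk_eq_mk_iff.2 ⟨1, (Λ.circleBundle.act_one _).symm, ?_⟩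
    rw [Λ.circleBundle.act_one, r4, r2, ← Λ.bundle.act_mul]
    rfl
  · obtain ⟨b, hb⟩ := Λ.circleBundle.proj_surjective x.1.1
    obtain ⟨U, s, -, hU, hbU, hs, hps, -, -, -⟩ := Λ.circleBundle.exists_section b
    rw [hb] at hbU
    have hfst := LiftJ.contMDiff_fst C β
    have hs' := hs.comp (hfst.contMDiffOn (s := (fun x : LiftJ C β => x.1.1) ⁻¹' U))
      (fun x hx => hx)
    refine ⟨(fun x => x.1.1) ⁻¹' U, fun x => s x.1.1, fun x => Λ.bundle.act (s x.1.1) x.1.2.2,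
      hbU, hU.preimage hfst.continuous, hs', ?_, fun y hy => Λ.toDelta_eq (hps _ hy)⟩
    exact Λ.bundle.contMDiff_act.comp_contMDiffOn
      (f := fun x : LiftJ C β => (s x.1.1, x.1.2.2))
      (hs'.prodMk (LiftJ.contMDiff_elt C β).contMDiffOn)
  · obtain ⟨hU, ha, hb, hab⟩ := hl
    have hab' : ∀ y ∈ U, Λ.qhat (a y) = y.1.1 ∧ b y = Λ.bundle.act (a y) y.1.2.2 :=
      fun y hy => Λ.eq_of_toDelta_eq_mk (hab y hy).choose_spec
    have e : b =ᶠ[𝓝 x] fun y => Λ.bundle.act (a y) y.1.2.2 :=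
      Filter.eventuallyEq_of_mem (hU.mem_nhds hx) fun y hy => (hab' y hy).2
    refine (Λ.liftConn_eq θhat hσ hc hU ha (fun y hy => (hab' y hy).1) hx v).trans ?_
    rw [← (hab' x hx).2, ← tder_congr e]
    rfl
  · exact Λ.liftCurving_eq_curvature θhat hσ L hc hK b v w
  · have hid : ∀ v : EB, tder 𝓘(ℝ, EB) 𝓘(ℝ, EB) (Diffeomorph.refl 𝓘(ℝ, EB) B ∞) b v = v :=
      fun v => DFunLike.congr_fun (tder_id b) v
    exact (congrArg₂ (fun v w : EB => liftCurving θ L σ b v w) (hid v) (hid w)).symm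

end Lifting

end Forward

/-! ### The lifting defined by a trivialization -/

section Backward

variable {EH : Type*} [NormedAddCommGroup EH] [NormedSpace ℝ EH] [CompleteSpace EH]
  {Ghat : Type*} [TopologicalSpace Ghat] [ChartedSpace EH Ghat] [Group Ghat]
  [LieGroup 𝓘(ℝ, EH) ∞ Ghat]
  {EG : Type*} [NormedAddCommGroup EG] [NormedSpace ℝ EG] [CompleteSpace EG]
  {G : Type*} [TopologicalSpace G] [ChartedSpace EG G] [Group G]
  [LieGroup 𝓘(ℝ, EG) ∞ G]
  {EX : Type*} [NormedAddCommGroup EX] [NormedSpace ℝ EX]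
  {X : Type*} [TopologicalSpace X] [ChartedSpace EX X]
  {EB : Type*} [NormedAddCommGroup EB] [NormedSpace ℝ EB]
  {B : Type*} [TopologicalSpace B] [ChartedSpace EB B] [IsManifold 𝓘(ℝ, EB) ∞ B]
  {C : CentralExtension EH Ghat EG G} {β : PrincipalBundle EG G EB B EX X}

theorem LiftJ.ext {x y : LiftJ C β} (h₁ : x.1.1 = y.1.1) (h₂ : x.1.2.2 = y.1.2.2) : x = y :=
  (LiftJ.homeo C β).injective (Prod.ext h₁ h₂)

variable {θ : Connection β} {L : Splitting C β} {σ : EG →L[ℝ] EH}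
  {Y' : Type*} [TopologicalSpace Y'] [ChartedSpace EB Y'] [IsManifold 𝓘(ℝ, EB) ∞ Y'] {π' : Y' → X}
  {EQ : Type*} [NormedAddCommGroup EQ] [NormedSpace ℝ EQ]
  {Q : Type*} [TopologicalSpace Q] [ChartedSpace EQ Q] [IsManifold 𝓘(ℝ, EQ) ∞ Q]
  {κ : PrincipalBundle LieT Circle EQ Q EB Y'} {α : Connection κ}

namespace IsoToDelta

variable (T : IsoToDelta (liftingBundleGerbe θ L σ) π' κ α)

/-- The projection `q̂ : Q → B`. -/
def qhat (c : Q) : B := T.F.symm (κ.proj c)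

theorem F_qhat (c : Q) : T.F (T.qhat c) = κ.proj c := T.F.apply_symm_apply _

theorem contMDiff_qhat : ContMDiff 𝓘(ℝ, EQ) 𝓘(ℝ, EB) ∞ T.qhat :=
  T.F.symm.contMDiff.comp κ.contMDiff_proj

theorem proj_eq_of_qhat_eq {c c' : Q} (h : T.qhat c = T.qhat c') : κ.proj c = κ.proj c' :=
  T.F.symm.injective h

/-- The point `(q̂(c), q̂(c)q(γ̂), γ̂)` of `J_B`. -/
def point (x : Q × Ghat) : LiftJ C β := (LiftJ.homeo C β).symm (T.qhat x.1, x.2)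

theorem contMDiff_point : ContMDiff (𝓘(ℝ, EQ).prod 𝓘(ℝ, EH)) (𝓘(ℝ, EB).prod 𝓘(ℝ, EH)) ∞ T.point :=
  (LiftJ.contMDiff_homeo_symm C β).comp (f := fun x : Q × Ghat => (T.qhat x.1, x.2))
    ((T.contMDiff_qhat.comp contMDiff_fst).prodMk contMDiff_snd)

theorem exists_action (c : Q) (g : Ghat) :
    ∃ c' h, T.Φ (T.point (c, g)) = Delta.mk π' κ c c' h :=
  Delta.exists_mk _ ((T.F_qhat c).symm.trans (T.fst_Φ (T.point (c, g))).symm)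

/-- The action of `Ĝ` on `Q`: `cγ̂` is determined by `Φ(b, bq(γ̂), γ̂) = c^* ⊗ cγ̂`, where
`b = q̂(c)`. -/
def action (c : Q) (g : Ghat) : Q := (T.exists_action c g).choose

theorem Φ_point (c : Q) (g : Ghat) :
    ∃ h, T.Φ (T.point (c, g)) = Delta.mk π' κ c (T.action c g) h :=
  (T.exists_action c g).choose_spec

theorem action_eq {c c' : Q} {g : Ghat} {h}
    (e : T.Φ (T.point (c, g)) = Delta.mk π' κ c c' h) : T.action c g = c' := by
  obtain ⟨h', e'⟩ := T.Φ_point c g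
  exact Delta.mk_right_injective (e'.symm.trans e)

theorem qhat_action (c : Q) (g : Ghat) : T.qhat (T.action c g) = β.act (T.qhat c) (C.q g) := by
  obtain ⟨h, e⟩ := T.Φ_point c g
  have h1 : κ.proj (T.action c g) = T.F (β.act (T.qhat c) (C.q g)) :=
    (congrArg (Delta.snd π' κ) e).symm.trans (T.snd_Φ _)
  rw [qhat, h1]
  exact T.F.symm_apply_apply _

theorem qhat_act (c : Q) (u : Circle) : T.qhat (κ.act c u) = T.qhat c := by
  rw [qhat, κ.proj_act, qhat]

theorem action_mul_incl (c : Q) (g : Ghat) (u : Circle) :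
    T.action c (g * C.incl u) = κ.act (T.action c g) u := by
  obtain ⟨h, e⟩ := T.Φ_point c g
  have h1 := T.Φ_act (T.point (c, g)) u
  rw [e] at h1
  have h2 : (liftingBundleGerbe θ L σ).act (T.point (c, g)) u = T.point (c, g * C.incl u) :=
    LiftJ.ext rfl rfl
  rw [h2] at h1
  exact T.action_eq (h := by rw [κ.proj_act]; exact h) h1

theorem action_act (c : Q) (u : Circle) (g : Ghat) :
    T.action (κ.act c u) g = κ.act (T.action c g) u := by
  obtain ⟨h, e⟩ := T.Φ_point c g
  have h1 : T.point (κ.act c u, g) = T.point (c, g) := LiftJ.ext (T.qhat_act c u) rfl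
  refine T.action_eq (h := by rw [κ.proj_act, κ.proj_act]; exact h) ?_
  rw [h1, e]
  exact Delta.mk_eq_mk_iff.2 ⟨u, rfl, rfl⟩

theorem action_mul (c : Q) (g h : Ghat) : T.action c (g * h) = T.action (T.action c g) h := by
  obtain ⟨k₁, e₁⟩ := T.Φ_point c g
  obtain ⟨k₂, e₂⟩ := T.Φ_point (T.action c g) h
  have h1 : (liftingBundleGerbe θ L σ).snd (T.point (c, g)) =
      (liftingBundleGerbe θ L σ).fst (T.point (T.action c g, h)) := (T.qhat_action c g).symm
  have h2 := T.Φ_mul _ _ h1 _ _ _ k₁ k₂ e₁ e₂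
  have h3 : (liftingBundleGerbe θ L σ).mul (T.point (c, g)) (T.point (T.action c g, h)) h1 =
      T.point (c, g * h) := LiftJ.ext rfl rfl
  rw [h3] at h2
  exact T.action_eq h2

theorem action_one (c : Q) : T.action c 1 = c := by
  have h1 : T.qhat (T.action c 1) = T.qhat c := by rw [T.qhat_action, map_one, β.act_one]
  obtain ⟨u, hu⟩ := PrincipalBundle.exists_act (T.proj_eq_of_qhat_eq h1.symm)
  -- if `c1 = cu`, then `cu = (c1)1 = cu²`
  have h2 := T.action_mul c 1 1
  rw [mul_one, ← hu, T.action_act, ← hu, ← κ.act_mul] at h2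
  have h3 : u = u * u := κ.act_injective c h2
  have h4 : u = 1 := left_eq_mul.1 h3
  rw [← hu, h4, κ.act_one]

theorem action_injective {c : Q} {g h : Ghat} (e : T.action c g = T.action c h) : g = h := by
  have h1 : C.q g = C.q h := β.act_injective (T.qhat c) (by
    rw [← T.qhat_action, ← T.qhat_action, e])
  obtain ⟨u, hu⟩ := (C.ker_q (g⁻¹ * h)).1 (by simp [h1])
  have h2 : h = g * C.incl u := by rw [hu, mul_inv_cancel_left]
  rw [h2, T.action_mul_incl] at e
  have h3 : (1 : Circle) = u := κ.act_injective (T.action c g) (by rw [κ.act_one, ← e])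
  rw [h2, ← h3, map_one, mul_one]

/-- Locally, the action is expressed by a local representative `(a, b)` of `Φ` and a smooth
circle-valued map `u` with `c = a u`, as `cγ̂ = b u`. -/
theorem exists_local_action (x : Q × Ghat) :
    ∃ (U : Set (LiftJ C β)) (a b : LiftJ C β → Q) (u : Q × Ghat → Circle), T.point x ∈ U ∧
      IsLocalLift (𝓘(ℝ, EB).prod 𝓘(ℝ, EH)) T.Φ U a b ∧
      ContMDiffOn (𝓘(ℝ, EQ).prod 𝓘(ℝ, EH)) 𝓘(ℝ, LieT) ∞ u (T.point ⁻¹' U) ∧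
      (∀ y ∈ T.point ⁻¹' U, κ.act (a (T.point y)) (u y) = y.1) ∧
      ∀ y ∈ T.point ⁻¹' U, κ.act (b (T.point y)) (u y) = T.action y.1 y.2 := by
  obtain ⟨U, a, b, hx, hl⟩ := T.smooth_Φ (T.point x)
  obtain ⟨hU, ha, hb, hab⟩ := id hl
  have h1 : ∀ y ∈ T.point ⁻¹' U, κ.proj (a (T.point y)) = κ.proj y.1 := by
    intro y hy
    obtain ⟨h, e⟩ := hab _ hy
    exact (congrArg (Delta.fst π' κ) e).symm.trans ((T.fst_Φ _).trans (T.F_qhat y.1))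
  obtain ⟨u, hu, hu'⟩ := κ.exists_smooth_div (IM := 𝓘(ℝ, EQ).prod 𝓘(ℝ, EH))
    (a := fun y => a (T.point y)) (b := fun y : Q × Ghat => y.1) (U := T.point ⁻¹' U)
    (ha.comp T.contMDiff_point.contMDiffOn fun y hy => hy) contMDiffOn_fst h1
  refine ⟨U, a, b, u, hx, hl, hu, hu', fun y hy => ?_⟩
  obtain ⟨h, e⟩ := hab _ hy
  refine (T.action_eq (h := ?_) (e.trans ?_)).symm
  · rw [κ.proj_act, ← h, h1 y hy]
  · exact Delta.mk_eq_mk_iff.2 ⟨u y, (hu' y hy).symm, rfl⟩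

theorem contMDiff_action : ContMDiff (𝓘(ℝ, EQ).prod 𝓘(ℝ, EH)) 𝓘(ℝ, EQ) ∞
    (fun x : Q × Ghat => T.action x.1 x.2) := by
  intro x
  obtain ⟨U, a, b, u, hx, ⟨hU, -, hb, -⟩, hu, -, hact⟩ := T.exists_local_action x
  have hU' : T.point ⁻¹' U ∈ 𝓝 x := (hU.preimage T.contMDiff_point.continuous).mem_nhds hx
  have h1 : ContMDiffOn (𝓘(ℝ, EQ).prod 𝓘(ℝ, EH)) 𝓘(ℝ, EQ) ∞
      (fun y => κ.act (b (T.point y)) (u y)) (T.point ⁻¹' U) :=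
    κ.contMDiff_act.comp_contMDiffOn (f := fun y => (b (T.point y), u y))
      ((hb.comp T.contMDiff_point.contMDiffOn fun y hy => hy).prodMk hu)
  refine (h1.contMDiffAt hU').congr_of_eventuallyEq ?_
  filter_upwards [hU'] with y hy
  exact (hact y hy).symm

/-- The circle bundle `Q` of a trivialization, as a principal `Ĝ`-bundle over `X`. -/
def bundle : PrincipalBundle EH Ghat EQ Q EX X :=
  PrincipalBundle.ofSections (fun c => β.proj (T.qhat c)) T.action T.action_one T.action_mul
    (fun c g => by rw [T.qhat_action, β.proj_act])
    (β.contMDiff_proj.comp T.contMDiff_qhat) T.contMDiff_action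
    (fun c g h e => T.action_injective e)
    (by
      intro x₀
      obtain ⟨b₀, hb₀⟩ := β.proj_surjective x₀
      obtain ⟨c₀, hc₀⟩ := κ.proj_surjective (T.F b₀)
      obtain ⟨U, s, γ, hU, hU₀, hs, hps, hs₀, hγ, hsγ⟩ := β.exists_section b₀
      obtain ⟨W, t, -, hW, hW₀, ht, hpt, -, -, -⟩ := κ.exists_section c₀
      have hFs : ContMDiffOn 𝓘(ℝ, EX) 𝓘(ℝ, EB) ∞ (fun x => T.F (s x)) U :=
        T.F.contMDiff.comp_contMDiffOn hs
      set N : Set X := U ∩ (fun x => T.F (s x)) ⁻¹' W with hN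
      have hNo : IsOpen N := hFs.continuousOn.isOpen_inter_preimage hU hW
      have hproj : ContMDiff 𝓘(ℝ, EQ) 𝓘(ℝ, EX) ∞ (fun c => β.proj (T.qhat c)) :=
        β.contMDiff_proj.comp T.contMDiff_qhat
      -- the section `r` of `Q → X` composed of sections of `B → X` and `Q → B`
      set r : X → Q := fun x => t (T.F (s x)) with hr
      have hr' : ContMDiffOn 𝓘(ℝ, EX) 𝓘(ℝ, EQ) ∞ r N :=
        ht.comp (hFs.mono Set.inter_subset_left) fun x hx => hx.2
      have hqr : ∀ x ∈ N, T.qhat (r x) = s x := by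
        intro x hx
        rw [qhat, hpt _ hx.2]
        exact T.F.symm_apply_apply _
      have hγq : ∀ c, β.proj (T.qhat c) ∈ N →
          β.act (T.qhat (r (β.proj (T.qhat c)))) (γ (T.qhat c)) = T.qhat c := by
        intro c hc
        rw [hqr _ hc, hsγ _ hc.1]
      have hex : ∀ c, ∃ g, β.proj (T.qhat c) ∈ N →
          T.action (r (β.proj (T.qhat c))) g = c := by
        intro c
        by_cases hc : β.proj (T.qhat c) ∈ N
        · obtain ⟨g, hg⟩ := C.q_surjective (γ (T.qhat c))
          have h1 : T.qhat (T.action (r (β.proj (T.qhat c))) g) = T.qhat c := by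
            rw [T.qhat_action, hg, hγq c hc]
          obtain ⟨u, hu⟩ := PrincipalBundle.exists_act (T.proj_eq_of_qhat_eq h1)
          exact ⟨g * C.incl u, fun _ => by rw [T.action_mul_incl, hu]⟩
        · exact ⟨1, fun h => absurd h hc⟩
      choose δ hδ using hex
      refine ⟨N, r, δ, hNo, ⟨hb₀ ▸ hU₀, ?_⟩, hr', ?_, ?_, hδ⟩
      · rw [Set.mem_preimage, ← hb₀, hs₀, ← hc₀]
        exact hW₀
      · intro x hx
        rw [hqr x hx, hps x hx.1]
      · -- near `c₁`, `δ` is the product of a local lift of `γ` and a circle-valued map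
        intro c₁ hc₁
        obtain ⟨W', τ, -, hW', hW₁, hτ, hpτ, -, -, -⟩ := C.bundle.exists_section (δ c₁)
        have hpq : C.bundle.proj = C.q := C.bundle_proj
        simp only [hpq] at hW₁ hpτ
        have hγ1 : ContMDiffOn 𝓘(ℝ, EQ) 𝓘(ℝ, EG) ∞ (fun c => γ (T.qhat c))
            ((fun c => β.proj (T.qhat c)) ⁻¹' N) :=
          hγ.comp T.contMDiff_qhat.contMDiffOn fun c hc => hc.1
        have hγδ : ∀ c, β.proj (T.qhat c) ∈ N → γ (T.qhat c) = C.q (δ c) := by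
          intro c hc
          apply β.act_injective (T.qhat (r (β.proj (T.qhat c))))
          rw [hγq c hc, ← T.qhat_action, hδ c hc]
        have hpre := hNo.preimage hproj.continuous
        set N' : Set Q := (fun c => β.proj (T.qhat c)) ⁻¹' N ∩ (fun c => γ (T.qhat c)) ⁻¹' W'
          with hN'
        have hNo' : IsOpen N' := hγ1.continuousOn.isOpen_inter_preimage hpre hW'
        have hc₁' : c₁ ∈ N' := ⟨hc₁, by rw [Set.mem_preimage, hγδ c₁ hc₁]; exact hW₁⟩
        have hτγ : ContMDiffOn 𝓘(ℝ, EQ) 𝓘(ℝ, EH) ∞ (fun c => τ (γ (T.qhat c))) N' :=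
          hτ.comp (hγ1.mono Set.inter_subset_left) fun c hc => hc.2
        have hrN : ContMDiffOn 𝓘(ℝ, EQ) 𝓘(ℝ, EQ) ∞ (fun c => r (β.proj (T.qhat c))) N' :=
          hr'.comp hproj.contMDiffOn fun c hc => hc.1
        obtain ⟨u, hu, hu'⟩ := κ.exists_smooth_div
          (a := fun c => T.action (r (β.proj (T.qhat c))) (τ (γ (T.qhat c)))) (b := fun c => c)
          (U := N')
          (T.contMDiff_action.comp_contMDiffOn
            (f := fun c => (r (β.proj (T.qhat c)), τ (γ (T.qhat c)))) (hrN.prodMk hτγ))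
          contMDiffOn_id (fun c hc => T.proj_eq_of_qhat_eq (by
            rw [T.qhat_action, hpτ _ hc.2, hγq c hc.1]))
        have hfin : ContMDiffOn 𝓘(ℝ, EQ) 𝓘(ℝ, EH) ∞
            (fun c => τ (γ (T.qhat c)) * C.incl (u c)) N' :=
          hτγ.mul (C.contMDiff_incl.comp_contMDiffOn hu)
        refine ((hfin.contMDiffAt (hNo'.mem_nhds hc₁')).congr_of_eventuallyEq
          ?_).contMDiffWithinAt
        filter_upwards [hNo'.mem_nhds hc₁'] with c hc
        apply T.action_injective (c := r (β.proj (T.qhat c)))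
        rw [hδ c hc.1, T.action_mul_incl, hu' c hc])

/-- The lifting `Q → B` defined by a trivialization. -/
def lifting : Lifting C β EQ Q where
  bundle := T.bundle
  qhat := T.qhat
  contMDiff_qhat := T.contMDiff_qhat
  proj_qhat _ := rfl
  qhat_act := T.qhat_action

/-- The connection `α` along the action of `Ĝ`:
`α(d(cγ̂)) = α(dc) + ν_σ(dγ̂) + Z_σ(γ⁻¹, θ(dq̂(c)))`.
For a local representative `(a, b)` of `Φ` and `u` with `c = a u` and `cγ̂ = b u`, the terms `u⁻¹du`
in `α(d(au))` and `α(d(bu))` are the same, and `α(db) - α(da)` is the connection of the gerbe. -/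
theorem val_action (x : Q × Ghat) (V : EQ × EH) :
    α.val (T.action x.1 x.2)
        (tder (𝓘(ℝ, EQ).prod 𝓘(ℝ, EH)) 𝓘(ℝ, EQ) (fun y : Q × Ghat => T.action y.1 y.2) x V) =
      α.val x.1 V.1 + (C.nu σ x.2 V.2 + C.groupCocycle σ (C.q x.2)⁻¹
        (θ.val (T.qhat x.1) (tder 𝓘(ℝ, EQ) 𝓘(ℝ, EB) T.qhat x.1 V.1))) := by
  set J := 𝓘(ℝ, EQ).prod 𝓘(ℝ, EH)
  set J' := 𝓘(ℝ, EB).prod 𝓘(ℝ, EH)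
  obtain ⟨U, a, b, u, hx, hl, hu, hau, hbu⟩ := T.exists_local_action x
  obtain ⟨hU, ha, hb, -⟩ := id hl
  have hU' : T.point ⁻¹' U ∈ 𝓝 x := (hU.preimage T.contMDiff_point.continuous).mem_nhds hx
  have dj : MDifferentiableAt J J' T.point x := mdifferentiableAt_of_contMDiff T.contMDiff_point x
  have da : MDifferentiableAt J' 𝓘(ℝ, EQ) a (T.point x) :=
    (ha.contMDiffAt (hU.mem_nhds hx)).mdifferentiableAt (by simp)
  have db : MDifferentiableAt J' 𝓘(ℝ, EQ) b (T.point x) :=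
    (hb.contMDiffAt (hU.mem_nhds hx)).mdifferentiableAt (by simp)
  have du : MDifferentiableAt J 𝓘(ℝ, LieT) u x := (hu.contMDiffAt hU').mdifferentiableAt (by simp)
  set Tj := tder J J' T.point x V with hTj
  have h1 := α.val_act (IM := J) (a := fun y => a (T.point y)) (g := u) (m := x)
    (da.comp x dj) du V
  have h2 := α.val_act (IM := J) (a := fun y => b (T.point y)) (g := u) (m := x)
    (db.comp x dj) du V
  rw [Ad_circle, hau x hx, tder_congr (Filter.eventuallyEq_of_mem hU' hau), tder_fst,
    tder_comp_apply da dj] at h1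
  rw [Ad_circle, hbu x hx, tder_congr (Filter.eventuallyEq_of_mem hU' hbu),
    tder_comp_apply db dj] at h2
  have h3 : liftConn C θ σ (T.point x) Tj =
      -α.val (a (T.point x)) (tder J' 𝓘(ℝ, EQ) a (T.point x) Tj) +
        α.val (b (T.point x)) (tder J' 𝓘(ℝ, EQ) b (T.point x) Tj) :=
    T.conn_eq U a b hl (T.point x) hx Tj
  have h4 : liftConn C θ σ (T.point x) Tj = C.nu σ x.2 (tder J' 𝓘(ℝ, EH)
      (fun y : LiftJ C β => y.1.2.2) (T.point x) Tj) + C.groupCocycle σ (C.q x.2)⁻¹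
        (θ.val (T.qhat x.1) (tder J' 𝓘(ℝ, EB) (fun y : LiftJ C β => y.1.1) (T.point x) Tj)) := rfl
  have h5 : tder J' 𝓘(ℝ, EH) (fun y : LiftJ C β => y.1.2.2) (T.point x) Tj = V.2 := by
    rw [hTj, ← tder_comp_apply (mdifferentiableAt_of_contMDiff (LiftJ.contMDiff_elt C β) _) dj]
    exact DFunLike.congr_fun (tder_snd (I := 𝓘(ℝ, EQ)) (I' := 𝓘(ℝ, EH)) x) V
  have h6 : tder J' 𝓘(ℝ, EB) (fun y : LiftJ C β => y.1.1) (T.point x) Tj =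
      tder 𝓘(ℝ, EQ) 𝓘(ℝ, EB) T.qhat x.1 V.1 := by
    rw [hTj, ← tder_comp_apply (mdifferentiableAt_of_contMDiff (LiftJ.contMDiff_fst C β) _) dj]
    have h7 := tder_comp_apply (I := J) (I' := 𝓘(ℝ, EQ)) (I'' := 𝓘(ℝ, EB)) (g := T.qhat)
      (f := fun y : Q × Ghat => y.1) (p := x)
      (mdifferentiableAt_of_contMDiff T.contMDiff_qhat _) mdifferentiableAt_fst V
    rw [tder_fst] at h7
    exact h7
  rw [h5, h6] at h4
  rw [← h4, h3, h2]
  have h8 : α.val x.1 V.1 = _ := h1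
  rw [h8]
  abel

theorem tder_action_left (c : Q) (g : Ghat) (v : EQ) :
    tder 𝓘(ℝ, EQ) 𝓘(ℝ, EQ) (fun c => T.action c g) c v =
      tder (𝓘(ℝ, EQ).prod 𝓘(ℝ, EH)) 𝓘(ℝ, EQ) (fun y : Q × Ghat => T.action y.1 y.2) (c, g)
        (v, 0) := by
  refine (tder_comp_apply (I' := 𝓘(ℝ, EQ).prod 𝓘(ℝ, EH))
    (g := fun y : Q × Ghat => T.action y.1 y.2) (f := fun c => (c, g))
    (mdifferentiableAt_of_contMDiff T.contMDiff_action _)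
    (mdifferentiableAt_id.prodMk mdifferentiableAt_const) v).trans ?_
  exact congrArg _ (DFunLike.congr_fun (mfderiv_prod_left (I := 𝓘(ℝ, EQ)) (I' := 𝓘(ℝ, EH))) v)

theorem tder_action_right (c : Q) (g : Ghat) (Z : EH) :
    tder 𝓘(ℝ, EH) 𝓘(ℝ, EQ) (fun g => T.action c g) g Z =
      tder (𝓘(ℝ, EQ).prod 𝓘(ℝ, EH)) 𝓘(ℝ, EQ) (fun y : Q × Ghat => T.action y.1 y.2) (c, g)
        (0, Z) := by
  refine (tder_comp_apply (I' := 𝓘(ℝ, EQ).prod 𝓘(ℝ, EH))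
    (g := fun y : Q × Ghat => T.action y.1 y.2) (f := fun g => (c, g))
    (mdifferentiableAt_of_contMDiff T.contMDiff_action _)
    (mdifferentiableAt_const.prodMk mdifferentiableAt_id) Z).trans ?_
  exact congrArg _ (DFunLike.congr_fun (mfderiv_prod_right (I := 𝓘(ℝ, EQ)) (I' := 𝓘(ℝ, EH))) Z)

/-- The form `σ(q̂^*θ) + α` on `Q`. -/
def liftForm : OneForm 𝓘(ℝ, EQ) Q EH := fun c =>
  σ.comp (pullForm T.qhat θ.form c) + C.dincl.comp (α.form c)

theorem liftForm_apply (c : Q) (v : EQ) : T.liftForm c v =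
    σ (θ.val (T.qhat c) (tder 𝓘(ℝ, EQ) 𝓘(ℝ, EB) T.qhat c v)) + C.dincl (α.val c v) := rfl

theorem liftForm_action (hσ : C.IsSplit σ) (c : Q) (g : Ghat) (v : EQ) :
    T.liftForm (T.action c g) (tder 𝓘(ℝ, EQ) 𝓘(ℝ, EQ) (fun c => T.action c g) c v) =
      Ad g⁻¹ (T.liftForm c v) := by
  have h1 := T.val_action (c, g) (v, 0)
  rw [← T.tder_action_left] at h1
  have h0 : C.nu σ g (0 : EH) = 0 := map_zero (C.nu σ g)
  simp only [h0, zero_add] at h1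
  have h2 : tder 𝓘(ℝ, EQ) 𝓘(ℝ, EB) T.qhat (T.action c g) (tder 𝓘(ℝ, EQ) 𝓘(ℝ, EQ)
      (fun c => T.action c g) c v) =
      tder 𝓘(ℝ, EB) 𝓘(ℝ, EB) (fun b => β.act b (C.q g)) (T.qhat c)
        (tder 𝓘(ℝ, EQ) 𝓘(ℝ, EB) T.qhat c v) := by
    have h := tder_comp_apply (I := 𝓘(ℝ, EQ)) (I' := 𝓘(ℝ, EQ)) (I'' := 𝓘(ℝ, EB))
      (g := T.qhat) (f := fun c => T.action c g) (p := c)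
      (mdifferentiableAt_of_contMDiff T.contMDiff_qhat _)
      (mdifferentiableAt_of_contMDiff (T.bundle.contMDiff_act_right g) _) v
    have h' := tder_comp_apply (I := 𝓘(ℝ, EQ)) (I' := 𝓘(ℝ, EB)) (I'' := 𝓘(ℝ, EB))
      (g := fun b => β.act b (C.q g)) (f := T.qhat) (p := c)
      (mdifferentiableAt_of_contMDiff (β.contMDiff_act_right _) _)
      (mdifferentiableAt_of_contMDiff T.contMDiff_qhat _) v
    simp only [T.qhat_action] at h
    exact h.symm.trans h'
  have h3 : θ.val (β.act (T.qhat c) (C.q g)) (tder 𝓘(ℝ, EB) 𝓘(ℝ, EB)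
      (fun b => β.act b (C.q g)) (T.qhat c) (tder 𝓘(ℝ, EQ) 𝓘(ℝ, EB) T.qhat c v)) =
      Ad (C.q g)⁻¹ (θ.val (T.qhat c) (tder 𝓘(ℝ, EQ) 𝓘(ℝ, EB) T.qhat c v)) :=
    θ.form_act (T.qhat c) (C.q g) _
  rw [T.liftForm_apply, T.liftForm_apply, h1, T.qhat_action, h2, h3, map_add, map_add,
    C.Ad_dincl, C.dincl_groupCocycle hσ]
  abel

/-- The connection `σ(q̂^*θ) + α` on the lifting defined by a trivialization. -/
def liftConnection (hσ : C.IsSplit σ) : Connection T.lifting.bundle where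
  form := T.liftForm
  smooth := ((θ.smooth.pullForm T.contMDiff_qhat).clm_comp σ).add (α.smooth.clm_comp C.dincl)
  form_fundamental c Z := by
    have h1 := T.val_action (c, 1) (0, Z)
    rw [← T.tder_action_right] at h1
    simp only [map_zero, add_zero, zero_add, T.action_one] at h1
    have h2 : tder 𝓘(ℝ, EQ) 𝓘(ℝ, EB) T.qhat c (tder 𝓘(ℝ, EH) 𝓘(ℝ, EQ)
        (fun g => T.action c g) 1 Z) =
        tder 𝓘(ℝ, EH) 𝓘(ℝ, EB) (fun g => β.act (T.qhat c) (C.q g)) 1 Z := by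
      have h := tder_comp_apply (I := 𝓘(ℝ, EH)) (I' := 𝓘(ℝ, EQ)) (I'' := 𝓘(ℝ, EB))
        (g := T.qhat) (f := fun g => T.action c g) (p := 1)
        (mdifferentiableAt_of_contMDiff T.contMDiff_qhat _)
        (mdifferentiableAt_of_contMDiff (T.bundle.contMDiff_orbit c) _) Z
      simp only [T.qhat_action, T.action_one] at h
      exact h.symm
    have h3 := θ.val_act (IM := 𝓘(ℝ, EH)) (a := fun _ : Ghat => T.qhat c) (g := C.q) (m := 1)
      mdifferentiableAt_const (mdifferentiableAt_of_contMDiff C.contMDiff_q _) Z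
    rw [map_one, tder_const, maurerCartan_one, β.act_one] at h3
    simp only [zero_apply, map_zero, zero_add] at h3
    have h4 := C.dincl_nu hσ 1 Z
    rw [map_one, maurerCartan_one, maurerCartan_one] at h4
    change T.liftForm c (tder 𝓘(ℝ, EH) 𝓘(ℝ, EQ) (fun g => T.action c g) 1 Z) = Z
    rw [T.liftForm_apply, h1, h2, h3, h4, add_sub_cancel]
  form_act c g v := T.liftForm_action hσ c g v

theorem isCompatible (hσ : C.IsSplit σ) : T.lifting.IsCompatible θ (T.liftConnection hσ) := by
  suffices H : ∀ (c : Q) (v : EQ), C.dq (T.liftForm c v) =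
      θ.val (T.qhat c) (tder 𝓘(ℝ, EQ) 𝓘(ℝ, EB) T.qhat c v) from H
  intro c v
  rw [T.liftForm_apply, map_add, C.dq_dincl, hσ, add_zero]

theorem isScalarCurvature_zero (hσ : C.IsSplit σ) :
    T.lifting.IsScalarCurvature L (T.liftConnection hσ) 0 := by
  suffices H : ∀ (c : Q) (v w : EQ),
      L.bar (T.qhat c) ((T.liftConnection hσ).curvature c v w) = 0 from
    fun c v w => (H c v w).symm
  intro c v w
  have h1 := bar_curvature hσ θ L T.contMDiff_qhat (T.liftConnection hσ) α.smooth
    (fun _ _ => rfl) c v w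
  have h2 : ∀ v : EQ, tder 𝓘(ℝ, EQ) 𝓘(ℝ, EB) κ.proj c v =
      tder 𝓘(ℝ, EB) 𝓘(ℝ, EB) T.F (T.qhat c) (tder 𝓘(ℝ, EQ) 𝓘(ℝ, EB) T.qhat c v) := by
    intro v
    rw [← tder_comp_apply (mdifferentiableAt_of_contMDiff T.F.contMDiff _)
      (mdifferentiableAt_of_contMDiff T.contMDiff_qhat _)]
    simp only [T.F_qhat]
  have h3 : T.curv (κ.proj c) (tder 𝓘(ℝ, EQ) 𝓘(ℝ, EB) κ.proj c v)
      (tder 𝓘(ℝ, EQ) 𝓘(ℝ, EB) κ.proj c w) = extDer α.form c v w :=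
    (T.curv_eq c v w).trans (curvature_circle κ α c v w)
  have h4 : liftCurving θ L σ (T.qhat c) (tder 𝓘(ℝ, EQ) 𝓘(ℝ, EB) T.qhat c v)
      (tder 𝓘(ℝ, EQ) 𝓘(ℝ, EB) T.qhat c w) = T.curv (T.F (T.qhat c))
        (tder 𝓘(ℝ, EB) 𝓘(ℝ, EB) T.F (T.qhat c) (tder 𝓘(ℝ, EQ) 𝓘(ℝ, EB) T.qhat c v))
        (tder 𝓘(ℝ, EB) 𝓘(ℝ, EB) T.F (T.qhat c) (tder 𝓘(ℝ, EQ) 𝓘(ℝ, EB) T.qhat c w)) :=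
    T.curving_eq (T.qhat c) _ _
  rw [← h2, ← h2, T.F_qhat, h3] at h4
  rw [h4, sub_self] at h1
  exact h1

end IsoToDelta

end Backward

end LiftGerbe

end

theorem mainTheorem7
    -- the central extension of Lie groups
    {EH : Type*} [NormedAddCommGroup EH] [NormedSpace ℝ EH] [CompleteSpace EH]
    {Ghat : Type*} [TopologicalSpace Ghat] [ChartedSpace EH Ghat] [Group Ghat]
    [LieGroup 𝓘(ℝ, EH) ∞ Ghat]
    {EG : Type*} [NormedAddCommGroup EG] [NormedSpace ℝ EG] [CompleteSpace EG]
    {G : Type*} [TopologicalSpace G] [ChartedSpace EG G] [Group G] [LieGroup 𝓘(ℝ, EG) ∞ G]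
    (C : LiftGerbe.CentralExtension EH Ghat EG G)
    -- the principal bundle with connection and splitting
    {EX : Type*} [NormedAddCommGroup EX] [NormedSpace ℝ EX] [CompleteSpace EX]
    {X : Type*} [TopologicalSpace X] [ChartedSpace EX X] [IsManifold 𝓘(ℝ, EX) ∞ X]
    {EB : Type uEB} [NormedAddCommGroup EB] [NormedSpace ℝ EB] [CompleteSpace EB]
    {B : Type uB} [TopologicalSpace B] [ChartedSpace EB B] [IsManifold 𝓘(ℝ, EB) ∞ B]
    (β : LiftGerbe.PrincipalBundle EG G EB B EX X)
    (θ : LiftGerbe.Connection β) (L : LiftGerbe.Splitting C β)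
    -- the split of the Lie algebra
    (σ : EG →L[ℝ] EH) (hσ : C.IsSplit σ) :
    (∃ (EL : Type uEB) (_ : NormedAddCommGroup EL) (_ : NormedSpace ℝ EL) (_ : CompleteSpace EL)
      (Bhat : Type uB) (_ : TopologicalSpace Bhat) (_ : ChartedSpace EL Bhat)
      (_ : IsManifold 𝓘(ℝ, EL) ∞ Bhat)
      (Λ : LiftGerbe.Lifting C β EL Bhat) (θhat : LiftGerbe.Connection Λ.bundle),
      Λ.IsCompatible θ θhat ∧ Λ.IsScalarCurvature L θhat 0) ↔
    (LiftGerbe.liftingBundleGerbe θ L σ).IsTrivial := by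
  constructor
  · rintro ⟨EL, _, _, _, Bhat, _, _, _, Λ, θhat, hc, hK⟩
    exact ⟨B, _, _, ‹_›, β.proj, EL, _, _, ‹_›, Bhat, _, _, ‹_›, Λ.circleBundle,
      Λ.circleConnection σ θ θhat, Λ.isTrivial θhat hσ L hc hK⟩
  · rintro ⟨Y', _, _, _, π', EQ, _, _, _, Q, _, _, _, κ, α, ⟨T⟩⟩
    exact ⟨EQ, _, _, ‹_›, Q, _, _, ‹_›, T.lifting, T.liftConnection hσ, T.isCompatible hσ,
      T.isScalarCurvature_zero hσ⟩
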